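/- Let $H$ be a Hopf algebra over a field $k$, with comultiplication $h\mapsto\sum h_{(1)}\otimes h_{(2)}$ and counit $\varepsilon$, and let $A$ be a left $H$-module algebra: an associative unital $k$-algebra with a left $H$-module structure such that $h1_A=\varepsilon(h)1_A$ and $h(ab)=\sum (h_{(1)}a)(h_{(2)}b)$ for $h\in H$, $a,b\in A$. Suppose that $A$ is $H$-simple, i.e. $A$ has no $H$-stable two-sided ideals other than $0$ and $A$. Suppose that $A$ has semilocal localizations with respect to a central subring $Z$, i.e. for each maximal ideal $\mathfrak m$ of $Z$ the localization $A_{\mathfrak m}$ of $A$ at $Z\setminus\mathfrak m$ is semilocal (the factor ring of $A_{\mathfrak m}$ by its Jacobson radical is artinian) and $\mathfrak m A_{\mathfrak m}\subseteq \mathrm{Jac}(A_{\mathfrak m})$. Denote by $\mathcal M_R$ the category of right modules over a ring $R$. Let $M$ be an object of ${}_H\mathcal M_A$, i.e. a right $A$-module with a left $H$-module structure (inducing the same $k$-vector space structure) such that $h(va)=\sum (h_{(1)}v)(h_{(2)}a)$ for $h\in H$, $v\in M$, $a\in A$. Suppose that $M$ is locally $A$-finite, i.e. $M$ is the union of a directed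 family of $H$-stable $A$-submodules each of which is finitely generated over $A$. Then for each maximal two-sided ideal $Q$ of $A$ the right $A$-module $A/Q$ has finite length. Let $l$ be the greatest common divisor of these lengths. Then: (i) $M$ is projective in $\mathcal M_A$; if $M\ne 0$, then $M$ is a generator in $\mathcal M_A$. (ii) For each prime ideal $\mathfrak p$ of $Z$, the localization $M^l_{\mathfrak p}$ of $M^l$ at $Z\setminus\mathfrak p$ is a free right $A_{\mathfrak p}$-module. (iii) If $M$ is not finitely generated over $A$, then $M_{\mathfrak p}$ is a free right $A_{\mathfrak p}$-module for each prime ideal $\mathfrak p$ of $Z$. -/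

import Mathlib

/-!
Conventions. A right `R`-module is a module over the opposite ring `Rᵐᵒᵖ`: the right action of `a`
on `v` is `MulOpposite.op a • v`. A central subring `Z` of a ring `R` is a commutative ring `Z` with
an algebra structure `Algebra Z R` (so its image is central) whose structure map is injective.
-/

universe w

section ModuleAlgebras

variable (k H A M : Type*) [Field k] [Ring H] [HopfAlgebra k H] [Ring A] [Algebra k A]
  [Module H A] [AddCommGroup M] [Module k M] [Module H M] [Module Aᵐᵒᵖ M]

/-- `A`, a `k`-algebra with a left `H`-module structure, is a left `H`-module algebra:
`h 1 = ε(h) 1` and `h (a b) = ∑ (h₁ a) (h₂ b)`, where `∑ h₁ ⊗ h₂` is any expression of the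
comultiplication of `h` as a finite sum of pure tensors. -/
structure IsModuleAlgebra : Prop where
  smul_one : ∀ h : H, h • (1 : A) = algebraMap k A (Coalgebra.counit (R := k) h)
  smul_mul : ∀ (h : H) (𝓡 : Coalgebra.Repr k h (H × H)) (a b : A),
    h • (a * b) = ∑ i ∈ 𝓡.index, (𝓡.left i • a) * (𝓡.right i • b)

/-- `M` with its left `H`-module and right `A`-module structures is an object of the category
`_H M_A`: `h (v a) = ∑ (h₁ v) (h₂ a)`. -/
structure IsHopfModule : Prop where
  smul_op_smul : ∀ (h : H) (𝓡 : Coalgebra.Repr k h (H × H)) (v : M) (a : A),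
    h • (MulOpposite.op a • v) =
      ∑ i ∈ 𝓡.index, MulOpposite.op (𝓡.right i • a) • (𝓡.left i • v)

/-- The only `H`-stable two-sided ideals of `A` are `0` and `A`. -/
def IsHSimple : Prop :=
  ∀ I : TwoSidedIdeal A, (∀ (h : H), ∀ a ∈ I, h • a ∈ I) → I = ⊥ ∨ I = ⊤

/-- `M` is a directed union of `A`-finite subobjects: submodules over `A` which are stable under `H`
and finitely generated over `A`. -/
def IsLocallyAFinite : Prop :=
  ∃ F : Set (Submodule Aᵐᵒᵖ M), DirectedOn (· ≤ ·) F ∧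
    (∀ N ∈ F, N.FG ∧ ∀ (h : H), ∀ v ∈ N, h • v ∈ N) ∧ ∀ v : M, ∃ N ∈ F, v ∈ N

end ModuleAlgebras

section CentralLocalization

variable {Z : Type*} [CommRing Z] (R : Type*) [Ring R] [Algebra Z R]

/-- The image in `R` of the complement of a prime ideal `p` of the central subring `Z`. -/
def centralCompl (p : Ideal Z) [p.IsPrime] : Submonoid R :=
  Algebra.algebraMapSubmonoid R p.primeCompl

theorem mul_comm_of_mem_centralCompl (p : Ideal Z) [p.IsPrime] (s : centralCompl R p) (r : R) :
    (s : R) * r = r * s := by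
  obtain ⟨_, z, -, rfl⟩ := s
  exact Algebra.commutes z r

/-- Central elements satisfy the Ore condition. -/
instance (p : Ideal Z) [p.IsPrime] : OreLocalization.OreSet (centralCompl R p) where
  ore_right_cancel r₁ r₂ s h := ⟨s, by
    rw [mul_comm_of_mem_centralCompl, mul_comm_of_mem_centralCompl, h]⟩
  oreNum r _ := r
  oreDenom _ s := s
  ore_eq r s := mul_comm_of_mem_centralCompl R p s r

/-- The localization `X_p` of an `R`-module `X` at `Z \ p`; it is a module over the ring
`R_p = LocAt R p R`. With `R = Aᵐᵒᵖ` this gives the localizations of right `A`-modules, as modules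
over `(Aᵐᵒᵖ)_p = (A_p)ᵐᵒᵖ`, that is, as right `A_p`-modules. -/
abbrev LocAt (p : Ideal Z) [p.IsPrime] (X : Type*) [AddCommGroup X] [Module R X] :=
  OreLocalization (centralCompl R p) X

/-- The canonical ring homomorphism `Z → R → R_p`. -/
def LocAt.ofCentral (p : Ideal Z) [p.IsPrime] : Z →+* LocAt R p R :=
  OreLocalization.numeratorRingHom.comp (algebraMap Z R)

/-- `R / Jac(R)` is artinian. -/
def IsSemilocal (R : Type*) [Ring R] : Prop :=
  IsArtinianRing (R ⧸ Ring.jacobson R)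

variable (Z) in
/-- `R` has semilocal localizations with respect to `Z`: for each maximal ideal `m` of `Z` the ring
`R_m` is semilocal and `m R_m` is contained in its Jacobson radical. -/
def HasSemilocalLocalizations : Prop :=
  ∀ (m : Ideal Z) [m.IsMaximal], IsSemilocal (LocAt R m R) ∧
    m.map (LocAt.ofCentral R m) ≤ Ring.jacobson (LocAt R m R)

end CentralLocalization

/-- The composition length of `A / Q` as a right `A`-module, for a two-sided ideal `Q`. -/
noncomputable def quotientLength {A : Type*} [Ring A] (Q : TwoSidedIdeal A) : ℕ∞ :=
  Module.length Aᵐᵒᵖ (Aᵐᵒᵖ ⧸ TwoSidedIdeal.asIdealOpposite Q)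

/-- The greatest common divisor of the lengths of `A / Q`, for `Q` a maximal two-sided ideal. -/
noncomputable def gcdLength (A : Type*) [Ring A] : ℕ :=
  Nat.setGcd {n : ℕ | ∃ Q : TwoSidedIdeal A, IsCoatom Q ∧ quotientLength Q = n}

/-- `M` is a generator of the category of `R`-modules (in the universe `w`): morphisms `X → Y` which
agree after composition with all morphisms `M → X` are equal. -/
def IsGenerator (R M : Type*) [Ring R] [AddCommGroup M] [Module R M] : Prop :=
  ∀ (X Y : Type w) [AddCommGroup X] [AddCommGroup Y] [Module R X] [Module R Y]
    (f g : X →ₗ[R] Y), (∀ h : M →ₗ[R] X, f ∘ₗ h = g ∘ₗ h) → f = g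

/-! Right `A`-modules are treated as left modules over `R = Aᵐᵒᵖ`. The core is a comparison of
lengths. Let `t` be a multiplicative `d × d` matrix over `H` and `Q` a maximal two-sided ideal of
`R`. Each `x` in `M` gives a map `(R/Q)^d → (M/QM)^d` with matrix `(tᵢⱼ x)`. For `M = R` these maps
make `(R/Q)^d` a right `R`-module, and for general `M` they assemble to a map `(R/Q)^d ⊗_R M →
(M/QM)^d`, which is onto by the antipode axiom. Suppose that `M` is generated by `n` elements
locally on the maximal spectrum of `Z` and that `length (M/QM) = n * length (R/Q)` for one `Q`.
Counting lengths then forces the coefficients of any relation between the generators to act by zero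
on `(R/Q)^d`, up to powers of a central element. An element acting by zero for all `t` has all its
translates in `Q`, so it vanishes by `H`-simplicity. Hence `M` is locally free of rank `n`
(`isLocallyFreeOfRank_of_length_eq`).

The subring `Z` need not be `H`-stable, so the twisted action of `z` on `(R/Q)^d` is not
multiplication by `z`. Fitting's lemma (`exists_fitting`) separates the part where `z` acts
invertibly from the part where it acts nilpotently, and `flatIdeal` records what is known about
relations after inverting `z`.

For finite `M` the ratio `length (M/QM) / length (R/Q)` attains a maximum at some `Q₀`
(`exists_max_length_ratio`). With `t = length (R/Q₀)` and `n = length (M/Q₀M)`, the power `M^t` is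
locally generated by `n` elements, with equality of lengths at `Q₀`, so it is locally free. The
ratio is therefore constant, and divisibility replaces `t` by the gcd `l`
(`exists_isLocallyFreeOfRank_pi`). Projectivity and the generator property follow.

A locally finite `M` has a transfinite filtration whose factors are finite objects, hence
projective, so `M` is a direct sum of modules `Cᵢ` of the finite kind
(`exists_isInternal_isHopfObject`). If `M` is not finite there are infinitely many summands. Any `l`
of them whose ranks agree modulo `l` form a locally free block, so `M_p` has a large free summand
while `M_p^l` is free of the same rank, and Eilenberg's swindle makes `M_p` free. -/

/-! ### Multiplicative matrices over a coalgebra. -/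

section Comatrices

open TensorProduct Coalgebra

variable {k H : Type*} [Field k]

/-- A square matrix over a coalgebra is multiplicative: `Δ tᵢⱼ = ∑ tᵢₗ ⊗ tₗⱼ`, `ε tᵢⱼ = δᵢⱼ`. -/
structure IsComatrix (k : Type*) {H : Type*} [Field k] [AddCommGroup H] [Module k H] [Coalgebra k H]
    {d : ℕ} (t : Fin d → Fin d → H) : Prop where
  comul : ∀ i j, comul (R := k) (t i j) = ∑ l, t i l ⊗ₜ[k] t l j
  counit : ∀ i j, counit (R := k) (t i j) = if i = j then 1 else 0

variable [AddCommGroup H] [Module k H] [Coalgebra k H]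

/-- Every element of a coalgebra over a field lies in a finite-dimensional left coideal. -/
theorem exists_leftCoideal (h : H) : ∃ V : Submodule k H, FiniteDimensional k V ∧ h ∈ V ∧
    ∀ v ∈ V, comul (R := k) v ∈ LinearMap.range (V.subtype.lTensor H) := by
  classical
  let b := Module.Basis.ofVectorSpace k H
  let y := TensorProduct.equivFinsuppOfBasisLeft (N := H) b (comul (R := k) h)
  have hy : comul (R := k) h = ∑ i ∈ y.support, b i ⊗ₜ[k] y i := by
    have := (TensorProduct.equivFinsuppOfBasisLeft (N := H) b).symm_apply_apply (comul (R := k) h)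
    rw [TensorProduct.equivFinsuppOfBasisLeft_symm_apply] at this
    exact this.symm
  -- The span of the right-hand coefficients of `Δ h`. The counit puts `h` in it, and
  -- coassociativity makes it a left coideal.
  let V : Submodule k H := Submodule.span k (y '' y.support)
  have hyV : ∀ i, y i ∈ V := fun i => by
    by_cases hi : i ∈ y.support
    · exact Submodule.subset_span ⟨i, hi, rfl⟩
    · rw [Finsupp.notMem_support_iff.1 hi]; exact V.zero_mem
  refine ⟨V, FiniteDimensional.span_of_finite k (y.support.finite_toSet.image _), ?_, ?_⟩
  · have h1 := LinearMap.congr_fun (rTensor_counit_comp_comul (R := k) (A := H)) h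
    simp only [LinearMap.comp_apply, hy, map_sum, LinearMap.rTensor_tmul] at h1
    have h2 := congrArg (TensorProduct.lid k H) h1
    simp only [map_sum, TensorProduct.lid_tmul, TensorProduct.mk_apply, one_smul] at h2
    rw [← h2]
    exact V.sum_mem fun i _ => V.smul_mem _ (hyV i)
  · intro v hv
    induction hv using Submodule.span_induction with
    | zero => rw [map_zero]; exact Submodule.zero_mem _
    | add x z _ _ hx hz => rw [map_add]; exact Submodule.add_mem _ hx hz
    | smul c x _ hx => rw [map_smul]; exact Submodule.smul_mem _ _ hx
    | mem x hx =>
      obtain ⟨i, -, rfl⟩ := hx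
      let φ : H ⊗[k] (H ⊗[k] H) →ₗ[k] H ⊗[k] H :=
        (TensorProduct.lid k (H ⊗[k] H)).toLinearMap ∘ₗ (b.coord i).rTensor (H ⊗[k] H)
      have h1 := congrArg φ (coassoc_apply (R := k) h)
      have h2 : φ (comul.lTensor H (comul (R := k) h)) = comul (R := k) (y i) := by
        rw [hy]
        simp only [map_sum, LinearMap.lTensor_tmul, φ, LinearMap.comp_apply, LinearMap.rTensor_tmul,
          LinearEquiv.coe_coe, TensorProduct.lid_tmul, Module.Basis.coord_apply,
          Module.Basis.repr_self, Finsupp.single_apply, ite_smul, one_smul, zero_smul]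
        rw [Finset.sum_ite_eq']
        split_ifs with hi
        · rfl
        · rw [Finsupp.notMem_support_iff.1 hi, map_zero]
      rw [← h2, ← h1, hy]
      simp only [map_sum, LinearMap.rTensor_tmul]
      refine Submodule.sum_mem _ fun j _ => ?_
      generalize comul (R := k) (b j) = u
      induction u with
      | zero => simp
      | add u w hu hw =>
        rw [add_tmul, map_add, map_add]; exact Submodule.add_mem _ hu hw
      | tmul p q =>
        refine ⟨(b.coord i p • q) ⊗ₜ ⟨y j, hyV j⟩, ?_⟩
        simp [φ, TensorProduct.smul_tmul']

/-- Every element of a coalgebra over a field is a linear combination of the entries of a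
multiplicative matrix. -/
theorem exists_isComatrix (h : H) : ∃ (d : ℕ) (t : Fin d → Fin d → H), IsComatrix k t ∧
    ∃ c : Fin d → Fin d → k, h = ∑ i, ∑ j, c i j • t i j := by
  classical
  obtain ⟨V, hV, hh, hΔ⟩ := exists_leftCoideal (k := k) h
  let f := Module.finBasis k V
  have key : ∀ p, ∃ u : Fin (Module.finrank k V) → H,
      comul (R := k) (f p : H) = ∑ q, u q ⊗ₜ[k] (f q : H) := fun p => by
    obtain ⟨w, hw⟩ := hΔ (f p) (f p).2
    refine ⟨fun q => TensorProduct.equivFinsuppOfBasisRight (M := H) f w q, ?_⟩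
    have := (TensorProduct.equivFinsuppOfBasisRight (M := H) f).symm_apply_apply w
    rw [TensorProduct.equivFinsuppOfBasisRight_symm_apply, Finsupp.sum_fintype _ _ (by simp)] at this
    rw [← hw]
    conv_lhs => rw [← this]
    simp
  choose t ht using key
  -- Functionals on all of `H` dual to the basis `f`: they extract the coefficient of `f r` from the
  -- coassociativity and counit identities.
  have hdual : ∀ r, ∃ ψ : H →ₗ[k] k, ∀ q, ψ (f q : H) = if q = r then 1 else 0 := fun r => by
    obtain ⟨ψ, hψ⟩ := LinearMap.exists_extend (f.coord r)
    refine ⟨ψ, fun q => ?_⟩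
    have := LinearMap.congr_fun hψ (f q)
    simpa [Finsupp.single_apply] using this
  choose ψ hψ using hdual
  have hε : ∀ p, (f p : H) = ∑ q, counit (R := k) (t p q) • (f q : H) := fun p => by
    have h1 := LinearMap.congr_fun (rTensor_counit_comp_comul (R := k) (A := H)) (f p : H)
    simp only [LinearMap.comp_apply, ht, map_sum, LinearMap.rTensor_tmul] at h1
    have h2 := congrArg (TensorProduct.lid k H) h1
    simp only [map_sum, TensorProduct.lid_tmul, TensorProduct.mk_apply, one_smul] at h2
    exact h2.symm
  have hε' : ∀ p, (f p : H) = ∑ q, counit (R := k) (f q : H) • t p q := fun p => by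
    have h1 := LinearMap.congr_fun (lTensor_counit_comp_comul (R := k) (A := H)) (f p : H)
    simp only [LinearMap.comp_apply, ht, map_sum, LinearMap.lTensor_tmul] at h1
    have h2 := congrArg (TensorProduct.rid k H) h1
    simp only [map_sum, TensorProduct.rid_tmul, LinearMap.flip_apply, TensorProduct.mk_apply,
      one_smul] at h2
    exact h2.symm
  refine ⟨_, t, ⟨fun p r => ?_, fun p r => ?_⟩, ?_⟩
  · let φ : H ⊗[k] (H ⊗[k] H) →ₗ[k] H ⊗[k] H :=
      ((TensorProduct.rid k H).toLinearMap ∘ₗ (ψ r).lTensor H).lTensor H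
    have h1 := congrArg φ (coassoc_apply (R := k) (f p : H))
    have h2 : φ (comul.lTensor H (comul (R := k) (f p : H))) = ∑ q, t p q ⊗ₜ[k] t q r := by
      have h4 : ∀ a b c : H, φ (a ⊗ₜ[k] (b ⊗ₜ[k] c)) = ψ r c • a ⊗ₜ[k] b := fun a b c => by
        simp [φ]
      rw [ht]
      simp only [map_sum, LinearMap.lTensor_tmul, ht, tmul_sum, h4, hψ, ite_smul, one_smul,
        zero_smul]
      simp
    rw [← h2, ← h1, ht]
    have h3 : ∀ (u : H ⊗[k] H) (v : H),
        φ ((TensorProduct.assoc k H H H) (u ⊗ₜ[k] v)) = ψ r v • u := fun u v => by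
      induction u with
      | zero => simp
      | add u w hu hw => rw [add_tmul, map_add, map_add, hu, hw, smul_add]
      | tmul a c => simp [φ]
    simp only [map_sum, LinearMap.rTensor_tmul, h3, hψ, ite_smul, one_smul, zero_smul]
    simp
  · have h1 := congrArg (ψ r) (hε p)
    simp only [map_sum, map_smul, hψ, smul_eq_mul, mul_ite, mul_one, mul_zero] at h1
    simpa using h1.symm
  · refine ⟨fun p q => f.repr ⟨h, hh⟩ p * counit (R := k) (f q : H), ?_⟩
    have h1 := congrArg V.subtype (f.sum_repr ⟨h, hh⟩)
    simp only [map_sum, map_smul, Submodule.subtype_apply] at h1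
    refine h1.symm.trans (Finset.sum_congr rfl fun p _ => ?_)
    conv_lhs => rw [hε' p]
    simp [Finset.smul_sum, mul_smul]

end Comatrices

/-! ### Length estimates for submodules. -/

section LengthLemmas

variable {R X Y : Type*} [Ring R] [AddCommGroup X] [Module R X] [AddCommGroup Y] [Module R Y]

theorem length_range_le (f : X →ₗ[R] Y) : Module.length R (LinearMap.range f) ≤ Module.length R X :=
  Module.length_le_of_surjective f.rangeRestrict f.surjective_rangeRestrict

theorem length_mono {A B : Submodule R X} (h : A ≤ B) : Module.length R A ≤ Module.length R B :=
  Module.length_le_of_injective (Submodule.inclusion h) (Submodule.inclusion_injective h)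

theorem length_sup_le (A B : Submodule R X) :
    Module.length R (A ⊔ B : Submodule R X) ≤ Module.length R A + Module.length R B := by
  have h : A ⊔ B = LinearMap.range (A.subtype.coprod B.subtype) := by
    rw [LinearMap.range_coprod, Submodule.range_subtype, Submodule.range_subtype]
  rw [h, ← Module.length_prod]
  exact length_range_le _

theorem length_eq_map_add_inf_ker (N : Submodule R X) (g : X →ₗ[R] Y) :
    Module.length R N = Module.length R (N.map g) + Module.length R (N ⊓ LinearMap.ker g : Submodule R X) := by
  rw [add_comm]
  refine Module.length_eq_add_of_exact (Submodule.inclusion inf_le_left) (g.submoduleMap N)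
    (Submodule.inclusion_injective _) (g.submoduleMap_surjective N) ?_
  intro x
  constructor
  · intro hx
    refine ⟨⟨x, x.2, ?_⟩, rfl⟩
    simpa using congrArg Subtype.val hx
  · rintro ⟨y, rfl⟩
    exact Subtype.ext y.2.2

end LengthLemmas

/-! ### Twisted actions on `(R/Q)^d` and the map onto `(M/N)^d`. -/

section Equivariance

open TensorProduct Coalgebra

variable {k H R M : Type*} [Field k] [Ring H] [HopfAlgebra k H] [Ring R] [AddCommGroup M] [Module R M]

/-- Compatibility of actions of a Hopf algebra `H` on a left `R`-module `M` and on the ring `R`: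
`h (r x) = ∑ (h₂ r) (h₁ x)`, expressed for the entries of multiplicative matrices. -/
def IsEquivariant (k : Type*) {H R M : Type*} [Field k] [Ring H] [HopfAlgebra k H] [Ring R]
    [AddCommGroup M] [Module R M] (σ : H →+* AddMonoid.End R) (ρ : H →+* AddMonoid.End M) : Prop :=
  ∀ ⦃d : ℕ⦄ ⦃t : Fin d → Fin d → H⦄, IsComatrix k t → ∀ i j r x,
    ρ (t i j) (r • x) = ∑ l, σ (t l j) r • ρ (t i l) x

/-- An `H`-action on the opposite of an `H`-module algebra, such that no nonzero element has all its
translates in a proper two-sided ideal. -/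
structure IsSimpleAction (k : Type*) {H R : Type*} [Field k] [Ring H] [HopfAlgebra k H] [Ring R]
    (σ : H →+* AddMonoid.End R) : Prop where
  one : ∀ ⦃d : ℕ⦄ ⦃t : Fin d → Fin d → H⦄, IsComatrix k t → ∀ i j,
    σ (t i j) 1 = if i = j then 1 else 0
  equivariant : IsEquivariant k σ σ
  simple : ∀ Q : Ideal R, Q.IsTwoSided → Q ≠ ⊤ → ∀ a, (∀ ⦃d : ℕ⦄ ⦃t : Fin d → Fin d → H⦄,
    IsComatrix k t → ∀ i j, σ (t i j) a ∈ Q) → a = 0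

theorem IsComatrix.sum_mul_antipode {d : ℕ} {t : Fin d → Fin d → H} (ht : IsComatrix k t)
    (i j : Fin d) :
    ∑ l, t i l * HopfAlgebra.antipode k (t l j) = if i = j then 1 else 0 := by
  have h := LinearMap.congr_fun (HopfAlgebra.mul_antipode_lTensor_comul (R := k) (A := H)) (t i j)
  simp only [LinearMap.comp_apply, ht.comul, map_sum, LinearMap.lTensor_tmul,
    LinearMap.mul'_apply, ht.counit, Algebra.linearMap_apply] at h
  rw [h]
  split_ifs <;> simp

variable {Q : Ideal R} {N : Submodule R M} (hN : ∀ q ∈ Q, ∀ x : M, q • x ∈ N)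

/-- The map `R / Q → M / N`, `r ↦ r x`. -/
def quotientSMul (x : M) : R ⧸ Q →ₗ[R] M ⧸ N :=
  Submodule.liftQ Q (N.mkQ ∘ₗ LinearMap.toSpanSingleton R M x) fun q hq => by
    exact (Submodule.Quotient.mk_eq_zero N).2 (hN q hq x)

theorem quotientSMul_mk (x : M) (r : R) :
    quotientSMul hN x (Submodule.Quotient.mk r) = Submodule.Quotient.mk (r • x) := rfl

variable (ρ : H →+* AddMonoid.End M) {d : ℕ} (t : Fin d → Fin d → H)

/-- The map `(R / Q)ᵈ → (M / N)ᵈ` given by the matrix `(tᵢⱼ x)`. -/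
def matrixAct (x : M) : (Fin d → R ⧸ Q) →ₗ[R] (Fin d → M ⧸ N) :=
  LinearMap.pi fun i => ∑ j, quotientSMul hN (ρ (t i j) x) ∘ₗ LinearMap.proj j

theorem matrixAct_mk (x : M) (f : Fin d → R) (i : Fin d) :
    matrixAct hN ρ t x (fun j => Submodule.Quotient.mk (f j)) i =
      Submodule.Quotient.mk (∑ j, f j • ρ (t i j) x) := by
  simp only [matrixAct, LinearMap.pi_apply, LinearMap.sum_apply, LinearMap.comp_apply,
    LinearMap.proj_apply, quotientSMul_mk]
  exact (map_sum N.mkQ _ _).symm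

theorem exists_pi_mk (f : Fin d → R ⧸ Q) :
    ∃ g : Fin d → R, f = fun j => Submodule.Quotient.mk (g j) := by
  choose g hg using fun j => Submodule.Quotient.mk_surjective Q (f j)
  exact ⟨g, funext fun j => (hg j).symm⟩

theorem matrixAct_add (x y : M) :
    matrixAct hN ρ t (x + y) = matrixAct hN ρ t x + matrixAct hN ρ t y := by
  refine LinearMap.ext fun f => ?_
  obtain ⟨g, rfl⟩ := exists_pi_mk f
  funext i
  rw [LinearMap.add_apply, Pi.add_apply, matrixAct_mk, matrixAct_mk, matrixAct_mk,
    ← Submodule.Quotient.mk_add, ← Finset.sum_add_distrib]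
  simp [map_add, smul_add]

/-- `matrixAct` as an additive map. -/
def matrixActHom : M →+ ((Fin d → R ⧸ Q) →ₗ[R] (Fin d → M ⧸ N)) :=
  AddMonoidHom.mk' (matrixAct hN ρ t) (matrixAct_add hN ρ t)

theorem matrixActHom_mk (x : M) (f : Fin d → R) (i : Fin d) :
    matrixActHom hN ρ t x (fun j => Submodule.Quotient.mk (f j)) i =
      Submodule.Quotient.mk (∑ j, f j • ρ (t i j) x) :=
  matrixAct_mk hN ρ t x f i

variable {ρ t}

/-- The place where the antipode `S` enters. The vector with `x` in position `j` is the sum over `l`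
of the matrix of `S(tₗⱼ) x` applied to the `l`-th unit vector, because `∑ tᵢₗ S(tₗⱼ) = δᵢⱼ`. -/
theorem iSup_range_matrixActHom (ht : IsComatrix k t) :
    ⨆ x : M, LinearMap.range (matrixActHom hN ρ t x) = ⊤ := by
  classical
  rw [eq_top_iff]
  rintro y -
  rw [← Finset.univ_sum_single y]
  refine Submodule.sum_mem _ fun j _ => ?_
  obtain ⟨x, hx⟩ := Submodule.Quotient.mk_surjective N (y j)
  have h : Pi.single j (y j) = ∑ l, matrixActHom hN ρ t (ρ (HopfAlgebra.antipode k (t l j)) x)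
      (fun p => Submodule.Quotient.mk (Pi.single (M := fun _ => R) l 1 p)) := by
    funext i
    rw [Finset.sum_apply]
    simp only [matrixActHom_mk]
    have h1 : ∀ l, ∑ p, (Pi.single l 1 : Fin d → R) p • ρ (t i p)
        (ρ (HopfAlgebra.antipode k (t l j)) x) = ρ (t i l * HopfAlgebra.antipode k (t l j)) x := by
      intro l
      rw [Finset.sum_eq_single l (fun p _ hp => by simp [Pi.single_eq_of_ne hp]) (by simp)]
      simp
    simp only [h1]
    change _ = ∑ l, N.mkQ _
    rw [← map_sum]
    have h2 : ∑ l, ρ (t i l * HopfAlgebra.antipode k (t l j)) x =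
        ρ (∑ l, t i l * HopfAlgebra.antipode k (t l j)) x := by
      rw [map_sum]; exact (AddMonoidHom.finsetSum_apply _ _ x).symm
    rw [h2, ht.sum_mul_antipode]
    by_cases hij : i = j
    · subst hij; simp [hx]
    · simp [hij]
  rw [h]
  exact Submodule.sum_mem _ fun l _ => Submodule.mem_iSup_of_mem _ ⟨_, rfl⟩

/-- The span of all `x n` for `x ∈ M`, `n ∈ L`. -/
def actSpan (ρ : H →+* AddMonoid.End M) (t : Fin d → Fin d → H)
    (L : Submodule R (Fin d → R ⧸ Q)) : Submodule R (Fin d → M ⧸ N) :=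
  ⨆ x : M, L.map (matrixActHom hN ρ t x)

theorem actSpan_sup (L L' : Submodule R (Fin d → R ⧸ Q)) :
    actSpan hN ρ t (L ⊔ L') = actSpan hN ρ t L ⊔ actSpan hN ρ t L' := by
  simp only [actSpan, Submodule.map_sup, iSup_sup_eq]

theorem actSpan_mono {L L' : Submodule R (Fin d → R ⧸ Q)} (h : L ≤ L') :
    actSpan hN ρ t L ≤ actSpan hN ρ t L' :=
  iSup_mono fun _ => Submodule.map_mono h

/-- The map `Lⁿ → (M / N)ᵈ`, `(xᵢ) ↦ ∑ vᵢ xᵢ`. -/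
def actSum (ρ : H →+* AddMonoid.End M) (t : Fin d → Fin d → H)
    (L : Submodule R (Fin d → R ⧸ Q)) {n : ℕ} (v : Fin n → M) :
    (Fin n → L) →ₗ[R] (Fin d → M ⧸ N) :=
  ∑ i, (matrixActHom hN ρ t (v i) ∘ₗ L.subtype) ∘ₗ LinearMap.proj i

theorem actSum_apply (L : Submodule R (Fin d → R ⧸ Q)) {n : ℕ} (v : Fin n → M) (c : Fin n → L) :
    actSum hN ρ t L v c = ∑ i, matrixActHom hN ρ t (v i) (c i) := by
  simp [actSum]

theorem mul_right_mem_of_isTwoSided [Q.IsTwoSided] : ∀ q ∈ Q, ∀ x : R, q • x ∈ Q := fun _ hq x =>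
  Q.mul_mem_right x hq

/-- The map `matrixAct` for the module `R` itself. -/
abbrev matrixMul (Q : Ideal R) [Q.IsTwoSided] (σ : H →+* AddMonoid.End R) {d : ℕ}
    (t : Fin d → Fin d → H) : R →+ ((Fin d → R ⧸ Q) →ₗ[R] (Fin d → R ⧸ Q)) :=
  matrixActHom (M := R) (N := Q) mul_right_mem_of_isTwoSided σ t

variable {σ : H →+* AddMonoid.End R} [Q.IsTwoSided]

/-- Balancedness: `f ⊗ r x` and `f r ⊗ x` have the same image, so the maps factor through a tensor
product over `R`. -/
theorem matrixActHom_smul (hρ : IsEquivariant k σ ρ) (ht : IsComatrix k t) (r : R) (x : M) :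
    matrixActHom hN ρ t (r • x) = matrixActHom hN ρ t x ∘ₗ matrixMul Q σ t r := by
  refine LinearMap.ext fun f => ?_
  obtain ⟨g, rfl⟩ := exists_pi_mk f
  have h : matrixMul Q σ t r (fun j => Submodule.Quotient.mk (g j)) =
      fun i => Submodule.Quotient.mk (∑ j, g j • σ (t i j) r) :=
    funext fun i => matrixActHom_mk _ _ _ _ _ _
  funext i
  rw [LinearMap.comp_apply, h, matrixActHom_mk, matrixActHom_mk]
  congr 1
  simp only [hρ ht, Finset.smul_sum, Finset.sum_smul]
  rw [Finset.sum_comm]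
  simp [mul_smul]

/-- Since `L = L s`, any `f ⊗ x` can be written as `g s ⊗ x = g ⊗ s x`. Here `s x` is a combination
of the `vᵢ`, whose coefficients move back into `L`. -/
theorem actSpan_le_range_actSum (hρ : IsEquivariant k σ ρ) (ht : IsComatrix k t)
    {L : Submodule R (Fin d → R ⧸ Q)} (hL : ∀ r, L.map (matrixMul Q σ t r) ≤ L)
    {n : ℕ} {v : Fin n → M} {s : R} (hv : ∀ x, s • x ∈ Submodule.span R (Set.range v))
    (hs : L ≤ L.map (matrixMul Q σ t s)) :
    actSpan hN ρ t L ≤ LinearMap.range (actSum hN ρ t L v) := by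
  refine iSup_le fun x => ?_
  rintro _ ⟨f, hf, rfl⟩
  obtain ⟨g, hg, rfl⟩ := hs hf
  obtain ⟨c, hc⟩ := (Submodule.mem_span_range_iff_exists_fun R).1 (hv x)
  have h1 : matrixActHom hN ρ t x (matrixMul Q σ t s g) = matrixActHom hN ρ t (s • x) g := by
    rw [matrixActHom_smul hN hρ ht]; rfl
  refine ⟨fun i => ⟨matrixMul Q σ t (c i) g, hL _ ⟨g, hg, rfl⟩⟩, ?_⟩
  rw [h1, actSum_apply, ← hc, map_sum, LinearMap.sum_apply]
  refine Finset.sum_congr rfl fun i _ => ?_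
  rw [matrixActHom_smul hN hρ ht]; rfl

theorem length_actSpan_le_of_le_map (hρ : IsEquivariant k σ ρ) (ht : IsComatrix k t)
    {L : Submodule R (Fin d → R ⧸ Q)} (hL : ∀ r, L.map (matrixMul Q σ t r) ≤ L)
    {n : ℕ} {v : Fin n → M} {s : R} (hv : ∀ x, s • x ∈ Submodule.span R (Set.range v))
    (hs : L ≤ L.map (matrixMul Q σ t s)) :
    Module.length R (actSpan hN ρ t L) ≤ n * Module.length R L := by
  refine (length_mono (actSpan_le_range_actSum hN hρ ht hL hv hs)).trans
    ((length_range_le _).trans ?_)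
  rw [Module.length_pi_of_fintype]
  simp

end Equivariance

theorem Ideal.span_range_pow_of_span_range {Z ι : Type*} [CommRing Z] {s : ι → Z}
    (hs : Ideal.span (Set.range s) = ⊤) (e : ι → ℕ) :
    Ideal.span (Set.range fun j => s j ^ e j) = ⊤ := by
  by_contra h
  obtain ⟨m, hm, hle⟩ := Ideal.exists_le_maximal _ h
  refine hm.ne_top (top_le_iff.1 (hs ▸ Ideal.span_le.2 ?_))
  rintro _ ⟨j, rfl⟩
  exact hm.isPrime.mem_of_pow_mem _ (hle (Ideal.subset_span ⟨j, rfl⟩))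

/-! ### Fitting decomposition for central elements and control of relations. -/

section CentralFitting

variable {k H R M Z : Type*} [Field k] [Ring H] [HopfAlgebra k H] [Ring R] [AddCommGroup M]
  [Module R M] [CommRing Z] [Algebra Z R] {Q : Ideal R} [Q.IsTwoSided]
  {σ : H →+* AddMonoid.End R} {d : ℕ} {t : Fin d → Fin d → H}

/-- The reversed order means that `matrixMul` is a right action of `R`. -/
theorem matrixMul_mul (hσ : IsSimpleAction k σ) (ht : IsComatrix k t) (r x : R) :
    matrixMul Q σ t (r * x) = matrixMul Q σ t x ∘ₗ matrixMul Q σ t r :=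
  matrixActHom_smul (M := R) (N := Q) _ hσ.equivariant ht r x

theorem matrixMul_one (hσ : IsSimpleAction k σ) (ht : IsComatrix k t) :
    matrixMul Q σ t 1 = LinearMap.id := by
  refine LinearMap.ext fun f => ?_
  obtain ⟨g, rfl⟩ := exists_pi_mk f
  funext i
  rw [matrixActHom_mk]
  simp [hσ.one ht]

/-- The ideal of elements of `Z` acting by zero on `L ≤ (R / Q)ᵈ` after multiplication by `a`. -/
def killingIdeal (Z : Type*) [CommRing Z] [Algebra Z R] (hσ : IsSimpleAction k σ)
    (ht : IsComatrix k t) (L : Submodule R (Fin d → R ⧸ Q)) (a : R) : Ideal Z where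
  carrier := {z | ∀ f ∈ L, matrixMul Q σ t (algebraMap Z R z * a) f = 0}
  add_mem' {x y} hx hy f hf := by
    rw [map_add, add_mul, map_add, LinearMap.add_apply, hx f hf, hy f hf, add_zero]
  zero_mem' f _ := by simp
  smul_mem' c z hz f hf := by
    have h : algebraMap Z R (c • z) * a = algebraMap Z R z * a * algebraMap Z R c := by
      rw [smul_eq_mul, mul_comm, map_mul, mul_assoc, Algebra.commutes c a, ← mul_assoc]
    have hz' := hz f hf
    rw [h, matrixMul_mul hσ ht, LinearMap.comp_apply, hz', map_zero]

/-- Fitting's lemma for the operator given by `z`. As `z` is central, this operator commutes with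
the right action of `R`, so the image and the kernel of a stable power are again sub-bimodules. -/
theorem exists_fitting [IsNoetherian R (R ⧸ Q)] [IsArtinian R (R ⧸ Q)]
    (hσ : IsSimpleAction k σ) (ht : IsComatrix k t)
    {L : Submodule R (Fin d → R ⧸ Q)} (hL : ∀ r, L.map (matrixMul Q σ t r) ≤ L) (z : Z) :
    ∃ e : ℕ, ∃ L₁ L₂ : Submodule R (Fin d → R ⧸ Q),
      L₁ = L.map (matrixMul Q σ t (algebraMap Z R (z ^ e))) ∧
      L₂ = L ⊓ LinearMap.ker (matrixMul Q σ t (algebraMap Z R (z ^ e))) ∧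
      (∀ r, L₁.map (matrixMul Q σ t r) ≤ L₁) ∧ (∀ r, L₂.map (matrixMul Q σ t r) ≤ L₂) ∧
      L ≤ L₁ ⊔ L₂ ∧ L₁ ≤ L₁.map (matrixMul Q σ t (algebraMap Z R z)) ∧
      Module.length R L = Module.length R L₁ + Module.length R L₂ := by
  let P : ℕ → Submodule R (Fin d → R ⧸ Q) := fun e => L.map (matrixMul Q σ t (algebraMap Z R (z ^ e)))
  have hadd : ∀ e f, P (e + f) = (P e).map (matrixMul Q σ t (algebraMap Z R (z ^ f))) := fun e f => by
    simp only [P]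
    rw [← Submodule.map_comp, ← matrixMul_mul hσ ht, pow_add, map_mul]
  have hcomm : ∀ (e : ℕ) (r : R) f, matrixMul Q σ t r (matrixMul Q σ t (algebraMap Z R (z ^ e)) f) =
      matrixMul Q σ t (algebraMap Z R (z ^ e)) (matrixMul Q σ t r f) := fun e r f => by
    rw [← LinearMap.comp_apply, ← LinearMap.comp_apply, ← matrixMul_mul hσ ht,
      ← matrixMul_mul hσ ht, Algebra.commutes]
  have hstab : ∀ e r, (P e).map (matrixMul Q σ t r) ≤ P e := by
    rintro e r _ ⟨_, ⟨f, hf, rfl⟩, rfl⟩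
    exact ⟨matrixMul Q σ t r f, hL r ⟨f, hf, rfl⟩, (hcomm e r f).symm⟩
  have hanti : Antitone P := antitone_nat_of_succ_le fun e => by
    rw [hadd e 1]; exact hstab e _
  obtain ⟨e, he⟩ := IsArtinian.monotone_stabilizes (R := R) ⟨fun e => OrderDual.toDual (P e),
    fun a b hab => hanti hab⟩
  have he' : ∀ m, e ≤ m → P e = P m := he
  refine ⟨e, P e, _, rfl, rfl, hstab e, ?_, ?_, ?_, length_eq_map_add_inf_ker L _⟩
  · rintro r _ ⟨f, ⟨hf, hf'⟩, rfl⟩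
    refine ⟨hL r ⟨f, hf, rfl⟩, ?_⟩
    have hf'' := LinearMap.mem_ker.1 hf'
    exact LinearMap.mem_ker.2 (by rw [← hcomm, hf'', map_zero])
  · intro f hf
    have h1 : matrixMul Q σ t (algebraMap Z R (z ^ e)) f ∈ P (e + e) := by
      rw [← he' _ (Nat.le_add_left _ _)]; exact ⟨f, hf, rfl⟩
    rw [hadd] at h1
    obtain ⟨g, hg, hg'⟩ := h1
    have hgL : g ∈ L := by
      obtain ⟨f', hf', rfl⟩ := hg
      exact hL _ ⟨f', hf', rfl⟩
    rw [← add_sub_cancel g f]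
    refine Submodule.add_mem_sup hg ⟨L.sub_mem hf hgL, ?_⟩
    exact LinearMap.mem_ker.2 (by rw [map_sub, hg', sub_self])
  · have := hadd e 1
    rw [pow_one] at this
    rw [← this]
    exact (he' _ (Nat.le_succ e)).le

variable {ρ : H →+* AddMonoid.End M} {N : Submodule R M} (hN : ∀ q ∈ Q, ∀ x : M, q • x ∈ N)
  {ι : Type*} {s : ι → Z} {n : ℕ} {v : ι → Fin n → M}

/-- Only the submodules `s j • M` are covered by `n` generators, so `L` is split for some `s j`. The
part where `s j` is invertible is bounded directly, and the nilpotent part is smaller and falls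
under induction. If no splitting shrinks `L`, every `s j` is nilpotent on `L`, and `L = 0` because
the powers still generate `Z`. -/
theorem length_actSpan_le [IsNoetherian R (R ⧸ Q)] [IsArtinian R (R ⧸ Q)]
    (hσ : IsSimpleAction k σ) (hρ : IsEquivariant k σ ρ) (ht : IsComatrix k t)
    (hs : Ideal.span (Set.range s) = ⊤)
    (hv : ∀ j x, algebraMap Z R (s j) • x ∈ Submodule.span R (Set.range (v j)))
    (L : Submodule R (Fin d → R ⧸ Q)) (hL : ∀ r, L.map (matrixMul Q σ t r) ≤ L) :
    Module.length R (actSpan hN ρ t L) ≤ n * Module.length R L := by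
  induction L using WellFoundedLT.induction with
  | ind L ih =>
    choose e L₁ L₂ h₁ h₂ hL₁ hL₂ hsup hsurj hlen using fun j => exists_fitting hσ ht hL (s j)
    by_cases hj : ∃ j, L₂ j < L
    · obtain ⟨j, hj⟩ := hj
      refine (length_mono (actSpan_mono hN (hsup j))).trans ?_
      rw [actSpan_sup hN, hlen j, mul_add]
      exact (length_sup_le _ _).trans (add_le_add
        (length_actSpan_le_of_le_map hN hρ ht (hL₁ j) (hv j) (hsurj j)) (ih _ hj (hL₂ j)))
    · have h : ∀ j, L₂ j = L := fun j => by
        by_contra hne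
        exact hj ⟨j, lt_of_le_of_ne (by rw [h₂ j]; exact inf_le_left) hne⟩
      have hspan : Ideal.span (Set.range fun j => s j ^ e j) = ⊤ :=
        Ideal.span_range_pow_of_span_range hs e
      have hle : Ideal.span (Set.range fun j => s j ^ e j) ≤ killingIdeal Z hσ ht L 1 := by
        rw [Ideal.span_le]
        rintro _ ⟨j, rfl⟩ f hf
        rw [mul_one]
        rw [← h j, h₂ j] at hf
        exact hf.2
      have h1 : (1 : Z) ∈ killingIdeal Z hσ ht L 1 := hle (hspan ▸ Submodule.mem_top)
      have hbot : L = ⊥ := by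
        rw [eq_bot_iff]
        intro f hf
        have := h1 f hf
        rw [map_one, mul_one, matrixMul_one hσ ht] at this
        exact this
      have : actSpan hN ρ t L = ⊥ := by simp [actSpan, hbot]
      rw [this, Module.length_bot]
      exact zero_le

/-- The length for the whole of `(R/Q)^d` is the largest possible, and the nilpotent part
contributes at most `n * length L₂`, so the invertible part `L₁` also reaches `n * length L₁`. Hence
`L₁ⁿ → (M/N)^d` is injective, and the coefficients of a relation kill `L₁`, the image of the `e`-th
power of `s j`. -/
theorem exists_matrixMul_eq_zero_of_relation [IsNoetherian R (R ⧸ Q)] [IsArtinian R (R ⧸ Q)]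
    (hσ : IsSimpleAction k σ) (hρ : IsEquivariant k σ ρ) (ht : IsComatrix k t)
    (hs : Ideal.span (Set.range s) = ⊤)
    (hv : ∀ j x, algebraMap Z R (s j) • x ∈ Submodule.span R (Set.range (v j)))
    (hlen : Module.length R (M ⧸ N) = n * Module.length R (R ⧸ Q))
    (hN : ∀ q ∈ Q, ∀ x : M, q • x ∈ N) (j : ι) {a : Fin n → R} (ha : ∑ i, a i • v j i = 0) :
    ∃ e : ℕ, ∀ i, matrixMul Q σ t (algebraMap Z R (s j) ^ e * a i) = 0 := by
  obtain ⟨e, L₁, L₂, h₁, h₂, hL₁, hL₂, hsup, hsurj, hlenL⟩ :=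
    exists_fitting (Q := Q) (L := ⊤) hσ ht (fun _ => le_top) (s j)
  have hfin : ∀ L : Submodule R (Fin d → R ⧸ Q), Module.length R L ≠ ⊤ := fun L =>
    Module.length_ne_top
  have hle : n * Module.length R L₁ ≤ Module.length R (actSpan hN ρ t L₁) := by
    have h3 : Module.length R (actSpan hN ρ t (⊤ : Submodule R (Fin d → R ⧸ Q))) =
        n * Module.length R (⊤ : Submodule R (Fin d → R ⧸ Q)) := by
      have : actSpan hN ρ t (⊤ : Submodule R (Fin d → R ⧸ Q)) = ⊤ := by
        rw [← iSup_range_matrixActHom hN (ρ := ρ) ht]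
        simp [actSpan, Submodule.map_top]
      rw [this, Module.length_top, Module.length_top, Module.length_pi_of_fintype,
        Module.length_pi_of_fintype, hlen]
      simp only [Finset.sum_const, Finset.card_univ, Fintype.card_fin, nsmul_eq_mul]
      ring
    have h4 := (length_mono (actSpan_mono hN (ρ := ρ) (t := t) hsup))
    rw [h3, hlenL, mul_add, actSpan_sup] at h4
    have h5 := h4.trans ((length_sup_le _ _).trans
      (add_le_add le_rfl (length_actSpan_le hN hσ hρ ht hs hv L₂ hL₂)))
    exact (ENat.add_le_add_iff_right (WithTop.mul_ne_top (ENat.natCast_ne_top n) (hfin L₂))).1 h5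
  have hinj : Function.Injective (actSum hN ρ t L₁ (v j)) := by
    rw [← LinearMap.ker_eq_bot, ← Submodule.subsingleton_iff_eq_bot,
      ← Module.length_eq_zero_iff (R := R)]
    have h6 := length_eq_map_add_inf_ker ⊤ (actSum hN ρ t L₁ (v j))
    rw [top_inf_eq, Module.length_top, Submodule.map_top, Module.length_pi_of_fintype] at h6
    simp only [Finset.sum_const, Finset.card_univ, Fintype.card_fin, nsmul_eq_mul] at h6
    have h7 := hle.trans (length_mono (actSpan_le_range_actSum hN hρ ht hL₁ (hv j) hsurj))
    rw [h6] at h7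
    have h8 : Module.length R (LinearMap.range (actSum hN ρ t L₁ (v j))) ≠ ⊤ := by
      refine ne_top_of_le_ne_top ?_ (length_range_le _)
      exact Module.length_ne_top
    by_contra h9
    rw [add_comm] at h7
    exact absurd h7 (not_le.2 (ENat.lt_add_left h8 (pos_iff_ne_zero.2 h9)))
  refine ⟨e, fun i => ?_⟩
  refine LinearMap.ext fun f => ?_
  have hg : matrixMul Q σ t (algebraMap Z R (s j ^ e)) f ∈ L₁ := by
    rw [h₁]; exact ⟨f, trivial, rfl⟩
  set g := matrixMul Q σ t (algebraMap Z R (s j ^ e)) f with hgdef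
  let c : Fin n → L₁ := fun i => ⟨matrixMul Q σ t (a i) g, hL₁ _ ⟨g, hg, rfl⟩⟩
  have hc : actSum hN ρ t L₁ (v j) c = 0 := by
    rw [actSum_apply]
    have : ∀ i, matrixActHom hN ρ t (v j i) (c i) = matrixActHom hN ρ t (a i • v j i) g := fun i => by
      rw [matrixActHom_smul hN hρ ht]; rfl
    simp only [this]
    rw [← LinearMap.sum_apply, ← map_sum, ha, map_zero, LinearMap.zero_apply]
  have hc0 : c = 0 := hinj (by rw [hc, map_zero])
  have := congrArg Subtype.val (congrFun hc0 i)
  rw [← map_pow, matrixMul_mul hσ ht, LinearMap.comp_apply, ← hgdef]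
  exact this

/-- The two-sided ideal of elements `a` such that, for each multiplicative matrix, `zᵉ a` acts by
zero for large `e`. -/
def flatIdeal (Q : Ideal R) [Q.IsTwoSided] (hσ : IsSimpleAction k σ) (z : Z) : Ideal R where
  carrier := {a | ∀ ⦃d : ℕ⦄ ⦃t : Fin d → Fin d → H⦄, IsComatrix k t →
    ∃ e : ℕ, matrixMul Q σ t (algebraMap Z R z ^ e * a) = 0}
  zero_mem' _ _ _ := ⟨0, by simp⟩
  add_mem' {a b} ha hb d t ht := by
    obtain ⟨e, he⟩ := ha ht
    obtain ⟨f, hf⟩ := hb ht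
    refine ⟨e + f, ?_⟩
    have h1 : algebraMap Z R z ^ (e + f) * (a + b) = algebraMap Z R z ^ f * (algebraMap Z R z ^ e * a) +
        algebraMap Z R z ^ e * (algebraMap Z R z ^ f * b) := by
      rw [mul_add, ← mul_assoc, ← mul_assoc, ← pow_add, ← pow_add, add_comm f e]
    rw [h1, map_add, matrixMul_mul hσ ht (_ ^ f), matrixMul_mul hσ ht (_ ^ e) (_ ^ f * b), he, hf, LinearMap.zero_comp,
      LinearMap.zero_comp, add_zero]
  smul_mem' r a ha d t ht := by
    obtain ⟨e, he⟩ := ha ht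
    refine ⟨e, ?_⟩
    have h1 : algebraMap Z R z ^ e * (r * a) = r * (algebraMap Z R z ^ e * a) := by
      rw [← map_pow, ← mul_assoc, Algebra.commutes, mul_assoc]
    rw [smul_eq_mul, h1, matrixMul_mul hσ ht, he, LinearMap.zero_comp]

instance (hσ : IsSimpleAction k σ) (z : Z) : (flatIdeal Q hσ z).IsTwoSided where
  mul_mem_of_left {a} b ha d t ht := by
    obtain ⟨e, he⟩ := ha ht
    refine ⟨e, ?_⟩
    rw [← mul_assoc, matrixMul_mul hσ ht, he, LinearMap.comp_zero]

/-- Powers of the `s j` generate `Z`, so `a` itself acts by zero for every multiplicative matrix.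
Evaluation at unit vectors puts all translates of `a` in `Q`, and simplicity applies. -/
theorem eq_zero_of_forall_mem_flatIdeal [Finite ι] (hQ : Q ≠ ⊤) (hσ : IsSimpleAction k σ)
    (hs : Ideal.span (Set.range s) = ⊤) {a : R} (ha : ∀ j, a ∈ flatIdeal Q hσ (s j)) : a = 0 := by
  have hQ' : Q.IsTwoSided := inferInstance
  refine hσ.simple Q hQ' hQ a fun d t ht i j => ?_
  choose e he using fun j => ha j ht
  have h1 : (1 : Z) ∈ killingIdeal Z hσ ht (⊤ : Submodule R (Fin d → R ⧸ Q)) a := by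
    have hle : Ideal.span (Set.range fun j => s j ^ e j) ≤
        killingIdeal Z hσ ht (⊤ : Submodule R (Fin d → R ⧸ Q)) a := by
      rw [Ideal.span_le]
      rintro _ ⟨j, rfl⟩ f -
      rw [map_pow, he j, LinearMap.zero_apply]
    exact hle (Ideal.span_range_pow_of_span_range hs e ▸ Submodule.mem_top)
  have h2 := congrFun (h1 (fun p => Submodule.Quotient.mk (Pi.single (M := fun _ => R) j 1 p))
    trivial) i
  rw [map_one, one_mul, matrixActHom_mk, Finset.sum_eq_single j
    (fun p _ hp => by simp [Pi.single_eq_of_ne hp]) (by simp)] at h2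
  simpa using (Submodule.Quotient.mk_eq_zero Q).1 h2

theorem mem_flatIdeal_of_relation [IsNoetherian R (R ⧸ Q)] [IsArtinian R (R ⧸ Q)]
    (hσ : IsSimpleAction k σ) (hρ : IsEquivariant k σ ρ)
    (hs : Ideal.span (Set.range s) = ⊤)
    (hv : ∀ j x, algebraMap Z R (s j) • x ∈ Submodule.span R (Set.range (v j)))
    (hlen : Module.length R (M ⧸ N) = n * Module.length R (R ⧸ Q))
    (hN : ∀ q ∈ Q, ∀ x : M, q • x ∈ N) (j : ι) {a : Fin n → R} (ha : ∑ i, a i • v j i = 0)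
    (i : Fin n) : a i ∈ flatIdeal Q hσ (s j) := fun d t ht => by
  obtain ⟨e, he⟩ := exists_matrixMul_eq_zero_of_relation hσ hρ ht hs hv hlen hN j ha
  exact ⟨e, he i⟩

end CentralFitting

/-! ### Nakayama's lemma with denominators in `Z`. -/

section LocalIdeals

variable {R Z : Type*} [Ring R] [CommRing Z] [Algebra Z R]

/-- `𝔧` behaves like the preimage in `R` of the Jacobson radical of the semilocal ring `R_m`. -/
structure IsLocalIdeal (m : Ideal Z) (𝔧 : Ideal R) [𝔧.IsTwoSided] : Prop where
  map_mem : ∀ z ∈ m, algebraMap Z R z ∈ 𝔧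
  exists_mul_eq : ∀ a ∈ 𝔧, ∃ b : R, ∃ s ∉ m, b * (1 - a) = algebraMap Z R s
  semisimple : IsSemisimpleRing (R ⧸ 𝔧)

variable (Z R) in
/-- Each maximal ideal of the central subring `Z` has a local ideal. -/
def HasLocalIdeals : Prop :=
  ∀ m : Ideal Z, m.IsMaximal → ∃ (𝔧 : Ideal R) (_ : 𝔧.IsTwoSided), IsLocalIdeal m 𝔧

variable {m : Ideal Z} {𝔧 : Ideal R} [𝔧.IsTwoSided]

theorem Ideal.exists_mul_sub_one_mem {Z : Type*} [CommRing Z] {m : Ideal Z} (hm : m.IsMaximal)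
    {s : Z} (hs : s ∉ m) : ∃ z, z * s - 1 ∈ m := by
  obtain ⟨z, i, hi, h⟩ := hm.exists_inv hs
  exact ⟨z, by rw [← h, sub_add_cancel_left]; exact m.neg_mem hi⟩

theorem IsLocalIdeal.exists_mul_sub_eq (h : IsLocalIdeal m 𝔧) (hm : m.IsMaximal) {a : R}
    (ha : a ∈ 𝔧) {s : Z} (hs : s ∉ m) :
    ∃ b : R, ∃ s' ∉ m, b * (algebraMap Z R s - a) = algebraMap Z R s' := by
  obtain ⟨z, hz⟩ := Ideal.exists_mul_sub_one_mem hm hs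
  obtain ⟨b, s', hs', hb⟩ := h.exists_mul_eq (algebraMap Z R z * a - algebraMap Z R (z * s - 1))
    (𝔧.sub_mem (𝔧.mul_mem_left _ ha) (h.map_mem _ hz))
  refine ⟨b * algebraMap Z R z, s', hs', ?_⟩
  rw [← hb, mul_assoc, mul_sub, ← map_mul]
  congr 1
  rw [map_sub, map_one]
  abel

variable {P : Type*} [AddCommGroup P] [Module R P]

theorem smul_comm_algebraMap (z : Z) (r : R) (x : P) :
    algebraMap Z R z • r • x = r • algebraMap Z R z • x := by
  rw [← mul_smul, ← mul_smul, Algebra.commutes]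

/-- Gaussian elimination: `s` minus a diagonal coefficient has a left inverse up to a denominator
outside `m`, so a multiple of the last element is expressed through the others and the family
shrinks. -/
theorem IsLocalIdeal.nakayama_family (h : IsLocalIdeal m 𝔧) (hm : m.IsMaximal) {N : ℕ}
    (p : Fin N → P) {s : Z} (hs : s ∉ m) {a : Fin N → Fin N → R} (ha : ∀ i j, a i j ∈ 𝔧)
    (hp : ∀ i, algebraMap Z R s • p i = ∑ j, a i j • p j) :
    ∃ s' ∉ m, ∀ i, algebraMap Z R s' • p i = 0 := by
  induction N generalizing s with
  | zero => exact ⟨s, hs, fun i => i.elim0⟩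
  | succ N ih =>
    obtain ⟨b, s', hs', hb⟩ := h.exists_mul_sub_eq hm (ha (Fin.last N) (Fin.last N)) hs
    have hlast : algebraMap Z R s' • p (Fin.last N) =
        ∑ j : Fin N, (b * a (Fin.last N) j.castSucc) • p j.castSucc := by
      have h1 := hp (Fin.last N)
      rw [Fin.sum_univ_castSucc, ← sub_eq_iff_eq_add, ← sub_smul] at h1
      rw [← hb, mul_smul, h1, Finset.smul_sum]
      simp [mul_smul]
    have hss : s * s' ∉ m := fun hmem => (hm.isPrime.mem_or_mem hmem).elim hs hs'
    obtain ⟨u, hu, hu'⟩ := ih (fun j => p j.castSucc) hss (a := fun i j =>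
      algebraMap Z R s' * a i.castSucc j.castSucc +
        a i.castSucc (Fin.last N) * (b * a (Fin.last N) j.castSucc))
      (fun i j => 𝔧.add_mem (𝔧.mul_mem_left _ (ha _ _))
        (𝔧.mul_mem_left _ (𝔧.mul_mem_left _ (ha _ _)))) (fun i => by
          rw [mul_comm s s', map_mul, mul_smul, hp, Fin.sum_univ_castSucc, smul_add,
            smul_comm_algebraMap _ _ (p (Fin.last N)), hlast]
          simp only [Finset.smul_sum, add_smul, Finset.sum_add_distrib, mul_smul])
    have husn : u * s' ∉ m := fun hmem => (hm.isPrime.mem_or_mem hmem).elim hu hs'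
    refine ⟨u * s', husn, fun i => ?_⟩
    refine Fin.lastCases ?_ (fun i => ?_) i
    · rw [map_mul, mul_smul, hlast, Finset.smul_sum]
      refine Finset.sum_eq_zero fun j _ => ?_
      rw [smul_comm_algebraMap, hu', smul_zero]
    · rw [mul_comm, map_mul, mul_smul, hu', smul_zero]

theorem exists_sum_of_mem_smul_top {N : ℕ} {p : Fin N → P}
    (hp : Submodule.span R (Set.range p) = ⊤) {x : P} (hx : x ∈ 𝔧 • (⊤ : Submodule R P)) :
    ∃ a : Fin N → R, (∀ j, a j ∈ 𝔧) ∧ x = ∑ j, a j • p j := by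
  induction hx using Submodule.smul_induction_on' with
  | smul r hr y _ =>
    obtain ⟨c, rfl⟩ := (Submodule.mem_span_range_iff_exists_fun R).1
      (hp ▸ Submodule.mem_top : y ∈ Submodule.span R (Set.range p))
    exact ⟨fun j => r * c j, fun j => 𝔧.mul_mem_right _ hr, by simp [Finset.smul_sum, mul_smul]⟩
  | add x _ y _ hx hy =>
    obtain ⟨a, ha, rfl⟩ := hx
    obtain ⟨b, hb, rfl⟩ := hy
    exact ⟨fun j => a j + b j, fun j => 𝔧.add_mem (ha j) (hb j), by
      simp [add_smul, Finset.sum_add_distrib]⟩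

theorem IsLocalIdeal.nakayama (h : IsLocalIdeal m 𝔧) (hm : m.IsMaximal) [Module.Finite R P]
    (hP : 𝔧 • (⊤ : Submodule R P) = ⊤) : ∃ s ∉ m, ∀ x : P, algebraMap Z R s • x = 0 := by
  obtain ⟨N, p, hp⟩ := Module.Finite.exists_fin (R := R) (M := P)
  choose a ha hap using fun i => exists_sum_of_mem_smul_top hp
    (hP.symm ▸ Submodule.mem_top : p i ∈ 𝔧 • (⊤ : Submodule R P))
  obtain ⟨s, hs, hs'⟩ := h.nakayama_family hm p (s := 1) (fun h1 => hm.ne_top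
    ((Ideal.eq_top_iff_one m).2 h1)) ha (fun i => by rw [map_one, one_smul]; exact hap i)
  refine ⟨s, hs, fun x => ?_⟩
  obtain ⟨c, rfl⟩ := (Submodule.mem_span_range_iff_exists_fun R).1
      (hp ▸ Submodule.mem_top : x ∈ Submodule.span R (Set.range p))
  rw [Finset.smul_sum]
  exact Finset.sum_eq_zero fun i _ => by rw [smul_comm_algebraMap, hs', smul_zero]

-- Near `m`, the congruence `C B = s` says that `a ↦ a B` is onto modulo `J`; what is needed is that
-- it is injective. This is the noetherian fact that one-sided inverses of matrices are two-sided,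
-- applied modulo `𝔧 + J` and lifted to `J` by Nakayama's lemma.
open Matrix in
theorem IsLocalIdeal.exists_smul_mem_of_vecMul_mem (h : IsLocalIdeal m 𝔧) (hm : m.IsMaximal)
    (J : Ideal R) [J.IsTwoSided] {n : ℕ} {B C : Matrix (Fin n) (Fin n) R} {s : Z} (hs : s ∉ m)
    (hCB : ∀ i j, (C * B - algebraMap Z R s • (1 : Matrix (Fin n) (Fin n) R)) i j ∈ J) :
    ∃ s' ∉ m, ∀ a : Fin n → R, (∀ i, (a ᵥ* B) i ∈ J) → ∀ i, algebraMap Z R s' * a i ∈ J := by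
  have : IsSemisimpleRing (R ⧸ 𝔧) := h.semisimple
  let I : Ideal R := 𝔧 ⊔ J
  have hI2 : I.IsTwoSided := ⟨fun {a} b ha => by
    obtain ⟨x, hx, y, hy, rfl⟩ := Submodule.mem_sup.1 ha
    rw [add_mul]
    exact Submodule.add_mem_sup (𝔧.mul_mem_right b hx) (J.mul_mem_right b hy)⟩
  have hle : 𝔧 ≤ I := le_sup_left
  have hI : IsNoetherianRing (R ⧸ I) :=
    isNoetherianRing_of_surjective (R ⧸ 𝔧) (R ⧸ I) (Ideal.Quotient.factor hle)
      (Ideal.Quotient.factor_surjective hle)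
  obtain ⟨z, hz⟩ := Ideal.exists_mul_sub_one_mem hm hs
  let f := Ideal.Quotient.mk I
  let g := Ideal.Quotient.mk J
  have hone : (algebraMap Z R z • C).map f * B.map f = 1 := by
    rw [← Matrix.map_mul]
    ext i j
    have h1 : f ((C * B) i j) = f ((algebraMap Z R s • (1 : Matrix (Fin n) (Fin n) R)) i j) :=
      Ideal.Quotient.eq.2 (Ideal.mem_sup_right (hCB i j))
    have h2 : f (algebraMap Z R z) * f (algebraMap Z R s) = 1 := by
      rw [← map_mul, ← map_mul, ← map_one f]
      refine Ideal.Quotient.eq.2 (Ideal.mem_sup_left ?_)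
      rw [← map_one (algebraMap Z R), ← map_sub]
      exact h.map_mem _ hz
    rw [Matrix.map_apply, Matrix.smul_mul, Matrix.smul_apply, smul_eq_mul, map_mul, h1,
      Matrix.smul_apply, smul_eq_mul, map_mul, ← mul_assoc, h2, one_mul]
    simp [Matrix.one_apply, apply_ite f]
  -- Matrix rings over the noetherian ring `R ⧸ I` are Dedekind-finite.
  have hone' : B.map f * (algebraMap Z R z • C).map f = 1 := mul_eq_one_symm hone
  -- The quotient by `U` is the cokernel of `y ↦ y C` modulo `J`. The rows of `B C`, up to the
  -- factor `z`, are unit vectors modulo `𝔧 + J`, so `𝔧` times this cokernel is everything.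
  let U : Submodule R (Fin n → R) :=
    (Submodule.pi Set.univ fun _ => J) ⊔ LinearMap.range C.vecMulLinear
  let p : Fin n → (Fin n → R) ⧸ U := fun i => U.mkQ (Pi.single i 1)
  have hp : ∀ x : Fin n → R, U.mkQ x = ∑ i, x i • p i := fun x => by
    simp only [p, ← map_smul, ← map_sum]
    congr 1
    ext j
    simp [Finset.sum_apply, Pi.single_apply]
  have hcomb : ∀ i, ∃ c : Fin n → R, (∀ j, c j ∈ 𝔧) ∧ p i = ∑ j, c j • p j := fun i => by
    have h1 : ∀ j, (Pi.single i 1 - (B * (algebraMap Z R z • C)) i : Fin n → R) j ∈ I := fun j => by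
      rw [← Ideal.Quotient.eq_zero_iff_mem, Pi.sub_apply, map_sub, sub_eq_zero]
      have := congrFun (congrFun hone' i) j
      rw [← Matrix.map_mul, Matrix.map_apply] at this
      refine Eq.trans ?_ this.symm
      by_cases hij : i = j
      · subst hij; simp
      · simp [hij, Ne.symm hij]
    choose c hc e he hce using fun j => Submodule.mem_sup.1 (h1 j)
    refine ⟨c, hc, ?_⟩
    rw [← hp, ← sub_eq_zero, ← map_sub, Submodule.mkQ_apply, Submodule.Quotient.mk_eq_zero]
    have h2 : (Pi.single i 1 : Fin n → R) - c = e + (B * (algebraMap Z R z • C)) i := by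
      have : c + e = (Pi.single i 1 - (B * (algebraMap Z R z • C)) i : Fin n → R) := funext hce
      rw [eq_sub_iff_add_eq] at this
      rw [← this]; abel
    rw [h2]
    refine Submodule.add_mem_sup (fun j _ => he j) ⟨fun l => B i l * algebraMap Z R z, ?_⟩
    ext j
    simp only [Matrix.vecMulLinear_apply, Matrix.vecMul, dotProduct, Matrix.mul_apply,
      Matrix.smul_apply, smul_eq_mul, mul_assoc]
  choose c hc hpc using hcomb
  obtain ⟨u, hu, hu'⟩ := h.nakayama_family hm p (s := 1) (fun h1 => hm.ne_top
    ((Ideal.eq_top_iff_one m).2 h1)) hc (fun i => by rw [map_one, one_smul]; exact hpc i)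
  have hD : ∀ i, ∃ y : Fin n → R, ∀ j, (algebraMap Z R u • (Pi.single i 1 : Fin n → R)) j -
      (y ᵥ* C) j ∈ J := fun i => by
    have h1 := hu' i
    rw [← map_smul, Submodule.mkQ_apply, Submodule.Quotient.mk_eq_zero] at h1
    obtain ⟨q, hq, _, ⟨y, rfl⟩, h2⟩ := Submodule.mem_sup.1 h1
    refine ⟨y, fun j => ?_⟩
    rw [← h2]
    have := hq j trivial
    simpa using this
  choose D hD using hD
  have husn : s * u ∉ m := fun hmem => (hm.isPrime.mem_or_mem hmem).elim hs hu
  refine ⟨s * u, husn, fun a ha i => ?_⟩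
  have hmap : ∀ (z : Z) (X : Matrix (Fin n) (Fin n) (R ⧸ J)),
      g (algebraMap Z R z) • X = X * (g (algebraMap Z R z) • (1 : Matrix (Fin n) (Fin n) (R ⧸ J))) :=
    fun z X => by
      ext i j
      obtain ⟨r, hr⟩ := Ideal.Quotient.mk_surjective (X i j)
      rw [Matrix.smul_apply, smul_eq_mul, Matrix.mul_apply, Finset.sum_eq_single j]
      · simp only [Matrix.smul_apply, Matrix.one_apply_eq, smul_eq_mul, mul_one, ← hr, g]
        rw [← map_mul, ← map_mul, Algebra.commutes]
      · intro l _ hl; simp [Matrix.one_apply_ne hl]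
      · simp
  have e1 : C.map g * B.map g = g (algebraMap Z R s) • 1 := by
    rw [← Matrix.map_mul]
    ext i j
    rw [Matrix.map_apply]
    refine (Ideal.Quotient.eq.2 (hCB i j)).trans ?_
    by_cases hij : i = j
    · subst hij; simp [g]
    · simp [hij]
  have e2 : (Matrix.of D).map g * C.map g = g (algebraMap Z R u) • 1 := by
    rw [← Matrix.map_mul]
    ext i j
    rw [Matrix.map_apply]
    refine (Ideal.Quotient.eq.2 (hD i j)).symm.trans ?_
    by_cases hij : i = j
    · subst hij; simp [g]
    · simp [hij, Ne.symm hij]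
  -- From `C B = s` and `D C = u` follows `u B = D C B = s D`, hence `u B C = s D C = s u`.
  have e3 : B.map g * C.map g * (g (algebraMap Z R u) • 1) =
      g (algebraMap Z R s) • g (algebraMap Z R u) • 1 := by
    have h1 : g (algebraMap Z R u) • B.map g = g (algebraMap Z R s) • (Matrix.of D).map g := by
      rw [hmap s, ← e1, ← mul_assoc, e2, Matrix.smul_mul, one_mul]
    rw [← hmap, ← Matrix.smul_mul, h1, Matrix.smul_mul, e2]
  have e4 : (fun i => g (a i)) ᵥ* (B.map g) = 0 := by
    ext j
    have h1 := Ideal.Quotient.eq_zero_iff_mem.2 (ha j)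
    rw [Pi.zero_apply, ← h1]
    simp [Matrix.vecMul, dotProduct, g]
  have e5 : (fun i => g (a i)) ᵥ* (g (algebraMap Z R s) • g (algebraMap Z R u) •
      (1 : Matrix (Fin n) (Fin n) (R ⧸ J))) = 0 := by
    rw [← e3, ← Matrix.vecMul_vecMul, ← Matrix.vecMul_vecMul, e4, Matrix.zero_vecMul,
      Matrix.zero_vecMul]
  rw [← Ideal.Quotient.eq_zero_iff_mem, Algebra.commutes, map_mul, map_mul, map_mul]
  have := congrFun e5 i
  simp only [Matrix.vecMul, dotProduct, Matrix.one_apply, Matrix.smul_apply, smul_eq_mul, mul_ite,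
    mul_one, mul_zero, Finset.sum_ite_eq', Finset.mem_univ, if_true, Pi.zero_apply] at this
  exact this

variable (Z R P) in
/-- Up to elements of `Z` outside any given maximal ideal, `P` is isomorphic to `Rⁿ`. -/
def IsLocallyFreeOfRank (n : ℕ) : Prop :=
  ∀ m : Ideal Z, m.IsMaximal → ∃ s ∉ m, ∃ (π : (Fin n → R) →ₗ[R] P) (τ : P →ₗ[R] (Fin n → R)),
    (∀ x, π (τ x) = algebraMap Z R s • x) ∧ ∀ c, τ (π c) = algebraMap Z R s • c

/-- The coefficients of `s x` in terms of `v` are unique only up to relations. These are killed by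
`u`, so `u` times the coefficients depends linearly on `x`. -/
theorem exists_quasi_inverse {n : ℕ} {v : Fin n → P} {s u : Z}
    (hv : ∀ x, algebraMap Z R s • x ∈ Submodule.span R (Set.range v))
    (hu : ∀ a : Fin n → R, ∑ i, a i • v i = 0 → algebraMap Z R u • a = 0) :
    ∃ (π : (Fin n → R) →ₗ[R] P) (τ : P →ₗ[R] (Fin n → R)),
      (∀ x, π (τ x) = algebraMap Z R (u * s) • x) ∧ ∀ c, τ (π c) = algebraMap Z R (u * s) • c := by
  choose α hα using fun x => (Submodule.mem_span_range_iff_exists_fun R).1 (hv x)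
  have key : ∀ a b : Fin n → R, ∑ i, a i • v i = ∑ i, b i • v i →
      algebraMap Z R u • a = algebraMap Z R u • b := fun a b hab => by
    rw [← sub_eq_zero, ← smul_sub]
    exact hu _ (by simp [sub_smul, hab])
  let τ : P →ₗ[R] (Fin n → R) :=
    { toFun := fun x => algebraMap Z R u • α x
      map_add' := fun x y => by
        rw [← smul_add]
        exact key _ _ (by simp [add_smul, Finset.sum_add_distrib, hα])
      map_smul' := fun r x => by
        rw [RingHom.id_apply, ← smul_comm_algebraMap]
        refine key _ _ ?_
        simp only [Pi.smul_apply, smul_eq_mul, mul_smul, ← Finset.smul_sum, hα]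
        rw [smul_comm_algebraMap] }
  have hπ : ∀ c, Fintype.linearCombination R v c = ∑ i, c i • v i := fun c =>
    Fintype.linearCombination_apply R v c
  refine ⟨Fintype.linearCombination R v, τ, fun x => ?_, fun c => ?_⟩
  · change Fintype.linearCombination R v (algebraMap Z R u • α x) = _
    rw [map_smul, hπ, hα, map_mul, mul_smul]
  · change algebraMap Z R u • α (Fintype.linearCombination R v c) = _
    rw [map_mul, mul_smul]
    refine key _ _ ?_
    rw [hα, hπ, Finset.smul_sum]
    simp [mul_smul, smul_comm_algebraMap]

end LocalIdeals

/-! ### The length criterion for local freeness. -/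

section LocalFreeness

variable {k H R M Z : Type*} [Field k] [Ring H] [HopfAlgebra k H] [Ring R] [AddCommGroup M]
  [Module R M] [CommRing Z] [Algebra Z R] {σ : H →+* AddMonoid.End R} {ρ : H →+* AddMonoid.End M}

theorem smul_mem_ideal_smul_top {Q : Ideal R} :
    ∀ q ∈ Q, ∀ x : M, q • x ∈ Q • (⊤ : Submodule R M) := fun _ hq _ =>
  Submodule.smul_mem_smul hq trivial

theorem exists_finite_cover {Z : Type*} [CommRing Z] (s : {m : Ideal Z // m.IsMaximal} → Z)
    (hs : ∀ m, s m ∉ m.1) : ∃ T : Finset {m : Ideal Z // m.IsMaximal},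
      Ideal.span (Set.range fun j : T => s j) = ⊤ := by
  classical
  have h1 : Ideal.span (Set.range s) = ⊤ := by
    by_contra h
    obtain ⟨m, hm, hle⟩ := Ideal.exists_le_maximal _ h
    exact hs ⟨m, hm⟩ (hle (Ideal.subset_span ⟨⟨m, hm⟩, rfl⟩))
  obtain ⟨T, hT, hT'⟩ := Submodule.mem_span_finite_of_mem_span ((Ideal.eq_top_iff_one _).1 h1)
  choose f hf using fun t : T => hT t.2
  refine ⟨Finset.univ.image f, (Ideal.eq_top_iff_one _).2 (Ideal.span_mono ?_ hT')⟩
  intro x hx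
  exact ⟨⟨f ⟨x, hx⟩, Finset.mem_image_of_mem _ (Finset.mem_univ _)⟩, hf ⟨x, hx⟩⟩

-- Relations between generators valid where `s j` is invertible are only known to lie in the flat
-- ideal of `s j`, and only the intersection of these ideals over a cover is zero. So for each `m'`
-- a family generating near both `m` and `m'` is used. A relation between the `v₀ i` becomes,
-- through the matrix `B j`, a relation between the `v j i`; undoing `B j` near `m` costs a factor
-- `u j ∉ m`. The product of the `u j` then puts the coefficients into all flat ideals at once.
open Matrix in
theorem isLocallyFreeOfRank_of_length_eq (hR : HasLocalIdeals R Z) (hσ : IsSimpleAction k σ)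
    (hρ : IsEquivariant k σ ρ) {Q : Ideal R} [Q.IsTwoSided] (hQ : Q ≠ ⊤)
    [IsNoetherian R (R ⧸ Q)] [IsArtinian R (R ⧸ Q)] {n : ℕ}
    (hlen : Module.length R (M ⧸ Q • (⊤ : Submodule R M)) = n * Module.length R (R ⧸ Q))
    (hgen : ∀ m m' : Ideal Z, m.IsMaximal → m'.IsMaximal → ∃ v : Fin n → M, ∃ s : Z, s ∉ m ∧ s ∉ m' ∧
      ∀ x, algebraMap Z R s • x ∈ Submodule.span R (Set.range v)) :
    IsLocallyFreeOfRank R Z M n := by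
  intro m hm
  obtain ⟨𝔧, _, h𝔧⟩ := hR m hm
  obtain ⟨v₀, s₀, hs₀, -, hv₀⟩ := hgen m m hm hm
  choose v s hsm hsm' hv using fun m' : {m : Ideal Z // m.IsMaximal} => hgen m m' hm m'.2
  obtain ⟨T, hT⟩ := exists_finite_cover s hsm'
  choose B hB using fun (j : T) i => (Submodule.mem_span_range_iff_exists_fun R).1 (hv j (v₀ i))
  choose C hC using fun (j : T) i => (Submodule.mem_span_range_iff_exists_fun R).1 (hv₀ (v j i))
  have hrel : ∀ (j : T) {a : Fin n → R}, ∑ i, a i • v j i = 0 →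
      ∀ i, a i ∈ flatIdeal Q hσ (s j) := fun j a ha =>
    mem_flatIdeal_of_relation (s := fun j : T => s j) (v := fun j : T => v j) hσ hρ hT
      (fun j => hv j) hlen smul_mem_ideal_smul_top j ha
  have hss : ∀ j : T, s₀ * s j ∉ m := fun j h =>
    (hm.isPrime.mem_or_mem h).elim hs₀ (hsm j)
  have hmul : ∀ (j : T) (a : Fin n → R), ∑ l, (a ᵥ* Matrix.of (B j)) l • v j l =
      algebraMap Z R (s j) • ∑ i, a i • v₀ i := fun j a => by
    simp only [Matrix.vecMul, dotProduct, Finset.sum_smul, Matrix.of_apply]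
    rw [Finset.sum_comm, Finset.smul_sum]
    refine Finset.sum_congr rfl fun i _ => ?_
    simp only [mul_smul]
    rw [← Finset.smul_sum, hB, smul_comm_algebraMap]
  -- The rows of `C B - s₀ s j` are relations between the `v j i`, so their entries lie in the flat
  -- ideal.
  choose u hu hu' using fun j : T => h𝔧.exists_smul_mem_of_vecMul_mem hm (flatIdeal Q hσ (s j))
    (B := Matrix.of (B j)) (C := Matrix.of (C j)) (hss j) (fun i l => by
      refine hrel j (a := (Matrix.of (C j) * Matrix.of (B j) -
        algebraMap Z R (s₀ * s j) • (1 : Matrix (Fin n) (Fin n) R)) i) ?_ l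
      have h1 := hmul j (C j i)
      rw [hC, ← mul_smul, ← map_mul, mul_comm] at h1
      simp only [Matrix.sub_apply, sub_smul, Finset.sum_sub_distrib]
      rw [sub_eq_zero]
      refine Eq.trans ?_ (h1.trans ?_)
      · rfl
      · rw [Finset.sum_eq_single i (fun l _ hl => by simp [Matrix.one_apply_ne hl.symm]) (by simp)]
        simp)
  have hprod : ∏ j, u j ∉ m := by
    have := hm.isPrime
    rw [Ideal.IsPrime.prod_mem_iff]
    rintro ⟨j, -, hj⟩
    exact hu j hj
  have hkill : ∀ a : Fin n → R, ∑ i, a i • v₀ i = 0 → algebraMap Z R (∏ j, u j) • a = 0 :=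
    fun a ha => by
      funext i
      refine eq_zero_of_forall_mem_flatIdeal (s := fun j : T => s j) hQ hσ hT fun j => ?_
      have h1 := hu' j a (hrel j (by rw [hmul, ha, smul_zero])) i
      rw [Pi.smul_apply, smul_eq_mul, ← Finset.mul_prod_erase _ _ (Finset.mem_univ j), mul_comm,
        map_mul, mul_assoc]
      exact Ideal.mul_mem_left _ _ h1
  obtain ⟨π, τ, h1, h2⟩ := exists_quasi_inverse hv₀ hkill
  exact ⟨_, fun h => (hm.isPrime.mem_or_mem h).elim hprod hs₀, π, τ, h1, h2⟩

end LocalFreeness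

/-! ### Maximal two-sided ideals and modules over semisimple quotients. -/

section MaximalTwoSided

variable {R : Type*} [Ring R]

/-- `Q` is maximal among the proper two-sided ideals. -/
structure IsMaximalTwoSided (Q : Ideal R) : Prop where
  isTwoSided : Q.IsTwoSided
  ne_top : Q ≠ ⊤
  le_of_le : ∀ I : Ideal R, I.IsTwoSided → I ≠ ⊤ → Q ≤ I → I ≤ Q

variable {T T' P : Type*} [AddCommGroup T] [Module R T] [AddCommGroup T'] [Module R T']
  [AddCommGroup P] [Module R P]

/-- The linear map `r ↦ r • x` on the quotient by an ideal killing `x`. -/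
def quotientToSpanSingleton {I : Ideal R} (x : P) (h : ∀ r ∈ I, r • x = 0) : R ⧸ I →ₗ[R] P :=
  Submodule.liftQ I (LinearMap.toSpanSingleton R P x) h

theorem quotientToSpanSingleton_mk {I : Ideal R} (x : P) (h : ∀ r ∈ I, r • x = 0) (r : R) :
    quotientToSpanSingleton x h (Submodule.Quotient.mk r) = r • x := rfl

/-- By semisimplicity `T'` embeds in `R ⧸ Ann T`. A nonzero element of its image does not kill some
`x` in `T`, so `r ↦ r x` restricts to a nonzero map `T' → T` of simple modules. -/
theorem nonempty_linearEquiv_of_annihilator_le [IsSimpleModule R T] [IsSimpleModule R T']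
    [IsSemisimpleModule R (R ⧸ Module.annihilator R T)]
    (h : Module.annihilator R T ≤ Module.annihilator R T') : Nonempty (T ≃ₗ[R] T') := by
  have := IsSimpleModule.nontrivial R T'
  obtain ⟨x', hx'⟩ := exists_ne (0 : T')
  let f : (R ⧸ Module.annihilator R T) →ₗ[R] T' :=
    quotientToSpanSingleton x' fun r hr => Module.mem_annihilator.1 (h hr) x'
  have hf : Function.Surjective f := by
    refine LinearMap.surjective_of_ne_zero fun h0 => hx' ?_
    have := LinearMap.congr_fun h0 (Submodule.Quotient.mk 1)
    rwa [LinearMap.zero_apply, quotientToSpanSingleton_mk, one_smul] at this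
  obtain ⟨g, hg⟩ := IsSemisimpleModule.lifting_property f hf LinearMap.id
  obtain ⟨r, hr⟩ := Submodule.Quotient.mk_surjective _ (g x')
  have hr0 : r ∉ Module.annihilator R T := fun h0 => hx' <| by
    rw [← Submodule.Quotient.mk_eq_zero, hr] at h0
    have h1 := LinearMap.congr_fun hg x'
    rw [LinearMap.comp_apply, h0, map_zero] at h1
    exact h1.symm
  rw [Module.mem_annihilator] at hr0
  push Not at hr0
  obtain ⟨x, hx⟩ := hr0
  let e : (R ⧸ Module.annihilator R T) →ₗ[R] T :=
    quotientToSpanSingleton x fun r hr => Module.mem_annihilator.1 hr x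
  have he : e ∘ₗ g ≠ 0 := fun h0 => hx <| by
    have := LinearMap.congr_fun h0 x'
    rw [LinearMap.comp_apply, ← hr] at this
    rwa [LinearMap.zero_apply, quotientToSpanSingleton_mk] at this
  exact ⟨(LinearEquiv.ofBijective _ (LinearMap.bijective_of_ne_zero he)).symm⟩

theorem isSemisimpleModule_quotient_of_le {I J : Ideal R} [IsSemisimpleModule R (R ⧸ I)]
    (h : I ≤ J) : IsSemisimpleModule R (R ⧸ J) :=
  .of_surjective (Submodule.factor h) (Submodule.factor_surjective h)

/-- A proper two-sided ideal above `Ann T` kills a simple module, and that module is isomorphic to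
`T`. -/
theorem isMaximalTwoSided_annihilator [IsSimpleModule R T]
    [IsSemisimpleModule R (R ⧸ Module.annihilator R T)] :
    IsMaximalTwoSided (Module.annihilator R T) where
  isTwoSided := inferInstance
  ne_top h := by
    have := IsSimpleModule.nontrivial R T
    obtain ⟨x, hx⟩ := exists_ne (0 : T)
    refine hx ?_
    have := Module.mem_annihilator.1 ((Ideal.eq_top_iff_one _).1 h) x
    rwa [one_smul] at this
  le_of_le I hI hne hle := by
    obtain ⟨m, hm, hIm⟩ := Ideal.exists_le_maximal I hne
    have hsimple : IsSimpleModule R (R ⧸ m) := isSimpleModule_iff_quot_maximal.2 ⟨m, hm, ⟨.refl ..⟩⟩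
    have hIa : I ≤ Module.annihilator R (R ⧸ m) := fun a ha => Module.mem_annihilator.2 fun x => by
      obtain ⟨r, rfl⟩ := Submodule.Quotient.mk_surjective _ x
      rw [← Submodule.Quotient.mk_smul, Submodule.Quotient.mk_eq_zero]
      exact hIm (I.mul_mem_right _ ha)
    obtain ⟨e⟩ := nonempty_linearEquiv_of_annihilator_le (hle.trans hIa)
    rwa [e.annihilator_eq]

theorem exists_isMaximalTwoSided {𝔧 : Ideal R} [𝔧.IsTwoSided] [IsSemisimpleModule R (R ⧸ 𝔧)]
    (h : 𝔧 ≠ ⊤) : ∃ Q, IsMaximalTwoSided Q ∧ 𝔧 ≤ Q := by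
  obtain ⟨m, hm, hle⟩ := Ideal.exists_le_maximal 𝔧 h
  have hsimple : IsSimpleModule R (R ⧸ m) := isSimpleModule_iff_quot_maximal.2 ⟨m, hm, ⟨.refl ..⟩⟩
  have hja : 𝔧 ≤ Module.annihilator R (R ⧸ m) := fun a ha => Module.mem_annihilator.2 fun x => by
    obtain ⟨r, rfl⟩ := Submodule.Quotient.mk_surjective _ x
    rw [← Submodule.Quotient.mk_smul, Submodule.Quotient.mk_eq_zero]
    exact hle (𝔧.mul_mem_right _ ha)
  have := isSemisimpleModule_quotient_of_le hja
  exact ⟨_, isMaximalTwoSided_annihilator, hja⟩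

theorem isSemisimpleModule_prod [IsSemisimpleModule R T] [IsSemisimpleModule R T'] :
    IsSemisimpleModule R (T × T') := by
  have h1 := IsSemisimpleModule.range (LinearMap.inl R T T')
  have h2 := IsSemisimpleModule.range (LinearMap.inr R T T')
  have h3 := IsSemisimpleModule.sup h1 h2
  rw [LinearMap.sup_range_inl_inr] at h3
  exact .congr Submodule.topEquiv.symm

/-- A map `f` of maximal range is onto. Otherwise a simple `T` misses the range; for `Q = Ann T`,
maximality forces the range to contain the full `Q`-part `(R/Q)^n` of the source, so `P/QP` has
length at least `n * length (R/Q) + 1`. -/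
theorem exists_surjective_of_length_le {𝔧 : Ideal R} [𝔧.IsTwoSided] [IsSemisimpleModule R (R ⧸ 𝔧)]
    [Module.Finite R P] (hP : ∀ a ∈ 𝔧, ∀ x : P, a • x = 0) {n : ℕ}
    (hlen : ∀ Q : Ideal R, IsMaximalTwoSided Q → 𝔧 ≤ Q →
      Module.length R (P ⧸ Q • (⊤ : Submodule R P)) ≤ n * Module.length R (R ⧸ Q)) :
    ∃ f : (Fin n → R ⧸ 𝔧) →ₗ[R] P, Function.Surjective f := by
  have hPs : IsSemisimpleModule R P := by
    obtain ⟨N, p, hp⟩ := Module.Finite.exists_fin (R := R) (M := P)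
    let g : (Fin N → R ⧸ 𝔧) →ₗ[R] P := LinearMap.lsum R (fun _ => R ⧸ 𝔧) ℤ fun i =>
      quotientToSpanSingleton (p i) fun r hr => hP r hr _
    refine .of_surjective g ?_
    rw [← LinearMap.range_eq_top, ← top_le_iff, ← hp, Submodule.span_le]
    rintro _ ⟨i, rfl⟩
    exact ⟨Pi.single i (Submodule.Quotient.mk 1), by
      change (LinearMap.lsum R (fun _ => R ⧸ 𝔧) ℤ _) _ = _
      rw [LinearMap.lsum_apply, LinearMap.sum_apply, Finset.sum_eq_single i
        (fun l _ hl => by simp [hl]) (by simp), LinearMap.comp_apply, LinearMap.proj_apply,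
        Pi.single_eq_same, quotientToSpanSingleton_mk, one_smul]⟩
  obtain ⟨N, ⟨f, rfl⟩, hmax⟩ := set_has_maximal_iff_noetherian.2 (inferInstance : IsNoetherian R P)
    {N | ∃ f : (Fin n → R ⧸ 𝔧) →ₗ[R] P, LinearMap.range f = N} ⟨_, 0, rfl⟩
  refine ⟨f, LinearMap.range_eq_top.1 (by_contra fun hne => ?_)⟩
  obtain ⟨W, hW⟩ := exists_isCompl (LinearMap.range f)
  have hW0 : W ≠ ⊥ := by
    rintro rfl
    exact hne (eq_top_of_isCompl_bot hW)
  obtain ⟨T, hT, hTW⟩ := (eq_bot_or_exists_atom_le W).resolve_left hW0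
  have hTs : IsSimpleModule R T := isSimpleModule_iff_isAtom.2 hT
  have hja : 𝔧 ≤ Module.annihilator R T := fun a ha => Module.mem_annihilator.2 fun x =>
    Subtype.ext (hP a ha x)
  have hss := isSemisimpleModule_quotient_of_le hja
  have hQ : IsMaximalTwoSided (Module.annihilator R T) := isMaximalTwoSided_annihilator
  have hdisj : Disjoint (LinearMap.range f) T := hW.disjoint.mono_right hTW
  set K := LinearMap.ker f with hK
  -- If this failed, `T` would embed in `ker f` as a summand of the source, and changing `f` on that
  -- summand would enlarge the range by `T`.
  have hKQ : Module.annihilator R T • (⊤ : Submodule R K) = ⊤ := by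
    by_contra hne'
    have hnt : Nontrivial (K ⧸ Module.annihilator R T • (⊤ : Submodule R K)) :=
      Submodule.Quotient.nontrivial_iff.2 hne'
    obtain ⟨T', hT', -⟩ := (eq_bot_or_exists_atom_le
      (⊤ : Submodule R (K ⧸ Module.annihilator R T • (⊤ : Submodule R K)))).resolve_left top_ne_bot
    have hTs' : IsSimpleModule R T' := isSimpleModule_iff_isAtom.2 hT'
    obtain ⟨e⟩ := nonempty_linearEquiv_of_annihilator_le (T := T) (T' := T') fun a ha =>
      Module.mem_annihilator.2 fun x => Subtype.ext (by
        obtain ⟨y, hy⟩ := Submodule.Quotient.mk_surjective _ x.1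
        rw [Submodule.coe_smul, ← hy, ← Submodule.Quotient.mk_smul, Submodule.coe_zero,
          Submodule.Quotient.mk_eq_zero]
        exact Submodule.smul_mem_smul ha trivial)
    obtain ⟨g, hg⟩ := IsSemisimpleModule.lifting_property
      (Submodule.mkQ (Module.annihilator R T • (⊤ : Submodule R K))) (Submodule.mkQ_surjective _)
      (T'.subtype ∘ₗ e.toLinearMap)
    let j : T →ₗ[R] (Fin n → R ⧸ 𝔧) := K.subtype ∘ₗ g
    have hj : Function.Injective j := by
      have : Function.Injective (Submodule.mkQ (Module.annihilator R T • (⊤ : Submodule R K)) ∘ₗ g) := by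
        rw [hg]
        exact T'.injective_subtype.comp e.injective
      exact K.injective_subtype.comp (Function.Injective.of_comp this)
    obtain ⟨p, hp⟩ := IsSemisimpleModule.extension_property j hj LinearMap.id
    have hT1 : T ≤ LinearMap.range (f + T.subtype ∘ₗ p) := fun x hx => ⟨j ⟨x, hx⟩, by
      have h1 : f (j ⟨x, hx⟩) = 0 := (g ⟨x, hx⟩).2
      have h2 : p (j ⟨x, hx⟩) = ⟨x, hx⟩ := LinearMap.congr_fun hp _
      simp [h1, h2]⟩
    refine hmax _ ⟨f + T.subtype ∘ₗ p, rfl⟩ (lt_of_le_of_ne ?_ fun h => ?_)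
    · rintro _ ⟨x, rfl⟩
      have h1 : f x = (f + T.subtype ∘ₗ p) x - T.subtype (p x) := by simp
      rw [h1]
      exact Submodule.sub_mem _ ⟨x, rfl⟩ (hT1 (p x).2)
    · rw [← h] at hT1
      exact hT.1 (hdisj.eq_bot_of_ge hT1)
  let g : ((Fin n → R ⧸ 𝔧) × T) →ₗ[R] P := f.coprod T.subtype
  have hprod : IsSemisimpleModule R ((Fin n → R ⧸ 𝔧) × T) := isSemisimpleModule_prod
  obtain ⟨s, hs⟩ := IsSemisimpleModule.lifting_property g.rangeRestrict g.surjective_rangeRestrict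
    LinearMap.id
  obtain ⟨ρ, hρ⟩ := IsSemisimpleModule.extension_property (LinearMap.range g).subtype
    (Submodule.injective_subtype _) LinearMap.id
  -- Since `QK = K`, the map `θ` kills `ker g`. It therefore descends to the range of `g`, extends
  -- to `P`, and exhibits `(R/Q)^n × T` as a quotient of `P/QP`.
  let θ : ((Fin n → R ⧸ 𝔧) × T) →ₗ[R] ((Fin n → R ⧸ Module.annihilator R T) × T) :=
    LinearMap.prodMap ((Submodule.factor hja).compLeft (Fin n)) LinearMap.id
  have hθ : Function.Surjective θ := by
    rintro ⟨x, y⟩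
    choose z hz using fun i => Submodule.factor_surjective hja (x i)
    exact ⟨(z, y), Prod.ext (funext hz) rfl⟩
  have hθQ : ∀ a ∈ Module.annihilator R T, ∀ x : (Fin n → R ⧸ Module.annihilator R T) × T,
      a • x = 0 := fun a ha x => by
    refine Prod.ext (funext fun i => ?_) (Module.mem_annihilator.1 ha _)
    obtain ⟨r, hr⟩ := Submodule.Quotient.mk_surjective _ (x.1 i)
    change a • x.1 i = 0
    rw [← hr, ← Submodule.Quotient.mk_smul, Submodule.Quotient.mk_eq_zero]
    exact (Module.annihilator R T).mul_mem_right _ ha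
  have hker : ∀ x, g x = 0 → θ x = 0 := by
    rintro ⟨x, y⟩ hxy
    have h1 : f x + y = 0 := hxy
    have hy : (y : P) = 0 := by
      have h2 : (y : P) ∈ LinearMap.range f := by
        rw [← neg_eq_of_add_eq_zero_right h1]
        exact Submodule.neg_mem _ ⟨x, rfl⟩
      exact Submodule.disjoint_def.1 hdisj _ h2 y.2
    rw [hy, add_zero] at h1
    obtain rfl : y = 0 := Subtype.ext hy
    have h3 : (⟨x, h1⟩ : K) ∈ Module.annihilator R T • (⊤ : Submodule R K) := hKQ.symm ▸ Submodule.mem_top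
    have h4 : ∀ z ∈ Module.annihilator R T • (⊤ : Submodule R K), θ ((z : Fin n → R ⧸ 𝔧), 0) = 0 := by
      intro z hz
      induction hz using Submodule.smul_induction_on' with
      | smul r hr y _ =>
        have : (((r • y : K) : Fin n → R ⧸ 𝔧), (0 : T)) = r • ((y : Fin n → R ⧸ 𝔧), (0 : T)) := by
          simp
        rw [this, map_smul, hθQ r hr]
      | add x _ y _ hx hy =>
        have : (((x + y : K) : Fin n → R ⧸ 𝔧), (0 : T)) =
          ((x : Fin n → R ⧸ 𝔧), (0 : T)) + ((y : Fin n → R ⧸ 𝔧), (0 : T)) := by simp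
        rw [this, map_add, hx, hy, add_zero]
    exact h4 _ h3
  have hsurj : Function.Surjective (θ ∘ₗ s ∘ₗ ρ) := fun y => by
    obtain ⟨x, rfl⟩ := hθ y
    refine ⟨g x, ?_⟩
    have h1 : ρ (g x) = ⟨g x, ⟨x, rfl⟩⟩ := LinearMap.congr_fun hρ ⟨g x, ⟨x, rfl⟩⟩
    have h2 : g (s ⟨g x, ⟨x, rfl⟩⟩) = g x :=
      congrArg Subtype.val (LinearMap.congr_fun hs ⟨g x, ⟨x, rfl⟩⟩)
    change θ (s (ρ (g x))) = θ x
    rw [h1, ← sub_eq_zero, ← map_sub]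
    exact hker _ (by rw [map_sub, h2, sub_self])
  have hle := hlen _ hQ hja
  have hlow : Module.length R ((Fin n → R ⧸ Module.annihilator R T) × T) ≤
      Module.length R (P ⧸ Module.annihilator R T • (⊤ : Submodule R P)) := by
    refine Module.length_le_of_surjective (Submodule.liftQ _ (θ ∘ₗ s ∘ₗ ρ) ?_) ?_
    · rw [Submodule.smul_le]
      intro a ha x _
      rw [LinearMap.mem_ker, map_smul, hθQ a ha]
    · intro y
      obtain ⟨x, rfl⟩ := hsurj y
      exact ⟨Submodule.Quotient.mk x, by simp⟩
  rw [Module.length_prod, Module.length_eq_one R T, Module.length_pi, ENat.card_eq_coe_fintype_card,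
    Fintype.card_fin] at hlow
  have hfin : (n : ℕ∞) * Module.length R (R ⧸ Module.annihilator R T) ≠ ⊤ :=
    WithTop.mul_ne_top (ENat.natCast_ne_top n) Module.length_ne_top
  exact absurd (hlow.trans hle) (not_le.2 (ENat.lt_add_left hfin one_pos |>.trans_eq (add_comm _ _)))

end MaximalTwoSided

/-! ### Lengths of `M/QM` and local generators. -/

section QuotientLength

variable {R Z M P : Type*} [Ring R] [CommRing Z] [Algebra Z R] [AddCommGroup M] [Module R M]
  [AddCommGroup P] [Module R P]

theorem length_quotient_le_of_smul_mem_range (Q : Ideal R) (f : M →ₗ[R] P) {c : R}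
    (hc : c - 1 ∈ Q) (hf : ∀ x, c • x ∈ LinearMap.range f) :
    Module.length R (P ⧸ Q • (⊤ : Submodule R P)) ≤
      Module.length R (M ⧸ Q • (⊤ : Submodule R M)) := by
  refine Module.length_le_of_surjective (Submodule.mapQ _ _ f ?_) fun y => ?_
  · rw [Submodule.smul_le]
    intro r hr x _
    rw [Submodule.mem_comap, map_smul]
    exact Submodule.smul_mem_smul hr trivial
  · obtain ⟨x, rfl⟩ := Submodule.Quotient.mk_surjective _ y
    obtain ⟨y, hy⟩ := hf x
    refine ⟨Submodule.Quotient.mk y, ?_⟩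
    rw [Submodule.mapQ_apply, hy, Submodule.Quotient.eq]
    have h : c • x - x = (c - 1) • x := by rw [sub_smul, one_smul]
    rw [h]
    exact Submodule.smul_mem_smul hc trivial

theorem length_quotient_le_of_surjective (Q : Ideal R) (f : M →ₗ[R] P)
    (hf : Function.Surjective f) :
    Module.length R (P ⧸ Q • (⊤ : Submodule R P)) ≤
      Module.length R (M ⧸ Q • (⊤ : Submodule R M)) :=
  length_quotient_le_of_smul_mem_range Q f (c := 1) (by simp) fun x => hf _

theorem length_quotient_piDep {ι : Type*} [Fintype ι] (Q : Ideal R) (M : ι → Type*)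
    [∀ i, AddCommGroup (M i)] [∀ i, Module R (M i)] :
    Module.length R ((∀ i, M i) ⧸ Q • (⊤ : Submodule R (∀ i, M i))) =
      ∑ i, Module.length R (M i ⧸ Q • (⊤ : Submodule R (M i))) := by
  classical
  let f : (∀ i, M i) →ₗ[R] (∀ i, M i ⧸ Q • (⊤ : Submodule R (M i))) :=
    LinearMap.pi fun i => Submodule.mkQ _ ∘ₗ LinearMap.proj i
  have hf : Function.Surjective f := fun y => by
    choose x hx using fun i => Submodule.mkQ_surjective _ (y i)
    exact ⟨x, funext hx⟩
  have hker : LinearMap.ker f = Q • (⊤ : Submodule R (∀ i, M i)) := by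
    refine le_antisymm (fun x hx => ?_) ?_
    · have h1 : ∀ i, x i ∈ Q • (⊤ : Submodule R (M i)) := fun i =>
        (Submodule.Quotient.mk_eq_zero _).1 (congrFun (LinearMap.mem_ker.1 hx) i)
      have h2 : x = ∑ i, LinearMap.single R M i (x i) := by
        simp [LinearMap.single_apply, Finset.univ_sum_single]
      rw [h2]
      refine Submodule.sum_mem _ fun i _ => ?_
      have h3 : Q • (⊤ : Submodule R (M i)) ≤
          (Q • (⊤ : Submodule R (∀ i, M i))).comap (LinearMap.single R M i) := by
        rw [Submodule.smul_le]
        intro r hr y _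
        rw [Submodule.mem_comap, map_smul]
        exact Submodule.smul_mem_smul hr trivial
      exact h3 (h1 i)
    · rw [Submodule.smul_le]
      intro r hr x _
      refine LinearMap.mem_ker.2 (funext fun i => ?_)
      exact (Submodule.Quotient.mk_eq_zero _).2 (Submodule.smul_mem_smul hr trivial)
  rw [← hker, (f.quotKerEquivOfSurjective hf).length_eq, Module.length_pi_of_fintype]

theorem length_quotient_pi (Q : Ideal R) (t : ℕ) :
    Module.length R ((Fin t → M) ⧸ Q • (⊤ : Submodule R (Fin t → M))) =
      t * Module.length R (M ⧸ Q • (⊤ : Submodule R M)) := by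
  rw [length_quotient_piDep]
  simp

theorem length_quotient_self (Q : Ideal R) [Q.IsTwoSided] :
    Module.length R (R ⧸ Q • (⊤ : Submodule R R)) = Module.length R (R ⧸ Q) := by
  have h : Q • (⊤ : Submodule R R) = Q := by
    refine le_antisymm ?_ fun x hx => ?_
    · rw [Submodule.smul_le]
      exact fun r hr x _ => Q.mul_mem_right x hr
    · rw [← mul_one x]
      exact Submodule.smul_mem_smul hx (Submodule.mem_top (x := (1 : R)))
  exact (Submodule.quotEquivOfEq _ _ h).length_eq

theorem length_quotient_fin (Q : Ideal R) [Q.IsTwoSided] (n : ℕ) :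
    Module.length R ((Fin n → R) ⧸ Q • (⊤ : Submodule R (Fin n → R))) =
      n * Module.length R (R ⧸ Q) := by
  rw [length_quotient_pi, length_quotient_self]

theorem IsLocalIdeal.isSemisimpleModule {m : Ideal Z} {𝔧 : Ideal R} [𝔧.IsTwoSided]
    (h : IsLocalIdeal m 𝔧) : IsSemisimpleModule R (R ⧸ 𝔧) := by
  have := h.semisimple
  let l : (R ⧸ 𝔧) →ₛₗ[Ideal.Quotient.mk 𝔧] (R ⧸ 𝔧) :=
    { toFun := id, map_add' := fun _ _ => rfl, map_smul' := fun r x => by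
        obtain ⟨y, rfl⟩ := Ideal.Quotient.mk_surjective x
        rfl }
  have : RingHomSurjective (Ideal.Quotient.mk 𝔧) := ⟨Ideal.Quotient.mk_surjective⟩
  exact (LinearMap.isSemisimpleModule_iff_of_bijective l Function.bijective_id).2 inferInstance

/-- If `𝔧 + Q = R` for the local ideal `𝔧` of every `m`, Nakayama's lemma for `R ⧸ Q` gives, for
each `m`, an element of `Z` outside `m` that maps into `Q`; then `1 ∈ Q`. -/
theorem IsMaximalTwoSided.exists_isLocalIdeal (hR : HasLocalIdeals R Z) {Q : Ideal R}
    (hQ : IsMaximalTwoSided Q) : ∃ m : Ideal Z, m.IsMaximal ∧ ∃ (𝔧 : Ideal R) (_ : 𝔧.IsTwoSided),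
      IsLocalIdeal m 𝔧 ∧ 𝔧 ≤ Q := by
  by_contra! hcon
  have hQ2 := hQ.isTwoSided
  have key : ∀ m : Ideal Z, m.IsMaximal → ∃ s ∉ m, algebraMap Z R s ∈ Q := fun m hm => by
    obtain ⟨𝔧, h𝔧2, h𝔧⟩ := hR m hm
    have hsup : 𝔧 ⊔ Q = ⊤ := by
      by_contra hne
      have h2 : (𝔧 ⊔ Q).IsTwoSided := ⟨fun {a} b ha => by
        obtain ⟨x, hx, y, hy, rfl⟩ := Submodule.mem_sup.1 ha
        rw [add_mul]
        exact Submodule.add_mem_sup (𝔧.mul_mem_right b hx) (Q.mul_mem_right b hy)⟩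
      exact hcon m hm 𝔧 h𝔧2 h𝔧 (le_sup_left.trans (hQ.le_of_le _ h2 hne le_sup_right))
    obtain ⟨s, hs, hs'⟩ := h𝔧.nakayama (P := R ⧸ Q) hm (by
      rw [eq_top_iff]
      rintro x -
      obtain ⟨r, rfl⟩ := Submodule.Quotient.mk_surjective _ x
      obtain ⟨a, ha, b, hb, hab⟩ := Submodule.mem_sup.1 (hsup ▸ Submodule.mem_top : (1 : R) ∈ 𝔧 ⊔ Q)
      have h1 : (Submodule.Quotient.mk r : R ⧸ Q) = a • Submodule.Quotient.mk r := by
        rw [← Submodule.Quotient.mk_smul, Submodule.Quotient.eq]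
        have : r - a • r = b * r := by
          rw [smul_eq_mul, sub_eq_iff_eq_add', ← add_mul, hab, one_mul]
        rw [this]
        exact Q.mul_mem_right _ hb
      rw [h1]
      exact Submodule.smul_mem_smul ha trivial)
    refine ⟨s, hs, ?_⟩
    have := hs' (Submodule.Quotient.mk 1)
    rwa [← Submodule.Quotient.mk_smul, Submodule.Quotient.mk_eq_zero, smul_eq_mul, mul_one] at this
  have htop : Q.comap (algebraMap Z R) = ⊤ := by
    by_contra hne
    obtain ⟨m, hm, hle⟩ := Ideal.exists_le_maximal _ hne
    obtain ⟨s, hs, hs'⟩ := key m hm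
    exact hs (hle hs')
  refine hQ.ne_top ((Ideal.eq_top_iff_one _).2 ?_)
  have : (1 : Z) ∈ Q.comap (algebraMap Z R) := htop ▸ Submodule.mem_top
  rwa [Ideal.mem_comap, map_one] at this

theorem IsLocalIdeal.exists_sub_one_mem {m : Ideal Z} {𝔧 Q : Ideal R} [𝔧.IsTwoSided]
    (h : IsLocalIdeal m 𝔧) (hm : m.IsMaximal) (hQ : 𝔧 ≤ Q) {s : Z} (hs : s ∉ m) :
    ∃ z, algebraMap Z R (z * s) - 1 ∈ Q := by
  obtain ⟨z, hz⟩ := Ideal.exists_mul_sub_one_mem hm hs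
  refine ⟨z, hQ ?_⟩
  rw [← map_one (algebraMap Z R), ← map_sub]
  exact h.map_mem _ hz

theorem exists_quotient_span_of_length_le {𝔧 : Ideal R} [𝔧.IsTwoSided]
    [IsSemisimpleModule R (R ⧸ 𝔧)] [Module.Finite R M] {n : ℕ}
    (hlen : ∀ Q : Ideal R, IsMaximalTwoSided Q → 𝔧 ≤ Q →
      Module.length R (M ⧸ Q • (⊤ : Submodule R M)) ≤ n * Module.length R (R ⧸ Q)) :
    ∃ v : Fin n → M,
      𝔧 • (⊤ : Submodule R (M ⧸ Submodule.span R (Set.range v))) = ⊤ := by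
  obtain ⟨f, hf⟩ := exists_surjective_of_length_le (P := M ⧸ 𝔧 • (⊤ : Submodule R M)) (𝔧 := 𝔧)
    (n := n) (fun a ha x => by
      obtain ⟨x, rfl⟩ := Submodule.Quotient.mk_surjective _ x
      rw [← Submodule.Quotient.mk_smul, Submodule.Quotient.mk_eq_zero]
      exact Submodule.smul_mem_smul ha trivial)
    (fun Q hQ hle => (length_quotient_le_of_surjective Q (Submodule.mkQ _)
      (Submodule.mkQ_surjective _)).trans (hlen Q hQ hle))
  choose v hv using fun i : Fin n =>
    Submodule.Quotient.mk_surjective _ (f (Pi.single i (Submodule.Quotient.mk 1)))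
  refine ⟨v, eq_top_iff.2 ?_⟩
  rintro x -
  obtain ⟨x, rfl⟩ := Submodule.Quotient.mk_surjective _ x
  obtain ⟨c, hc⟩ := hf (Submodule.Quotient.mk x)
  choose r hr using fun i => Submodule.Quotient.mk_surjective _ (c i)
  have h1 : c = ∑ i, r i • (Pi.single i (Submodule.Quotient.mk 1) : Fin n → R ⧸ 𝔧) := by
    funext j
    rw [Finset.sum_apply, Finset.sum_eq_single j (fun l _ hl => by
      rw [Pi.smul_apply, Pi.single_eq_of_ne hl.symm, smul_zero]) (by simp), Pi.smul_apply,
      Pi.single_eq_same, ← Submodule.Quotient.mk_smul, smul_eq_mul, mul_one, hr]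
  have h2 : x - ∑ i, r i • v i ∈ 𝔧 • (⊤ : Submodule R M) := by
    rw [← Submodule.Quotient.mk_eq_zero, Submodule.Quotient.mk_sub, ← hc, h1, map_sum, sub_eq_zero]
    refine Eq.trans ?_ (map_sum (Submodule.mkQ (𝔧 • (⊤ : Submodule R M))) _ _).symm
    exact Finset.sum_congr rfl fun i _ => by rw [map_smul, map_smul, ← hv, Submodule.mkQ_apply]
  have h3 : (Submodule.Quotient.mk x : M ⧸ Submodule.span R (Set.range v)) =
      Submodule.mkQ _ (x - ∑ i, r i • v i) := by
    rw [map_sub, Submodule.mkQ_apply, eq_comm, sub_eq_self, Submodule.mkQ_apply,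
      Submodule.Quotient.mk_eq_zero]
    exact Submodule.sum_mem _ fun i _ => Submodule.smul_mem _ _ (Submodule.subset_span ⟨i, rfl⟩)
  rw [h3]
  have h4 : 𝔧 • (⊤ : Submodule R M) ≤ (𝔧 • (⊤ : Submodule R (M ⧸ Submodule.span R (Set.range v)))).comap
      (Submodule.mkQ _) := by
    rw [Submodule.smul_le]
    intro r hr y _
    rw [Submodule.mem_comap, map_smul]
    exact Submodule.smul_mem_smul hr trivial
  exact h4 h2

theorem smul_mem_of_smul_quotient_eq_zero {N : Submodule R M} {r : R}
    (h : ∀ x : M ⧸ N, r • x = 0) (x : M) : r • x ∈ N := by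
  have := h (Submodule.Quotient.mk x)
  rwa [← Submodule.Quotient.mk_smul, Submodule.Quotient.mk_eq_zero] at this

theorem IsLocalIdeal.exists_generators {m : Ideal Z} {𝔧 : Ideal R} [𝔧.IsTwoSided]
    (h : IsLocalIdeal m 𝔧) (hm : m.IsMaximal) [Module.Finite R M] {n : ℕ}
    (hlen : ∀ Q : Ideal R, IsMaximalTwoSided Q → 𝔧 ≤ Q →
      Module.length R (M ⧸ Q • (⊤ : Submodule R M)) ≤ n * Module.length R (R ⧸ Q)) :
    ∃ v : Fin n → M, ∃ s ∉ m, ∀ x, algebraMap Z R s • x ∈ Submodule.span R (Set.range v) := by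
  have := h.isSemisimpleModule
  obtain ⟨v, hv⟩ := exists_quotient_span_of_length_le hlen
  obtain ⟨s, hs, hs'⟩ := h.nakayama hm hv
  exact ⟨v, s, hs, smul_mem_of_smul_quotient_eq_zero hs'⟩

/-- The quotient by `𝔧 ⊓ 𝔧'` is still semisimple, so one family serves both maximal ideals. Prime
avoidance merges the two denominators into one. -/
theorem HasLocalIdeals.exists_generators (hR : HasLocalIdeals R Z) [Module.Finite R M] {n : ℕ}
    (hlen : ∀ Q : Ideal R, IsMaximalTwoSided Q →
      Module.length R (M ⧸ Q • (⊤ : Submodule R M)) ≤ n * Module.length R (R ⧸ Q))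
    (m m' : Ideal Z) (hm : m.IsMaximal) (hm' : m'.IsMaximal) :
    ∃ v : Fin n → M, ∃ s : Z, s ∉ m ∧ s ∉ m' ∧
      ∀ x, algebraMap Z R s • x ∈ Submodule.span R (Set.range v) := by
  obtain ⟨𝔧, _, h⟩ := hR m hm
  obtain ⟨𝔧', _, h'⟩ := hR m' hm'
  have h1 := h.isSemisimpleModule
  have h2 := h'.isSemisimpleModule
  have h3 : IsSemisimpleModule R (R ⧸ (𝔧 ⊓ 𝔧')) := by
    have := isSemisimpleModule_prod (R := R) (T := R ⧸ 𝔧) (T' := R ⧸ 𝔧')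
    let f : (R ⧸ (𝔧 ⊓ 𝔧')) →ₗ[R] (R ⧸ 𝔧) × (R ⧸ 𝔧') :=
      (Submodule.factor inf_le_left).prod (Submodule.factor inf_le_right)
    refine .of_injective f fun x y hxy => ?_
    obtain ⟨x, rfl⟩ := Submodule.Quotient.mk_surjective _ x
    obtain ⟨y, rfl⟩ := Submodule.Quotient.mk_surjective _ y
    exact (Submodule.Quotient.eq _).2 ⟨(Submodule.Quotient.eq _).1 (congrArg Prod.fst hxy),
      (Submodule.Quotient.eq _).1 (congrArg Prod.snd hxy)⟩
  have h4 : (𝔧 ⊓ 𝔧').IsTwoSided :=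
    ⟨fun {_} b ha => ⟨𝔧.mul_mem_right b ha.1, 𝔧'.mul_mem_right b ha.2⟩⟩
  obtain ⟨v, hv⟩ := exists_quotient_span_of_length_le (𝔧 := 𝔧 ⊓ 𝔧') fun Q hQ _ => hlen Q hQ
  obtain ⟨s, hs, hs'⟩ := h.nakayama hm (top_le_iff.1
    (hv.ge.trans (Submodule.smul_mono_left inf_le_left)))
  obtain ⟨s₁, hs₁, hs₁'⟩ := h'.nakayama hm' (top_le_iff.1
    (hv.ge.trans (Submodule.smul_mono_left inf_le_right)))
  let I : Ideal Z := (Module.annihilator R (M ⧸ Submodule.span R (Set.range v))).comap (algebraMap Z R)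
  have hI : ¬ ((I : Set Z) ⊆ m ∪ m') := fun hsub => by
    rcases Ideal.subset_union.1 hsub with hle | hle
    · exact hs (hle (Module.mem_annihilator.2 hs'))
    · exact hs₁ (hle (Module.mem_annihilator.2 hs₁'))
  obtain ⟨u, hu, hu'⟩ := Set.not_subset.1 hI
  rw [Set.mem_union, not_or] at hu'
  exact ⟨v, u, hu'.1, hu'.2, smul_mem_of_smul_quotient_eq_zero (Module.mem_annihilator.1 hu)⟩

theorem HasLocalIdeals.isFiniteLength (hR : HasLocalIdeals R Z) {Q : Ideal R}
    (hQ : IsMaximalTwoSided Q) : IsNoetherian R (R ⧸ Q) ∧ IsArtinian R (R ⧸ Q) := by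
  obtain ⟨m, hm, 𝔧, _, h, hle⟩ := hQ.exists_isLocalIdeal hR
  have := h.isSemisimpleModule
  have := isSemisimpleModule_quotient_of_le hle
  exact ⟨inferInstance, inferInstance⟩

theorem HasLocalIdeals.length_ne_top (hR : HasLocalIdeals R Z) {Q : Ideal R}
    (hQ : IsMaximalTwoSided Q) : Module.length R (R ⧸ Q) ≠ ⊤ := by
  obtain ⟨_, _⟩ := hR.isFiniteLength hQ
  exact Module.length_ne_top

theorem exists_length_quotient_le (Q : Ideal R) [Q.IsTwoSided] [Module.Finite R M] : ∃ n : ℕ,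
    Module.length R (M ⧸ Q • (⊤ : Submodule R M)) ≤ n * Module.length R (R ⧸ Q) := by
  obtain ⟨n, f, hf⟩ := Module.Finite.exists_fin' R M
  exact ⟨n, (length_quotient_le_of_surjective Q f hf).trans_eq (length_quotient_fin Q n)⟩

end QuotientLength

/-! ### Constancy of the length ratio and the rank of finite objects. -/

section RankOfFinite

variable {k H R M Z : Type*} [Field k] [Ring H] [HopfAlgebra k H] [Ring R] [AddCommGroup M]
  [Module R M] [CommRing Z] [Algebra Z R] {σ : H →+* AddMonoid.End R} {ρ : H →+* AddMonoid.End M}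

/-- The coordinatewise action. -/
def piAction {ι : Type*} {M : ι → Type*} [∀ i, AddCommGroup (M i)]
    (ρ : ∀ i, H →+* AddMonoid.End (M i)) : H →+* AddMonoid.End (∀ i, M i) where
  toFun h :=
    { toFun := fun f i => ρ i h (f i)
      map_zero' := funext fun i => map_zero (ρ i h)
      map_add' := fun _ _ => funext fun i => map_add (ρ i h) _ _ }
  map_one' := AddMonoidHom.ext fun f => funext fun i => DFunLike.congr_fun (map_one (ρ i)) (f i)
  map_mul' g h :=
    AddMonoidHom.ext fun f => funext fun i => DFunLike.congr_fun (map_mul (ρ i) g h) (f i)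
  map_zero' := AddMonoidHom.ext fun f => funext fun i => DFunLike.congr_fun (map_zero (ρ i)) (f i)
  map_add' g h :=
    AddMonoidHom.ext fun f => funext fun i => DFunLike.congr_fun (map_add (ρ i) g h) (f i)

theorem IsEquivariant.pi {ι : Type*} {M : ι → Type*} [∀ i, AddCommGroup (M i)]
    [∀ i, Module R (M i)] {ρ : ∀ i, H →+* AddMonoid.End (M i)}
    (hρ : ∀ i, IsEquivariant k σ (ρ i)) : IsEquivariant k σ (piAction ρ) :=
  fun d t ht i j r x => by
    funext e
    rw [Finset.sum_apply]
    exact hρ e ht i j r (x e)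

theorem IsLocallyFreeOfRank.length_eq {P : Type*} [AddCommGroup P] [Module R P] {n : ℕ}
    (hP : IsLocallyFreeOfRank R Z P n) (hR : HasLocalIdeals R Z) {Q : Ideal R}
    (hQ : IsMaximalTwoSided Q) :
    Module.length R (P ⧸ Q • (⊤ : Submodule R P)) = n * Module.length R (R ⧸ Q) := by
  have := hQ.isTwoSided
  obtain ⟨m, hm, 𝔧, _, h, hle⟩ := hQ.exists_isLocalIdeal hR
  obtain ⟨s, hs, π, τ, hπ, hτ⟩ := hP m hm
  obtain ⟨z, hz⟩ := h.exists_sub_one_mem hm hle hs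
  rw [← length_quotient_fin]
  refine le_antisymm (length_quotient_le_of_smul_mem_range Q π hz fun x => ?_)
    (length_quotient_le_of_smul_mem_range Q τ hz fun x => ?_)
  · rw [map_mul, mul_smul, ← hπ]
    exact Submodule.smul_mem _ _ ⟨_, rfl⟩
  · rw [map_mul, mul_smul, ← hτ]
    exact Submodule.smul_mem _ _ ⟨_, rfl⟩

variable (R) in
/-- The greatest common divisor of the lengths of the quotients by maximal two-sided ideals. -/
noncomputable def lengthGcd : ℕ :=
  Nat.setGcd {n : ℕ | ∃ Q : Ideal R, IsMaximalTwoSided Q ∧ Module.length R (R ⧸ Q) = n}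

/-- After cancelling the gcd of `t` and `n`, what remains of `t` divides every length, hence their
gcd. -/
theorem dvd_mul_lengthGcd {t n : ℕ} (ht : t ≠ 0)
    (h : ∀ Q : Ideal R, IsMaximalTwoSided Q → ∀ a : ℕ, Module.length R (R ⧸ Q) = a → t ∣ n * a) :
    t ∣ n * lengthGcd R := by
  obtain ⟨g, t', n', hg, hco, rfl, rfl⟩ := Nat.exists_coprime' (Nat.gcd_pos_of_pos_left n ht.bot_lt)
  have h1 : t' ∣ lengthGcd R := Nat.dvd_setGcd_iff.2 fun a ⟨Q, hQ, ha⟩ => by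
    have h2 := h Q hQ a ha
    rw [mul_right_comm] at h2
    exact hco.dvd_of_dvd_mul_left (Nat.dvd_of_mul_dvd_mul_right hg h2)
  rw [mul_comm t' g, mul_comm n' g, mul_assoc]
  exact Nat.mul_dvd_mul_left g (h1.mul_left n')

theorem IsMaximalTwoSided.length_pos {Q : Ideal R} (hQ : IsMaximalTwoSided Q) :
    0 < Module.length R (R ⧸ Q) :=
  Module.length_pos_iff.2 (Submodule.Quotient.nontrivial_iff.2 hQ.ne_top)

theorem IsLocalIdeal.ne_top (hZ : Function.Injective (algebraMap Z R)) {m : Ideal Z} {𝔧 : Ideal R}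
    [𝔧.IsTwoSided] (h : IsLocalIdeal m 𝔧) : 𝔧 ≠ ⊤ := fun h1 => by
  obtain ⟨b, s, hs, hb⟩ := h.exists_mul_eq 1 (h1 ▸ Submodule.mem_top)
  rw [sub_self, mul_zero, ← map_zero (algebraMap Z R)] at hb
  exact hs (hZ hb ▸ m.zero_mem)

theorem HasLocalIdeals.exists_isMaximalTwoSided [Nontrivial R] (hR : HasLocalIdeals R Z)
    (hZ : Function.Injective (algebraMap Z R)) : ∃ Q : Ideal R, IsMaximalTwoSided Q := by
  have : Nontrivial Z := (algebraMap Z R).domain_nontrivial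
  obtain ⟨m, hm⟩ := Ideal.exists_maximal Z
  obtain ⟨𝔧, _, h⟩ := hR m hm
  have := h.isSemisimpleModule
  obtain ⟨Q, hQ, -⟩ := _root_.exists_isMaximalTwoSided (h.ne_top hZ)
  exact ⟨Q, hQ⟩

theorem lengthGcd_ne_zero [Nontrivial R] (hR : HasLocalIdeals R Z)
    (hZ : Function.Injective (algebraMap Z R)) : lengthGcd R ≠ 0 := by
  obtain ⟨Q, hQ⟩ := hR.exists_isMaximalTwoSided hZ
  obtain ⟨a, ha⟩ := ENat.ne_top_iff_exists.1 (hR.length_ne_top hQ)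
  have h1 : lengthGcd R ∣ a := Nat.setGcd_dvd_of_mem ⟨Q, hQ, ha.symm⟩
  intro h0
  rw [h0, zero_dvd_iff] at h1
  have := hQ.length_pos
  rw [← ha, h1] at this
  simp at this

theorem HasLocalIdeals.length_quotient_ne_top (hR : HasLocalIdeals R Z) [Module.Finite R M]
    {Q : Ideal R} (hQ : IsMaximalTwoSided Q) :
    Module.length R (M ⧸ Q • (⊤ : Submodule R M)) ≠ ⊤ := by
  have := hQ.isTwoSided
  obtain ⟨n, hn⟩ := exists_length_quotient_le (M := M) Q
  exact ne_top_of_le_ne_top (WithTop.mul_ne_top (ENat.natCast_ne_top n) (hR.length_ne_top hQ)) hn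

/-- Only finitely many pairs of lengths occur for `Q ⊇ 𝔧`, so the ratio has a maximum `b / a` among
these. Then `M^a` is generated near `m` by `b` elements, and this bounds the ratio at every `Q`
modulo which `s` is invertible. -/
theorem exists_cover_length_ratio (hR : HasLocalIdeals R Z)
    (hZ : Function.Injective (algebraMap Z R)) [Module.Finite R M] (m : Ideal Z) (hm : m.IsMaximal) :
    ∃ Q₀ : Ideal R, IsMaximalTwoSided Q₀ ∧ ∃ s ∉ m, ∀ Q : Ideal R, IsMaximalTwoSided Q →
      ∀ c, algebraMap Z R (c * s) - 1 ∈ Q →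
      Module.length R (R ⧸ Q₀) * Module.length R (M ⧸ Q • (⊤ : Submodule R M)) ≤
        Module.length R (M ⧸ Q₀ • (⊤ : Submodule R M)) * Module.length R (R ⧸ Q) := by
  obtain ⟨𝔧, _, h⟩ := hR m hm
  have hs := h.isSemisimpleModule
  obtain ⟨N, f, hf⟩ := Module.Finite.exists_fin' R M
  obtain ⟨D, hD⟩ := ENat.ne_top_iff_exists.1 (Module.length_ne_top (R := R) (M := R ⧸ 𝔧))
  let S : Set (ℕ × ℕ) := {p | ∃ Q : Ideal R, IsMaximalTwoSided Q ∧ 𝔧 ≤ Q ∧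
    Module.length R (R ⧸ Q) = p.1 ∧ Module.length R (M ⧸ Q • (⊤ : Submodule R M)) = p.2}
  have hSfin : S.Finite := by
    refine ((Set.finite_Iic D).prod (Set.finite_Iic (N * D))).subset ?_
    rintro ⟨a, b⟩ ⟨Q, hQ, hle, ha, hb⟩
    have := hQ.isTwoSided
    have h1 : a ≤ D := by
      have := Module.length_le_of_surjective (Submodule.factor hle) (Submodule.factor_surjective hle)
      rw [ha, ← hD] at this
      exact_mod_cast this
    have h2 := (length_quotient_le_of_surjective Q f hf).trans_eq (length_quotient_fin Q N)
    simp only at ha hb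
    rw [ha, hb] at h2
    exact ⟨h1, le_trans (by exact_mod_cast h2) (Nat.mul_le_mul_left N h1)⟩
  have hmem : ∀ Q : Ideal R, IsMaximalTwoSided Q → 𝔧 ≤ Q → ∃ p ∈ S,
      Module.length R (R ⧸ Q) = (p.1 : ℕ) ∧
      Module.length R (M ⧸ Q • (⊤ : Submodule R M)) = (p.2 : ℕ) := fun Q hQ hle => by
    obtain ⟨a, ha⟩ := ENat.ne_top_iff_exists.1 (hR.length_ne_top hQ)
    obtain ⟨b, hb⟩ := ENat.ne_top_iff_exists.1 (hR.length_quotient_ne_top (M := M) hQ)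
    exact ⟨(a, b), ⟨Q, hQ, hle, ha.symm, hb.symm⟩, ha.symm, hb.symm⟩
  have hpos : ∀ p ∈ S, 0 < p.1 := fun p ⟨Q, hQ, _, ha, _⟩ => by
    have := hQ.length_pos
    rw [ha] at this
    exact_mod_cast this
  obtain ⟨Q₁, hQ₁, hle₁⟩ := exists_isMaximalTwoSided (h.ne_top hZ)
  obtain ⟨p₁, hp₁, -⟩ := hmem Q₁ hQ₁ hle₁
  obtain ⟨⟨a, b⟩, hp, hmax⟩ := Set.exists_max_image S (fun p => (p.2 : ℚ) / p.1) hSfin ⟨p₁, hp₁⟩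
  have hpS := hp
  obtain ⟨Q₀, hQ₀, hle₀, ha, hb⟩ := hp
  simp only at ha hb
  have hmax' : ∀ p ∈ S, a * p.2 ≤ b * p.1 := fun p hp => by
    have h1 := hmax p hp
    have h2 : (0 : ℚ) < a := by exact_mod_cast hpos _ hpS
    have h3 : (0 : ℚ) < p.1 := by exact_mod_cast hpos _ hp
    rw [div_le_div_iff₀ h3 h2] at h1
    rw [mul_comm a]
    exact_mod_cast h1
  obtain ⟨v, s, hs, hv⟩ := h.exists_generators (M := Fin a → M) hm (n := b) fun Q hQ hle => by
    obtain ⟨p, hp, h1, h2⟩ := hmem Q hQ hle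
    rw [length_quotient_pi, h1, h2]
    exact_mod_cast hmax' p hp
  refine ⟨Q₀, hQ₀, s, hs, fun Q hQ c hc => ?_⟩
  have := hQ.isTwoSided
  rw [ha, hb, ← length_quotient_pi, ← length_quotient_fin]
  refine length_quotient_le_of_smul_mem_range Q (Fintype.linearCombination R v) hc fun x => ?_
  rw [map_mul, mul_smul, Fintype.range_linearCombination]
  exact Submodule.smul_mem _ _ (hv x)

/-- Quasi-compactness of the maximal spectrum of `Z` reduces the local maxima to finitely many. -/
theorem exists_max_length_ratio [Nontrivial R] (hR : HasLocalIdeals R Z)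
    (hZ : Function.Injective (algebraMap Z R)) [Module.Finite R M] :
    ∃ Q₀ : Ideal R, IsMaximalTwoSided Q₀ ∧ ∀ Q : Ideal R, IsMaximalTwoSided Q →
      Module.length R (R ⧸ Q₀) * Module.length R (M ⧸ Q • (⊤ : Submodule R M)) ≤
        Module.length R (M ⧸ Q₀ • (⊤ : Submodule R M)) * Module.length R (R ⧸ Q) := by
  choose Q₀ hQ₀ s hs h using fun m : {m : Ideal Z // m.IsMaximal} =>
    exists_cover_length_ratio (M := M) hR hZ m.1 m.2
  obtain ⟨T, hT⟩ := exists_finite_cover s hs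
  choose a ha using fun m => ENat.ne_top_iff_exists.1 (hR.length_ne_top (hQ₀ m))
  choose b hb using fun m =>
    ENat.ne_top_iff_exists.1 (hR.length_quotient_ne_top (M := M) (hQ₀ m))
  have hpos : ∀ m, 0 < a m := fun m => by
    have := (hQ₀ m).length_pos
    rw [← ha] at this
    exact_mod_cast this
  have hcov : ∀ m : Ideal Z, m.IsMaximal → ∃ j ∈ T, s j ∉ m := fun m hm => by
    by_contra! hcon
    refine hm.ne_top (top_le_iff.1 (hT.ge.trans (Ideal.span_le.2 ?_)))
    rintro _ ⟨j, rfl⟩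
    exact hcon j j.2
  have : Nontrivial Z := (algebraMap Z R).domain_nontrivial
  obtain ⟨m₁, hm₁⟩ := Ideal.exists_maximal Z
  obtain ⟨j₁, hj₁, -⟩ := hcov m₁ hm₁
  obtain ⟨i, hi, hmax⟩ := Finset.exists_max_image T (fun m => (b m : ℚ) / a m) ⟨j₁, hj₁⟩
  refine ⟨Q₀ i, hQ₀ i, fun Q hQ => ?_⟩
  obtain ⟨m, hm, 𝔧, _, h𝔧, hle⟩ := hQ.exists_isLocalIdeal hR
  obtain ⟨j, hj, hjm⟩ := hcov m hm
  obtain ⟨c, hc⟩ := h𝔧.exists_sub_one_mem hm hle hjm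
  have h1 := h j Q hQ c hc
  have h2 := hmax j hj
  obtain ⟨a', ha'⟩ := ENat.ne_top_iff_exists.1 (hR.length_ne_top hQ)
  obtain ⟨b', hb'⟩ := ENat.ne_top_iff_exists.1 (hR.length_quotient_ne_top (M := M) hQ)
  have hai : (0 : ℚ) < a i := by exact_mod_cast hpos i
  have haj : (0 : ℚ) < a j := by exact_mod_cast hpos j
  rw [← ha, ← hb, ← ha', ← hb'] at h1 ⊢
  rw [div_le_div_iff₀ haj hai] at h2
  have h1' : (a j : ℚ) * b' ≤ b j * a' := by exact_mod_cast h1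
  have h3 : (a i : ℚ) * b' ≤ b i * a' := by
    refine le_of_mul_le_mul_left ?_ haj
    calc (a j : ℚ) * (a i * b') = a i * (a j * b') := by ring
      _ ≤ a i * (b j * a') := by gcongr
      _ = b j * a i * a' := by ring
      _ ≤ b i * a j * a' := by gcongr
      _ = a j * (b i * a') := by ring
  exact_mod_cast h3

theorem isLocallyFreeOfRank_of_forall_length_eq (hR : HasLocalIdeals R Z) (hσ : IsSimpleAction k σ)
    (hρ : IsEquivariant k σ ρ) [Module.Finite R M] {n : ℕ} {Q₀ : Ideal R}
    (hQ₀ : IsMaximalTwoSided Q₀)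
    (hlen₀ : Module.length R (M ⧸ Q₀ • (⊤ : Submodule R M)) = n * Module.length R (R ⧸ Q₀))
    (hlen : ∀ Q : Ideal R, IsMaximalTwoSided Q →
      Module.length R (M ⧸ Q • (⊤ : Submodule R M)) ≤ n * Module.length R (R ⧸ Q)) :
    IsLocallyFreeOfRank R Z M n := by
  have := hQ₀.isTwoSided
  obtain ⟨_, _⟩ := hR.isFiniteLength hQ₀
  exact isLocallyFreeOfRank_of_length_eq hR hσ hρ hQ₀.ne_top hlen₀ (hR.exists_generators hlen)

/-- Local freeness of `M^t` makes `t * length (M/QM) = n * length (R/Q)` hold for all `Q`. Hence `t`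
divides `n * l` for the gcd `l`, and `n * l / t` is the exact ratio for `M^l` at every `Q`, so the
criterion applies a second time. -/
theorem exists_isLocallyFreeOfRank_pi [Nontrivial R] (hR : HasLocalIdeals R Z)
    (hZ : Function.Injective (algebraMap Z R)) (hσ : IsSimpleAction k σ)
    (hρ : IsEquivariant k σ ρ) [Module.Finite R M] :
    ∃ n, IsLocallyFreeOfRank R Z (Fin (lengthGcd R) → M) n := by
  obtain ⟨Q₀, hQ₀, hmax⟩ := exists_max_length_ratio (M := M) hR hZ
  obtain ⟨t, ht⟩ := ENat.ne_top_iff_exists.1 (hR.length_ne_top hQ₀)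
  obtain ⟨n, hn⟩ := ENat.ne_top_iff_exists.1 (hR.length_quotient_ne_top (M := M) hQ₀)
  have ht0 : t ≠ 0 := by
    have := hQ₀.length_pos
    rw [← ht] at this
    exact (Nat.pos_iff_ne_zero.1 (by exact_mod_cast this))
  have h1 : IsLocallyFreeOfRank R Z (Fin t → M) n :=
    isLocallyFreeOfRank_of_forall_length_eq hR hσ (IsEquivariant.pi fun _ => hρ) hQ₀
      (by rw [length_quotient_pi, ← hn, ← ht, mul_comm]) fun Q hQ => by
        rw [length_quotient_pi, ht, hn]
        exact hmax Q hQ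
  have h2 : ∀ Q : Ideal R, IsMaximalTwoSided Q →
      t * Module.length R (M ⧸ Q • (⊤ : Submodule R M)) = n * Module.length R (R ⧸ Q) :=
    fun Q hQ => by rw [← length_quotient_pi, h1.length_eq hR hQ]
  obtain ⟨n', hn'⟩ := dvd_mul_lengthGcd (n := n) ht0 fun Q hQ a ha => by
    obtain ⟨b, hb⟩ := ENat.ne_top_iff_exists.1 (hR.length_quotient_ne_top (M := M) hQ)
    have h3 := h2 Q hQ
    rw [ha, ← hb] at h3
    exact ⟨b, by exact_mod_cast h3.symm⟩
  have h4 : ∀ Q : Ideal R, IsMaximalTwoSided Q →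
      Module.length R ((Fin (lengthGcd R) → M) ⧸ Q • (⊤ : Submodule R (Fin (lengthGcd R) → M))) =
        n' * Module.length R (R ⧸ Q) := fun Q hQ => by
    obtain ⟨a, ha⟩ := ENat.ne_top_iff_exists.1 (hR.length_ne_top hQ)
    obtain ⟨b, hb⟩ := ENat.ne_top_iff_exists.1 (hR.length_quotient_ne_top (M := M) hQ)
    have h3 := h2 Q hQ
    rw [length_quotient_pi]
    rw [← ha, ← hb] at h3 ⊢
    have h5 : t * b = n * a := by exact_mod_cast h3
    have h6 : lengthGcd R * b = n' * a := by
      refine Nat.eq_of_mul_eq_mul_left ht0.bot_lt ?_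
      rw [mul_left_comm, h5, ← mul_assoc, ← mul_assoc, ← hn', mul_comm n]
    exact_mod_cast h6
  exact ⟨n', isLocallyFreeOfRank_of_forall_length_eq hR hσ (IsEquivariant.pi fun _ => hρ) hQ₀ (h4 Q₀ hQ₀)
    fun Q hQ => (h4 Q hQ).le⟩

end RankOfFinite

/-! ### Projectivity and the trace ideal from local freeness. -/

section ProjectiveGenerator

variable {R M Z : Type*} [Ring R] [AddCommGroup M] [Module R M] [CommRing Z] [Algebra Z R]

variable (R M) in
/-- Multiplication by a central element. -/
def centralMul (z : Z) : M →ₗ[R] M where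
  toFun x := algebraMap Z R z • x
  map_add' := smul_add _
  map_smul' r x := smul_comm_algebraMap z r x

theorem Ideal.eq_top_of_forall_isMaximal {Z : Type*} [CommRing Z] {I : Ideal Z}
    (h : ∀ m : Ideal Z, m.IsMaximal → ∃ s ∉ m, s ∈ I) : I = ⊤ := by
  by_contra hne
  obtain ⟨m, hm, hle⟩ := Ideal.exists_le_maximal I hne
  obtain ⟨s, hs, hs'⟩ := h m hm
  exact hs (hle hs')

/-- The `z` whose multiplication on `M` lifts through a free cover form an ideal contained in no
maximal ideal, so the identity lifts. -/
theorem IsLocallyFreeOfRank.projective {n : ℕ} (h : IsLocallyFreeOfRank R Z M n) :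
    Module.Projective R M := by
  let φ : (M →₀ R) →ₗ[R] M := Finsupp.linearCombination R id
  have hφ : Function.Surjective φ := Finsupp.linearCombination_id_surjective R M
  let I : Ideal Z :=
    { carrier := {z | ∃ g : M →ₗ[R] (M →₀ R), φ ∘ₗ g = centralMul R M z}
      add_mem' := by
        rintro a b ⟨f, hf⟩ ⟨g, hg⟩
        refine ⟨f + g, ?_⟩
        rw [LinearMap.comp_add, hf, hg]
        ext x
        simp [centralMul, add_smul]
      zero_mem' := ⟨0, by ext x; simp [centralMul]⟩
      smul_mem' := by
        rintro c a ⟨f, hf⟩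
        refine ⟨f ∘ₗ centralMul R M c, ?_⟩
        rw [← LinearMap.comp_assoc, hf]
        ext x
        simp only [centralMul, LinearMap.comp_apply, LinearMap.coe_mk, AddHom.coe_mk, smul_eq_mul,
          map_mul, mul_smul]
        rw [smul_comm_algebraMap] }
  have hI : I = ⊤ := Ideal.eq_top_of_forall_isMaximal fun m hm => by
    obtain ⟨s, hs, π, τ, hπ, -⟩ := h m hm
    obtain ⟨π', hπ'⟩ := Module.projective_lifting_property φ π hφ
    refine ⟨s, hs, π' ∘ₗ τ, ?_⟩
    rw [← LinearMap.comp_assoc, hπ']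
    ext x
    exact hπ x
  obtain ⟨g, hg⟩ : (1 : Z) ∈ I := hI ▸ Submodule.mem_top
  refine Module.Projective.of_lifting_property'' fun f hf => ?_
  obtain ⟨p, hp⟩ := Module.projective_lifting_property f φ hf
  refine ⟨p ∘ₗ g, ?_⟩
  rw [← LinearMap.comp_assoc, hp, hg]
  ext x
  simp [centralMul]

theorem projective_of_pi {l : ℕ} (hl : l ≠ 0) (h : Module.Projective R (Fin l → M)) :
    Module.Projective R M := by
  let i : Fin l := ⟨0, hl.bot_lt⟩
  exact Module.Projective.of_split (LinearMap.single R (fun _ => M) i) (LinearMap.proj i)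
    (LinearMap.proj_comp_single_same R (fun _ => M) i)

theorem IsLocallyFreeOfRank.subsingleton (h : IsLocallyFreeOfRank R Z M 0) : Subsingleton M := by
  have hI : (Module.annihilator R M).comap (algebraMap Z R) = ⊤ :=
    Ideal.eq_top_of_forall_isMaximal fun m hm => by
      obtain ⟨s, hs, π, τ, hπ, -⟩ := h m hm
      refine ⟨s, hs, Module.mem_annihilator.2 fun x => ?_⟩
      rw [← hπ, Subsingleton.elim (τ x) 0, map_zero]
  have h1 : (1 : Z) ∈ (Module.annihilator R M).comap (algebraMap Z R) := hI ▸ Submodule.mem_top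
  rw [Ideal.mem_comap, map_one] at h1
  exact ⟨fun x y => by rw [← one_smul R x, ← one_smul R y, Module.mem_annihilator.1 h1,
    Module.mem_annihilator.1 h1]⟩

variable (R M) in
/-- The trace ideal, generated by the values of linear forms. -/
def traceIdeal : Ideal R := Ideal.span {r | ∃ (f : M →ₗ[R] R) (x : M), f x = r}

theorem isGenerator_of_traceIdeal_eq_top (h : traceIdeal R M = ⊤) : IsGenerator R M := by
  intro X Y _ _ _ _ f g hfg
  ext x
  let J : Ideal R := LinearMap.ker ((f - g) ∘ₗ LinearMap.toSpanSingleton R X x)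
  have hJ : traceIdeal R M ≤ J := Ideal.span_le.2 <| by
    rintro _ ⟨φ, y, rfl⟩
    have h1 := LinearMap.congr_fun (hfg (LinearMap.toSpanSingleton R X x ∘ₗ φ)) y
    have h2 : f (φ y • x) = g (φ y • x) := h1
    change (f - g) (φ y • x) = 0
    rw [LinearMap.sub_apply, h2, sub_self]
  have h1 : (1 : R) ∈ J := hJ (h ▸ Submodule.mem_top)
  have h2 : (f - g) ((1 : R) • x) = 0 := h1
  rwa [one_smul, LinearMap.sub_apply, sub_eq_zero] at h2

theorem traceIdeal_mono {M' : Type*} [AddCommGroup M'] [Module R M'] (f : M →ₗ[R] M')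
    (hf : Function.Surjective f) : traceIdeal R M' ≤ traceIdeal R M := Ideal.span_mono <| by
  rintro _ ⟨φ, y, rfl⟩
  obtain ⟨x, rfl⟩ := hf y
  exact ⟨φ ∘ₗ f, x, rfl⟩

theorem traceIdeal_pi_le (ι : Type*) [Finite ι] : traceIdeal R (ι → M) ≤ traceIdeal R M := by
  classical
  have := Fintype.ofFinite ι
  refine Ideal.span_le.2 ?_
  rintro _ ⟨f, x, rfl⟩
  rw [← Finset.univ_sum_single x, map_sum]
  refine Submodule.sum_mem _ fun i _ => ?_
  exact Ideal.subset_span ⟨f ∘ₗ LinearMap.single R (fun _ => M) i, x i, rfl⟩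

theorem IsLocallyFreeOfRank.traceIdeal_eq_top {n : ℕ} (h : IsLocallyFreeOfRank R Z M n)
    (hn : n ≠ 0) : traceIdeal R M = ⊤ := by
  have hI : (traceIdeal R M).comap (algebraMap Z R) = ⊤ :=
    Ideal.eq_top_of_forall_isMaximal fun m hm => by
      obtain ⟨s, hs, π, τ, -, hτ⟩ := h m hm
      let i : Fin n := ⟨0, hn.bot_lt⟩
      refine ⟨s, hs, Ideal.subset_span ⟨LinearMap.proj i ∘ₗ τ, π (Pi.single i 1), ?_⟩⟩
      rw [LinearMap.comp_apply, hτ, LinearMap.proj_apply, Pi.smul_apply, Pi.single_eq_same,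
        smul_eq_mul, mul_one]
  rw [Ideal.eq_top_iff_one, ← map_one (algebraMap Z R), ← Ideal.mem_comap, hI]
  exact Submodule.mem_top

end ProjectiveGenerator

/-! ### Subobjects, quotients and transport of the action. -/

section Actions

variable {k H R M : Type*} [Field k] [Ring H] [HopfAlgebra k H] [Ring R] [AddCommGroup M]
  [Module R M] {σ : H →+* AddMonoid.End R}

/-- The action on a stable submodule. -/
def submoduleAction (ρ : H →+* AddMonoid.End M) (N : Submodule R M)
    (hN : ∀ h, ∀ x ∈ N, ρ h x ∈ N) : H →+* AddMonoid.End N where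
  toFun h := ((ρ h).comp N.subtype.toAddMonoidHom).codRestrict N.toAddSubgroup fun x => hN h x x.2
  map_one' := AddMonoidHom.ext fun x => Subtype.ext (DFunLike.congr_fun (map_one ρ) x.1)
  map_mul' g h := AddMonoidHom.ext fun x => Subtype.ext (DFunLike.congr_fun (map_mul ρ g h) x.1)
  map_zero' := AddMonoidHom.ext fun x => Subtype.ext (DFunLike.congr_fun (map_zero ρ) x.1)
  map_add' g h := AddMonoidHom.ext fun x => Subtype.ext (DFunLike.congr_fun (map_add ρ g h) x.1)

theorem IsEquivariant.submodule {ρ : H →+* AddMonoid.End M} (hρ : IsEquivariant k σ ρ)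
    (N : Submodule R M) (hN : ∀ h, ∀ x ∈ N, ρ h x ∈ N) :
    IsEquivariant k σ (submoduleAction ρ N hN) := fun d t ht i j r x => Subtype.ext <| by
  rw [AddSubmonoidClass.coe_finsetSum]
  exact hρ ht i j r x

/-- The action on the quotient by a stable submodule. -/
def quotientAction (ρ : H →+* AddMonoid.End M) (N : Submodule R M)
    (hN : ∀ h, ∀ x ∈ N, ρ h x ∈ N) : H →+* AddMonoid.End (M ⧸ N) where
  toFun h := QuotientAddGroup.map N.toAddSubgroup N.toAddSubgroup (ρ h) (hN h)
  map_one' := AddMonoidHom.ext fun x => by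
    obtain ⟨x, rfl⟩ := Submodule.Quotient.mk_surjective _ x
    exact congrArg Submodule.Quotient.mk (DFunLike.congr_fun (map_one ρ) x)
  map_mul' g h := AddMonoidHom.ext fun x => by
    obtain ⟨x, rfl⟩ := Submodule.Quotient.mk_surjective _ x
    exact congrArg Submodule.Quotient.mk (DFunLike.congr_fun (map_mul ρ g h) x)
  map_zero' := AddMonoidHom.ext fun x => by
    obtain ⟨x, rfl⟩ := Submodule.Quotient.mk_surjective _ x
    exact congrArg Submodule.Quotient.mk (DFunLike.congr_fun (map_zero ρ) x)
  map_add' g h := AddMonoidHom.ext fun x => by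
    obtain ⟨x, rfl⟩ := Submodule.Quotient.mk_surjective _ x
    exact congrArg Submodule.Quotient.mk (DFunLike.congr_fun (map_add ρ g h) x)

theorem IsEquivariant.quotient {ρ : H →+* AddMonoid.End M} (hρ : IsEquivariant k σ ρ)
    (N : Submodule R M) (hN : ∀ h, ∀ x ∈ N, ρ h x ∈ N) :
    IsEquivariant k σ (quotientAction ρ N hN) := fun d t ht i j r x => by
  obtain ⟨x, rfl⟩ := Submodule.Quotient.mk_surjective _ x
  refine (congrArg (Submodule.mkQ N) (hρ ht i j r x)).trans ?_
  rw [map_sum]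
  rfl

/-- Transport of an action along an isomorphism. -/
def congrAction {M' : Type*} [AddCommGroup M'] [Module R M'] (ρ : H →+* AddMonoid.End M)
    (e : M ≃ₗ[R] M') : H →+* AddMonoid.End M' where
  toFun h := (e.toLinearMap.toAddMonoidHom.comp (ρ h)).comp e.symm.toLinearMap.toAddMonoidHom
  map_one' := AddMonoidHom.ext fun x => by
    refine (congrArg e (DFunLike.congr_fun (map_one ρ) (e.symm x))).trans (e.apply_symm_apply x)
  map_mul' g h := AddMonoidHom.ext fun x => by
    refine (congrArg e (DFunLike.congr_fun (map_mul ρ g h) (e.symm x))).trans ?_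
    exact congrArg (fun y => e (ρ g y)) (e.symm_apply_apply _).symm
  map_zero' := AddMonoidHom.ext fun x => by
    exact (congrArg e (DFunLike.congr_fun (map_zero ρ) (e.symm x))).trans e.map_zero
  map_add' g h := AddMonoidHom.ext fun x => by
    exact (congrArg e (DFunLike.congr_fun (map_add ρ g h) (e.symm x))).trans (e.map_add _ _)

theorem IsEquivariant.congr {M' : Type*} [AddCommGroup M'] [Module R M']
    {ρ : H →+* AddMonoid.End M} (hρ : IsEquivariant k σ ρ) (e : M ≃ₗ[R] M') :
    IsEquivariant k σ (congrAction ρ e) := fun d t ht i j r x => by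
  have h1 : congrAction ρ e (t i j) (r • x) = e (ρ (t i j) (r • e.symm x)) := by
    rw [← map_smul]; rfl
  rw [h1, hρ ht, map_sum]
  exact Finset.sum_congr rfl fun l _ => e.map_smul _ _

variable (k σ) in
/-- `M` has an action compatible with `σ`. -/
def IsHopfObject (M : Type*) [AddCommGroup M] [Module R M] : Prop :=
  ∃ ρ : H →+* AddMonoid.End M, IsEquivariant k σ ρ

theorem IsHopfObject.pi {ι : Type*} {M : ι → Type*} [∀ i, AddCommGroup (M i)]
    [∀ i, Module R (M i)] (hM : ∀ i, IsHopfObject k σ (M i)) : IsHopfObject k σ (∀ i, M i) := by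
  choose ρ hρ using hM
  exact ⟨_, IsEquivariant.pi hρ⟩

variable {Z : Type*} [CommRing Z] [Algebra Z R]

theorem projective_of_isHopfObject [Nontrivial R] (hR : HasLocalIdeals R Z)
    (hZ : Function.Injective (algebraMap Z R)) (hσ : IsSimpleAction k σ) [Module.Finite R M]
    (hM : IsHopfObject k σ M) : Module.Projective R M := by
  obtain ⟨ρ, hρ⟩ := hM
  obtain ⟨n, hn⟩ := exists_isLocallyFreeOfRank_pi hR hZ hσ hρ
  exact projective_of_pi (lengthGcd_ne_zero hR hZ) hn.projective

theorem exists_isLocallyFreeOfRank_pi_pos [Nontrivial R] (hR : HasLocalIdeals R Z)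
    (hZ : Function.Injective (algebraMap Z R)) (hσ : IsSimpleAction k σ) [Module.Finite R M]
    [Nontrivial M] (hM : IsHopfObject k σ M) :
    ∃ n ≠ 0, IsLocallyFreeOfRank R Z (Fin (lengthGcd R) → M) n := by
  obtain ⟨ρ, hρ⟩ := hM
  obtain ⟨n, hn⟩ := exists_isLocallyFreeOfRank_pi hR hZ hσ hρ
  refine ⟨n, ?_, hn⟩
  rintro rfl
  have := hn.subsingleton
  have : NeZero (lengthGcd R) := ⟨lengthGcd_ne_zero hR hZ⟩
  exact not_subsingleton (Fin (lengthGcd R) → M) hn.subsingleton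

theorem traceIdeal_eq_top_of_isHopfObject [Nontrivial R] (hR : HasLocalIdeals R Z)
    (hZ : Function.Injective (algebraMap Z R)) (hσ : IsSimpleAction k σ) [Module.Finite R M]
    [Nontrivial M] (hM : IsHopfObject k σ M) : traceIdeal R M = ⊤ := by
  obtain ⟨n, hn0, hn⟩ := exists_isLocallyFreeOfRank_pi_pos hR hZ hσ hM
  exact top_le_iff.1 ((hn.traceIdeal_eq_top hn0).ge.trans (traceIdeal_pi_le _))

end Actions

/-! ### Decomposition of locally finite objects. -/

section Filtration

variable {R M : Type*} [Ring R] [AddCommGroup M] [Module R M]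

theorem iSupIndep_of_disjoint_iSup_lt {ι : Type*} [LinearOrder ι] {C : ι → Submodule R M}
    (h : ∀ i, Disjoint (C i) (⨆ j < i, C j)) : iSupIndep C := by
  rw [iSupIndep_iff_supIndep]
  intro s
  induction s using Finset.induction_on_max with
  | empty => exact Finset.supIndep_empty C
  | insert a s hs ih =>
    exact ih.insert ((h a).mono_right (Finset.sup_le fun j hj => le_iSup₂_of_le j (hs j hj) le_rfl))

theorem isInternal_of_isCompl_iSup_lt {ι : Type*} [LinearOrder ι] [WellFoundedLT ι] [DecidableEq ι]
    {N C : ι → Submodule R M} (hN : ⨆ i, N i = ⊤) (hCN : ∀ i, C i ≤ N i)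
    (hdisj : ∀ i, Disjoint (C i) (⨆ j < i, N j)) (hsup : ∀ i, N i ≤ C i ⊔ ⨆ j < i, N j) :
    DirectSum.IsInternal C := by
  refine DirectSum.isInternal_submodule_of_iSupIndep_of_iSup_eq_top
    (iSupIndep_of_disjoint_iSup_lt fun i => (hdisj i).mono_right (iSup₂_mono fun j _ => hCN j)) ?_
  rw [eq_top_iff, ← hN]
  refine iSup_le fun i => ?_
  induction i using WellFoundedLT.induction with
  | ind i ih => exact (hsup i).trans (sup_le (le_iSup C i) (iSup₂_le ih))

variable {k H : Type*} [Field k] [Ring H] [HopfAlgebra k H] {σ : H →+* AddMonoid.End R}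

/-- Along a well-order of `M`, each `N i` modulo the sum `U i` of its predecessors is a finite
object, hence projective, so a complement `C i` exists. Its action is transported from the factor;
`C i` itself need not be stable in `M`. -/
theorem exists_isInternal_isHopfObject
    {Z : Type*} [CommRing Z] [Algebra Z R] [Nontrivial R] (hR : HasLocalIdeals R Z)
    (hZ : Function.Injective (algebraMap Z R)) (hσ : IsSimpleAction k σ) {ρ : H →+* AddMonoid.End M} (hρ : IsEquivariant k σ ρ)
    (hfin : ∀ x : M, ∃ N : Submodule R M, N.FG ∧ (∀ h, ∀ x ∈ N, ρ h x ∈ N) ∧ x ∈ N) :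
    ∃ (ι : Set M) (C : ι → Submodule R M), (∃ _ : DecidableEq ι, DirectSum.IsInternal C) ∧
      ∀ i, Module.Finite R (C i) ∧ Nontrivial (C i) ∧ IsHopfObject k σ (C i) := by
  classical
  choose N hfg hst hmem using hfin
  obtain ⟨_, _⟩ := exists_wellFoundedLT M
  let U : M → Submodule R M := fun i => ⨆ j < i, N j
  have hU : ∀ i h, ∀ x ∈ U i, ρ h x ∈ U i := fun i h x hx => by
    have h1 : (U i).toAddSubmonoid = ⨆ j : {j // j < i}, (N j).toAddSubmonoid := by
      rw [← Submodule.iSup_toAddSubmonoid, iSup_subtype]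
    have h2 : (U i).toAddSubmonoid ≤ (U i).toAddSubmonoid.comap (ρ h) := by
      conv_lhs => rw [h1]
      exact iSup_le fun j y hy => (le_iSup₂_of_le j.1 j.2 le_rfl : N j ≤ U i) (hst _ h y hy)
    exact h2 hx
  have hq : ∀ i, IsHopfObject k σ (N i ⧸ (U i).comap (N i).subtype) := fun i =>
    ⟨_, (hρ.submodule (N i) (hst i)).quotient _ fun h x hx => hU i h x hx⟩
  have hfinN : ∀ i, Module.Finite R (N i) := fun i => Module.Finite.iff_fg.2 (hfg i)
  have hex : ∀ i, ∃ C : Submodule R M, C ≤ N i ∧ Disjoint C (U i) ∧ N i ≤ C ⊔ U i ∧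
      Nonempty ((N i ⧸ (U i).comap (N i).subtype) ≃ₗ[R] C) := fun i => by
    have := projective_of_isHopfObject hR hZ hσ (hq i)
    obtain ⟨g, hg⟩ := Module.projective_lifting_property (Submodule.mkQ ((U i).comap (N i).subtype))
      LinearMap.id (Submodule.mkQ_surjective _)
    have hg' : ∀ y, Submodule.mkQ ((U i).comap (N i).subtype) (g y) = y := LinearMap.congr_fun hg
    have hinj : Function.Injective ((N i).subtype ∘ₗ g) :=
      (N i).injective_subtype.comp (Function.LeftInverse.injective hg')
    refine ⟨LinearMap.range ((N i).subtype ∘ₗ g), ?_, ?_, ?_, ⟨LinearEquiv.ofInjective _ hinj⟩⟩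
    · rintro _ ⟨y, rfl⟩
      exact (g y).2
    · rw [Submodule.disjoint_def]
      rintro _ ⟨y, rfl⟩ hy
      have h1 : Submodule.mkQ ((U i).comap (N i).subtype) (g y) = 0 :=
        (Submodule.Quotient.mk_eq_zero _).2 hy
      rw [hg'] at h1
      rw [h1, map_zero]
    · intro x hx
      have h1 : (⟨x, hx⟩ : N i) - g (Submodule.mkQ _ ⟨x, hx⟩) ∈ (U i).comap (N i).subtype := by
        rw [← Submodule.Quotient.mk_eq_zero, ← Submodule.mkQ_apply, map_sub, hg', sub_self]
      have h2 : x = ((N i).subtype ∘ₗ g) (Submodule.mkQ _ ⟨x, hx⟩) +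
        ((⟨x, hx⟩ : N i) - g (Submodule.mkQ _ ⟨x, hx⟩) : N i) := by simp
      rw [h2]
      exact Submodule.add_mem_sup ⟨_, rfl⟩ h1
  choose C hCN hdisj hsup e using hex
  have hint : DirectSum.IsInternal C := isInternal_of_isCompl_iSup_lt
    (eq_top_iff.2 fun x _ => Submodule.mem_iSup_of_mem x (hmem x)) hCN hdisj hsup
  -- Zero summands are discarded so that the ranks of the remaining ones are positive.
  refine ⟨{i | C i ≠ ⊥}, fun i => C i, ⟨inferInstance, DirectSum.isInternal_ne_bot_iff.2 hint⟩,
    fun i => ⟨?_, Submodule.nontrivial_iff_ne_bot.2 i.2, ?_⟩⟩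
  · exact Module.Finite.equiv (e i).some
  · obtain ⟨ρ', hρ'⟩ := hq i
    exact ⟨_, hρ'.congr (e i).some⟩

end Filtration

/-! ### Localization at a prime of `Z`, products and direct sums. -/

section CentralLocalizationMaps

variable {R Z : Type*} [Ring R] [CommRing Z] [Algebra Z R] (p : Ideal Z) [p.IsPrime]
  {X Y : Type*} [AddCommGroup X] [Module R X] [AddCommGroup Y] [Module R Y]

variable (R) in
/-- The element of `centralCompl R p` given by an element of `Z` outside `p`. -/
def centralCompl.mk {z : Z} (hz : z ∉ p) : centralCompl R p := ⟨algebraMap Z R z, z, hz, rfl⟩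

theorem centralCompl.exists_eq (s : centralCompl R p) :
    ∃ (z : Z) (hz : z ∉ p), s = centralCompl.mk R p hz := by
  obtain ⟨_, z, hz, rfl⟩ := s
  exact ⟨z, hz, rfl⟩

variable (R X) in
/-- The canonical map to the localization. -/
def LocAt.numerator : X →ₗ[R] LocAt R p X where
  toFun x := x /ₒ 1
  map_add' _ _ := OreLocalization.add_oreDiv.symm
  map_smul' r x := (OreLocalization.smul_oreDiv_one r x).symm

/-- `f` is a localization of the module `X` at `Z \ p`. -/
structure IsCentralLocalization [Module (LocAt R p R) Y] (f : X →ₗ[R] Y) : Prop where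
  exists_eq : ∀ y, ∃ z ∉ p, ∃ x, algebraMap Z R z • y = f x
  exists_smul_eq_zero : ∀ x, f x = 0 → ∃ z ∉ p, algebraMap Z R z • x = 0

variable {p} in
theorem IsCentralLocalization.comp_linearEquiv [Module (LocAt R p R) Y] {X' : Type*} [AddCommGroup X'] [Module R X']
    {f : X →ₗ[R] Y}
    (hf : IsCentralLocalization p f) (e : X' ≃ₗ[R] X) :
    IsCentralLocalization p (f ∘ₗ e.toLinearMap) where
  exists_eq y := by
    obtain ⟨z, hz, x, hx⟩ := hf.exists_eq y
    exact ⟨z, hz, e.symm x, by simp [hx]⟩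
  exists_smul_eq_zero x hx := by
    obtain ⟨z, hz, h⟩ := hf.exists_smul_eq_zero (e x) hx
    exact ⟨z, hz, e.injective (by rw [map_smul, h, map_zero])⟩

theorem oreDiv_eq_mul (r : R) (s : centralCompl R p) :
    (r /ₒ s : LocAt R p R) = (1 /ₒ s) * (r /ₒ 1) := by
  rw [OreLocalization.one_div_mul, one_mul]

theorem oreDiv_smul_oreDiv_eq (r : R) (x : X) (s t : centralCompl R p) :
    (r /ₒ s : LocAt R p R) • (x /ₒ t : LocAt R p X) = (r • x) /ₒ (t * s) :=
  OreLocalization.oreDiv_smul_char r x s t r t (mul_comm_of_mem_centralCompl R p t r)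

theorem oreDiv_smul_numerator [Module (LocAt R p R) Y] [IsScalarTower R (LocAt R p R) Y]
    (r : R) (y : Y) : (r /ₒ 1 : LocAt R p R) • y = r • y := by
  rw [← smul_one_smul (LocAt R p R) r y]
  congr 1
  rw [OreLocalization.one_def, OreLocalization.smul_oreDiv_one, smul_eq_mul, mul_one]

theorem centralCompl.mul_comm (s t : centralCompl R p) : s * t = t * s :=
  Subtype.ext (mul_comm_of_mem_centralCompl R p s t)

theorem exists_common_oreDiv (a b : LocAt R p X) :
    ∃ (x y : X) (s : centralCompl R p), a = x /ₒ s ∧ b = y /ₒ s := by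
  induction a using OreLocalization.ind with
  | _ x s =>
  induction b using OreLocalization.ind with
  | _ y t =>
  exact ⟨t • x, s • y, t * s, OreLocalization.expand' x s t, by
    rw [OreLocalization.expand' y t s, centralCompl.mul_comm]⟩

variable [Module (LocAt R p R) Y] [IsScalarTower R (LocAt R p R) Y]

/-- The map from the localization induced by a linear map. -/
def LocAt.lift (f : X →ₗ[R] Y) : LocAt R p X → Y :=
  OreLocalization.liftExpand (fun x s => (1 /ₒ s : LocAt R p R) • f x) fun x t s ht => by
    rw [map_smul, ← oreDiv_smul_numerator p t (f x), ← mul_smul, ← oreDiv_eq_mul]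
    congr 1
    rw [OreLocalization.expand (1 : R) s t ht, smul_eq_mul, mul_one]

theorem LocAt.lift_oreDiv (f : X →ₗ[R] Y) (x : X) (s : centralCompl R p) :
    LocAt.lift p f (x /ₒ s) = (1 /ₒ s : LocAt R p R) • f x := rfl

theorem LocAt.lift_smul_oreDiv (f : X →ₗ[R] Y) (r : R) (x : X) (s : centralCompl R p) :
    LocAt.lift p f ((r • x) /ₒ s) = (r /ₒ s : LocAt R p R) • f x := by
  rw [LocAt.lift_oreDiv, map_smul, oreDiv_eq_mul p r s, mul_smul, oreDiv_smul_numerator]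

/-- The linear map from the localization induced by a linear map. -/
def LocAt.liftLinear (f : X →ₗ[R] Y) : LocAt R p X →ₗ[LocAt R p R] Y where
  toFun := LocAt.lift p f
  map_add' a b := by
    obtain ⟨x, y, s, rfl, rfl⟩ := exists_common_oreDiv p a b
    rw [OreLocalization.add_oreDiv, LocAt.lift_oreDiv, LocAt.lift_oreDiv, LocAt.lift_oreDiv,
      map_add, smul_add]
  map_smul' c a := by
    induction c using OreLocalization.ind with
    | _ r s =>
    induction a using OreLocalization.ind with
    | _ x t =>
    rw [oreDiv_smul_oreDiv_eq, LocAt.lift_smul_oreDiv, LocAt.lift_oreDiv, RingHom.id_apply,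
      ← mul_smul]
    have h : (r /ₒ (t * s) : LocAt R p R) = (r /ₒ s) * (1 /ₒ t) := by
      have h1 := oreDiv_smul_oreDiv_eq p r (1 : R) s t
      rw [smul_eq_mul r 1, mul_one] at h1
      exact h1.symm
    rw [h]

theorem oreDiv_smul_cancel (s : centralCompl R p) (y : Y) :
    (s : R) • (1 /ₒ s : LocAt R p R) • y = y := by
  rw [← oreDiv_smul_numerator p (s : R), ← mul_smul, OreLocalization.mul_cancel,
    ← OreLocalization.one_def, one_smul]

theorem oreDiv_smul_cancel' (s : centralCompl R p) (y : Y) :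
    (1 /ₒ s : LocAt R p R) • (s : R) • y = y := by
  rw [← oreDiv_smul_numerator p (s : R), ← mul_smul, ← oreDiv_eq_mul, OreLocalization.div_eq_one,
    one_smul]

variable {p}

theorem IsCentralLocalization.nonempty_linearEquiv {f : X →ₗ[R] Y}
    (hf : IsCentralLocalization p f) : Nonempty (LocAt R p X ≃ₗ[LocAt R p R] Y) := by
  refine ⟨LinearEquiv.ofBijective (LocAt.liftLinear p f)
    ⟨(injective_iff_map_eq_zero _).2 fun a ha => ?_, fun y => ?_⟩⟩
  · induction a using OreLocalization.ind with
    | _ x s =>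
    have h1 : (1 /ₒ s : LocAt R p R) • f x = 0 := ha
    have h2 : f x = 0 := by rw [← oreDiv_smul_cancel p s (f x), h1, smul_zero]
    obtain ⟨z, hz, hzx⟩ := hf.exists_smul_eq_zero x h2
    rw [OreLocalization.expand' x s (centralCompl.mk R p hz)]
    change (algebraMap Z R z • x) /ₒ _ = _
    rw [hzx, OreLocalization.zero_oreDiv]
  · obtain ⟨z, hz, x, hx⟩ := hf.exists_eq y
    refine ⟨x /ₒ centralCompl.mk R p hz, ?_⟩
    change (1 /ₒ centralCompl.mk R p hz : LocAt R p R) • f x = y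
    rw [← hx]
    exact oreDiv_smul_cancel' p (centralCompl.mk R p hz) y

theorem isCentralLocalization_numerator : IsCentralLocalization p (LocAt.numerator R p X) where
  exists_eq y := by
    induction y using OreLocalization.ind with
    | _ x s =>
    obtain ⟨z, hz, rfl⟩ := centralCompl.exists_eq p s
    refine ⟨z, hz, x, ?_⟩
    rw [← oreDiv_smul_numerator p (algebraMap Z R z)]
    exact OreLocalization.smul_cancel
  exists_smul_eq_zero x hx := by
    have hx' : (x /ₒ 1 : LocAt R p X) = 0 /ₒ 1 := hx.trans (OreLocalization.zero_oreDiv 1).symm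
    obtain ⟨u, v, h1, h2⟩ := OreLocalization.oreDiv_eq_iff.1 hx'
    rw [smul_zero] at h1
    rw [OneMemClass.coe_one, mul_one, mul_one] at h2
    obtain ⟨z, hz, rfl⟩ := centralCompl.exists_eq p u
    exact ⟨z, hz, h1.symm ▸ congrArg (· • x) h2⟩

theorem IsCentralLocalization.pi {ι : Type*} [Finite ι] {X Y : ι → Type*}
    [∀ i, AddCommGroup (X i)] [∀ i, Module R (X i)] [∀ i, AddCommGroup (Y i)]
    [∀ i, Module R (Y i)] [∀ i, Module (LocAt R p R) (Y i)] {f : ∀ i, X i →ₗ[R] Y i}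
    (hf : ∀ i, IsCentralLocalization p (f i)) :
    IsCentralLocalization p (LinearMap.pi fun i => f i ∘ₗ LinearMap.proj i) where
  exists_eq y := by
    classical
    have := Fintype.ofFinite ι
    choose z hz x hx using fun i => (hf i).exists_eq (y i)
    refine ⟨∏ i, z i, fun h => ?_, fun i => algebraMap Z R (∏ j ∈ Finset.univ.erase i, z j) • x i,
      funext fun i => ?_⟩
    · obtain ⟨i, -, hi⟩ := (Ideal.IsPrime.prod_mem_iff).1 h
      exact hz i hi
    · rw [Pi.smul_apply, LinearMap.pi_apply, LinearMap.comp_apply, LinearMap.proj_apply, map_smul,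
        ← hx, ← mul_smul, ← map_mul, Finset.prod_erase_mul _ _ (Finset.mem_univ i)]
  exists_smul_eq_zero x hx := by
    classical
    have := Fintype.ofFinite ι
    choose z hz hzx using fun i => (hf i).exists_smul_eq_zero (x i) (congrFun hx i)
    refine ⟨∏ i, z i, fun h => ?_, funext fun i => ?_⟩
    · obtain ⟨i, -, hi⟩ := (Ideal.IsPrime.prod_mem_iff).1 h
      exact hz i hi
    · rw [Pi.smul_apply, ← Finset.prod_erase_mul _ _ (Finset.mem_univ i), map_mul, mul_smul, hzx,
        smul_zero, Pi.zero_apply]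

theorem IsCentralLocalization.dfinsupp {ι : Type*} {X Y : ι → Type*}
    [∀ i, AddCommGroup (X i)] [∀ i, Module R (X i)] [∀ i, AddCommGroup (Y i)]
    [∀ i, Module R (Y i)] [∀ i, Module (LocAt R p R) (Y i)] {f : ∀ i, X i →ₗ[R] Y i}
    (hf : ∀ i, IsCentralLocalization p (f i)) :
    IsCentralLocalization p (DFinsupp.mapRange.linearMap f) where
  exists_eq y := by
    classical
    induction y using DFinsupp.induction with
    | h0 => exact ⟨1, fun h => Ideal.IsPrime.ne_top' ((Ideal.eq_top_iff_one p).2 h), 0, by simp⟩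
    | ha i b g _ _ ih =>
      obtain ⟨z, hz, x, hx⟩ := ih
      obtain ⟨u, hu, a, ha⟩ := (hf i).exists_eq b
      refine ⟨u * z, fun h => ((Ideal.IsPrime.mem_or_mem ‹_› h).elim hu hz),
        algebraMap Z R z • DFinsupp.single i a + algebraMap Z R u • x, ?_⟩
      rw [map_add, map_smul, map_smul, ← hx, smul_add, DFinsupp.mapRange.linearMap_apply,
        DFinsupp.mapRange_single, ← ha, map_mul, mul_smul, mul_smul, smul_comm_algebraMap,
        DFinsupp.single_smul]
  exists_smul_eq_zero x hx := by
    classical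
    choose z hz hzx using fun i => (hf i).exists_smul_eq_zero (x i) (DFunLike.congr_fun hx i)
    refine ⟨∏ i ∈ x.support, z i, fun h => ?_, DFinsupp.ext fun i => ?_⟩
    · obtain ⟨i, -, hi⟩ := (Ideal.IsPrime.prod_mem_iff).1 h
      exact hz i hi
    · rw [DFinsupp.smul_apply, DFinsupp.zero_apply]
      by_cases hi : i ∈ x.support
      · rw [← Finset.prod_erase_mul _ _ hi, map_mul, mul_smul, hzx, smul_zero]
      · rw [DFinsupp.notMem_support_iff.1 hi, smul_zero]

/-- The denominator at a maximal ideal containing `p` lies outside `p` too, so `π` and `τ` become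
isomorphisms over `R_p`. -/
theorem IsLocallyFreeOfRank.nonempty_linearEquiv {n : ℕ} (h : IsLocallyFreeOfRank R Z X n) :
    Nonempty (LocAt R p X ≃ₗ[LocAt R p R] (Fin n → LocAt R p R)) := by
  obtain ⟨m, hm, hle⟩ := Ideal.exists_le_maximal p Ideal.IsPrime.ne_top'
  obtain ⟨s, hs, π, τ, hπ, hτ⟩ := h m hm
  have hsp : s ∉ p := fun h => hs (hle h)
  let ν : (Fin n → R) →ₗ[R] (Fin n → LocAt R p R) :=
    LinearMap.pi fun i => LocAt.numerator R p R ∘ₗ LinearMap.proj i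
  have hν : IsCentralLocalization p ν := .pi fun _ => isCentralLocalization_numerator
  refine IsCentralLocalization.nonempty_linearEquiv (f := ν ∘ₗ τ) ⟨fun y => ?_, fun x hx => ?_⟩
  · obtain ⟨z, hz, c, hc⟩ := hν.exists_eq y
    refine ⟨s * z, fun h => (Ideal.IsPrime.mem_or_mem ‹_› h).elim hsp hz, π c, ?_⟩
    rw [LinearMap.comp_apply, hτ, map_smul, ← hc, map_mul, mul_smul]
  · obtain ⟨z, hz, hzx⟩ := hν.exists_smul_eq_zero (τ x) hx
    refine ⟨z * s, fun h => (Ideal.IsPrime.mem_or_mem ‹_› h).elim hz hsp, ?_⟩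
    rw [map_mul, mul_smul, ← hπ, ← map_smul, hzx, map_zero]

variable (p) in
theorem nonempty_locAt_pi_linearEquiv (ι : Type*) [Finite ι] (X : ι → Type*)
    [∀ i, AddCommGroup (X i)] [∀ i, Module R (X i)] :
    Nonempty (LocAt R p (∀ i, X i) ≃ₗ[LocAt R p R] (∀ i, LocAt R p (X i))) :=
  (IsCentralLocalization.pi (p := p) fun i =>
    isCentralLocalization_numerator (X := X i)).nonempty_linearEquiv

variable (p) in
theorem nonempty_locAt_linearEquiv_dfinsupp {ι : Type*} [DecidableEq ι] {C : ι → Submodule R X}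
    (hC : DirectSum.IsInternal C) :
    Nonempty (LocAt R p X ≃ₗ[LocAt R p R] (Π₀ i, LocAt R p (C i))) :=
  ((IsCentralLocalization.dfinsupp (p := p) fun i =>
    isCentralLocalization_numerator (X := C i)).comp_linearEquiv
      (LinearEquiv.ofBijective (DirectSum.coeLinearMap C) hC).symm).nonempty_linearEquiv

end CentralLocalizationMaps

/-! ### Eilenberg's swindle and infinite direct sums. -/

section Swindle

universe u

variable {S : Type*} [Ring S]

theorem nonempty_prod_linearEquiv_of_surjective {P E : Type*} [AddCommGroup P] [Module S P]
    [AddCommGroup E] [Module S E] [Module.Projective S E] (f : P →ₗ[S] E)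
    (hf : Function.Surjective f) : Nonempty (P ≃ₗ[S] E × LinearMap.ker f) := by
  obtain ⟨g, hg⟩ := Module.projective_lifting_property f LinearMap.id hf
  have hg' : ∀ y, f (g y) = y := LinearMap.congr_fun hg
  refine ⟨(LinearEquiv.ofBijective (g.coprod (LinearMap.ker f).subtype) ⟨?_, fun x => ?_⟩).symm⟩
  · refine (injective_iff_map_eq_zero _).2 ?_
    rintro ⟨e, y⟩ h
    have h1 : g e + y = 0 := h
    have h2 : e = 0 := by
      have h3 : f (g e + y) = 0 := by rw [h1, map_zero]
      rwa [map_add, hg', LinearMap.mem_ker.1 y.2, add_zero] at h3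
    rw [h2, map_zero, zero_add] at h1
    exact Prod.ext h2 (Subtype.ext h1)
  · refine ⟨(f x, ⟨x - g (f x), ?_⟩), ?_⟩
    · rw [LinearMap.mem_ker, map_sub, hg', sub_self]
    · simp

/-- Eilenberg's swindle: a module which has a free module of infinite rank as a direct summand and
a power isomorphic to this free module is itself free. -/
theorem nonempty_linearEquiv_finsupp_of_swindle {I : Type u} [Infinite I] {P Y : Type*}
    [AddCommGroup P] [Module S P] [AddCommGroup Y] [Module S Y] {l : ℕ} (hl : l ≠ 0)
    (e₁ : P ≃ₗ[S] (I →₀ S) × Y) (e₂ : (Fin l → P) ≃ₗ[S] (I →₀ S)) :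
    Nonempty (P ≃ₗ[S] (I →₀ S)) := by
  have : NeZero l := ⟨hl⟩
  obtain ⟨i₁⟩ : Nonempty (I ≃ ℕ × I) := Cardinal.eq.1 <| by
    rw [Cardinal.mk_prod, Cardinal.lift_uzero, Cardinal.mk_nat, Cardinal.lift_aleph0]
    exact (Cardinal.mul_eq_right (Cardinal.aleph0_le_mk I) (Cardinal.aleph0_le_mk I)
      Cardinal.aleph0_ne_zero).symm
  obtain ⟨i₂⟩ : Nonempty (I ⊕ I ≃ I) := Cardinal.eq.1 <| by
    rw [Cardinal.mk_sum, Cardinal.lift_id]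
    exact Cardinal.add_eq_self (Cardinal.aleph0_le_mk I)
  obtain ⟨i₃⟩ : Nonempty (ℕ × Fin l ≃ ℕ) := nonempty_equiv_of_countable
  obtain ⟨i₄⟩ : Nonempty (ℕ ≃ Unit ⊕ ℕ) := nonempty_equiv_of_countable
  have hEE : ((I →₀ S) × (I →₀ S)) ≃ₗ[S] (I →₀ S) :=
    (Finsupp.sumFinsuppLEquivProdFinsupp S).symm.trans (Finsupp.domLCongr i₂)
  -- With `E` the free module on `I`: `E ≅ E^(ℕ) ≅ (P^l)^(ℕ) ≅ P^(ℕ)`, so `E` absorbs a further copy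
  -- of `P`.
  have hEN : (I →₀ S) ≃ₗ[S] (ℕ →₀ P) :=
    (Finsupp.domLCongr i₁).trans <| (Finsupp.curryLinearEquiv S).trans <|
    (Finsupp.mapRange.linearEquiv (e₂.symm.trans
      (Finsupp.linearEquivFunOnFinite S P (Fin l)).symm)).trans <|
    (Finsupp.curryLinearEquiv S).symm.trans (Finsupp.domLCongr i₃)
  have hNP : (ℕ →₀ P) ≃ₗ[S] P × (ℕ →₀ P) :=
    (Finsupp.domLCongr i₄).trans <| (Finsupp.sumFinsuppLEquivProdFinsupp S).trans <|
    (Finsupp.uniqueLinearEquiv S P ()).prodCongr (.refl S _)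
  have hPE : (P × (I →₀ S)) ≃ₗ[S] (I →₀ S) :=
    ((LinearEquiv.refl S P).prodCongr hEN).trans <| hNP.symm.trans hEN.symm
  -- Conversely `P ≅ E × Y ≅ E × E × Y ≅ E × P`, so `P` absorbs `E`.
  have hPE' : P ≃ₗ[S] P × (I →₀ S) :=
    e₁.trans <| (hEE.symm.prodCongr (.refl S Y)).trans <| (LinearEquiv.prodAssoc S _ _ _).trans <|
    ((LinearEquiv.refl S _).prodCongr e₁.symm).trans (LinearEquiv.prodComm S _ _)
  exact ⟨hPE'.trans hPE⟩

theorem nonempty_dfinsupp_linearEquiv_finsupp {I : Type u} [Infinite I] {n : I → ℕ}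
    (hn : ∀ i, n i ≠ 0) : Nonempty ((Π₀ i, Fin (n i) → S) ≃ₗ[S] (I →₀ S)) := by
  obtain ⟨e⟩ : Nonempty ((Σ i, Fin (n i)) ≃ I) := Cardinal.eq.1 <| by
    refine le_antisymm ?_ (Cardinal.mk_le_of_injective (f := fun i => ⟨i, ⟨0, (hn i).bot_lt⟩⟩)
      fun i j h => congrArg Sigma.fst h)
    have h1 : Cardinal.mk (Σ i, Fin (n i)) ≤ Cardinal.mk (I × ℕ) :=
      Cardinal.mk_le_of_injective (f := fun x => (x.1, (x.2 : ℕ))) <| by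
        rintro ⟨i, a⟩ ⟨j, b⟩ h
        obtain rfl : i = j := congrArg Prod.fst h
        have h2 : (a : ℕ) = b := congrArg Prod.snd h
        rw [Fin.ext h2]
    refine h1.trans ?_
    rw [Cardinal.mk_prod, Cardinal.lift_uzero, Cardinal.mk_nat, Cardinal.lift_aleph0]
    exact (Cardinal.mul_eq_left (Cardinal.aleph0_le_mk I) (Cardinal.aleph0_le_mk I)
      Cardinal.aleph0_ne_zero).le
  exact ⟨(DFinsupp.basis fun i => Pi.basisFun S (Fin (n i))).repr.trans (Finsupp.domLCongr e)⟩

/-- Finite products commute with direct sums. -/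
theorem nonempty_dfinsupp_pi_linearEquiv {I J : Type*} [Finite J] (X : I → J → Type*)
    [∀ i j, AddCommGroup (X i j)] [∀ i j, Module S (X i j)] :
    Nonempty ((Π₀ i, ∀ j, X i j) ≃ₗ[S] ∀ j, Π₀ i, X i j) := by
  classical
  have := Fintype.ofFinite J
  refine ⟨LinearEquiv.ofBijective (LinearMap.pi fun j => DFinsupp.mapRange.linearMap
    (β₁ := fun i => ∀ j, X i j) (β₂ := fun i => X i j) fun i => LinearMap.proj j)
    ⟨fun x y h => ?_, fun y => ?_⟩⟩
  · ext i j
    exact DFunLike.congr_fun (congrFun h j) i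
  · refine ⟨DFinsupp.mk (Finset.univ.biUnion fun j => (y j).support) fun i j => y j i, ?_⟩
    funext j
    ext i
    rw [LinearMap.pi_apply, DFinsupp.mapRange.linearMap_apply, DFinsupp.mapRange_apply,
      DFinsupp.mk_apply]
    split_ifs with h
    · rfl
    · have : y j i = 0 := by
        by_contra h0
        exact h (Finset.mem_biUnion.2 ⟨j, Finset.mem_univ j, DFinsupp.mem_support_iff.2 h0⟩)
      rw [this]
      rfl

theorem exists_surjective_dfinsupp_pi {I J : Type*} [Finite J] (X : I → Type*)
    [∀ i, AddCommGroup (X i)] [∀ i, Module S (X i)] {φ : I × J → I} (hφ : Function.Injective φ) :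
    ∃ f : (Π₀ i, X i) →ₗ[S] ∀ j, Π₀ i, X (φ (i, j)), Function.Surjective f := by
  classical
  have := Fintype.ofFinite J
  have hj : ∀ j, Function.Injective fun i => φ (i, j) := fun j a b h =>
    congrArg Prod.fst (hφ h)
  let f : (Π₀ i, X i) →ₗ[S] ∀ j, Π₀ i, X (φ (i, j)) := LinearMap.pi fun j =>
    { toFun := DFinsupp.comapDomain (fun i => φ (i, j)) (hj j)
      map_add' := DFinsupp.comapDomain_add _ _
      map_smul' := DFinsupp.comapDomain_smul _ _ }
  have hf : ∀ i j (a : X (φ (i, j))), f (DFinsupp.single (φ (i, j)) a) =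
      Pi.single j (DFinsupp.single i a) := fun i j a => by
    funext j'
    by_cases h : j' = j
    · subst h
      rw [Pi.single_eq_same]
      exact DFinsupp.comapDomain_single (fun i => φ (i, j')) (hj j') i a
    · rw [Pi.single_eq_of_ne h]
      ext i'
      change DFinsupp.single (φ (i, j)) a (φ (i', j')) = 0
      exact DFinsupp.single_eq_of_ne fun h' => h (congrArg Prod.snd (hφ h'))
  refine ⟨f, LinearMap.range_eq_top.1 (eq_top_iff.2 fun y _ => ?_)⟩
  rw [← Finset.univ_sum_single y]
  refine Submodule.sum_mem _ fun j _ => ?_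
  induction y j using DFinsupp.induction with
  | h0 => rw [Pi.single_zero]; exact Submodule.zero_mem _
  | ha i b g _ _ ih =>
    rw [Pi.single_add]
    exact Submodule.add_mem _ ⟨_, hf i j b⟩ ih

/-- A function from an infinite set to a finite one is constant on the members of some family of
disjoint `l`-element subsets of full cardinality. -/
theorem exists_injective_prod_constant {I : Type u} [Infinite I] {T : Type*} [Finite T] (g : I → T)
    {l : ℕ} (hl : l ≠ 0) : ∃ φ : I × Fin l → I, Function.Injective φ ∧ ∃ c, ∀ x, g (φ x) = c := by
  have hI := Cardinal.aleph0_le_mk I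
  obtain ⟨N, ⟨eN⟩⟩ := Finite.exists_equiv_fin T
  -- The number of fibres is finite, hence below the cofinality of the cardinal of `I`, so one fibre
  -- has full cardinality.
  obtain ⟨c, hc⟩ := Cardinal.infinite_pigeonhole (fun i => ULift.up.{u} (eN (g i))) hI <|
    (Cardinal.lt_aleph0_of_finite _).trans_le
      (Ordinal.aleph0_le_cof_iff.2 (Ordinal.one_lt_cof_iff.2 (Cardinal.isSuccLimit_ord hI)))
  obtain ⟨e⟩ : Nonempty (I × Fin l ≃ ((fun i => ULift.up.{u} (eN (g i))) ⁻¹' {c})) :=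
    Cardinal.eq.1 <| by
      rw [hc, Cardinal.mk_prod, Cardinal.lift_uzero, Cardinal.mk_fin, Cardinal.lift_natCast]
      exact Cardinal.mul_eq_left hI ((Cardinal.natCast_lt_aleph0).le.trans hI)
        (Nat.cast_ne_zero.2 hl)
  refine ⟨fun x => e x, Subtype.val_injective.comp e.injective, eN.symm c.down, fun x => ?_⟩
  have h := (e x).2
  rw [Set.mem_preimage, Set.mem_singleton_iff] at h
  exact (eN.symm_apply_apply _).symm.trans (congrArg (fun y => eN.symm (ULift.down y)) h)

/-- As many disjoint `l`-element blocks as `I` has elements are chosen within one residue class of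
`n` modulo `l`. Their sum is a free quotient of rank `|I|`, hence a summand, while the `l`-th power
of the whole is free of rank `|I|`; the swindle finishes. -/
theorem free_dfinsupp_of_blocks {I : Type u} [Infinite I] {X : I → Type*}
    [∀ i, AddCommGroup (X i)] [∀ i, Module S (X i)] {l : ℕ} (hl : l ≠ 0) {n : I → ℕ}
    (hn : ∀ i, n i ≠ 0) (hX : ∀ i, Nonempty ((Fin l → X i) ≃ₗ[S] (Fin (n i) → S)))
    (hblock : ∀ b : Fin l → I, (∀ j j', (n (b j) : ZMod l) = n (b j')) →
      ∃ r ≠ 0, Nonempty ((∀ j, X (b j)) ≃ₗ[S] (Fin r → S))) :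
    Module.Free S (Π₀ i, X i) := by
  have : NeZero l := ⟨hl⟩
  obtain ⟨φ, hφ, c, hc⟩ := exists_injective_prod_constant (fun i => (n i : ZMod l)) hl
  choose r hr e using fun i => hblock (fun j => φ (i, j)) fun j j' => (hc _).trans (hc _).symm
  obtain ⟨f, hf⟩ := exists_surjective_dfinsupp_pi (S := S) X hφ
  obtain ⟨e₃⟩ := nonempty_dfinsupp_pi_linearEquiv (S := S) fun i (j : Fin l) => X (φ (i, j))
  obtain ⟨e₄⟩ := nonempty_dfinsupp_linearEquiv_finsupp (S := S) hr
  let e₅ : (∀ j, Π₀ i, X (φ (i, j))) ≃ₗ[S] (I →₀ S) :=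
    e₃.symm.trans ((DFinsupp.mapRange.linearEquiv fun i => (e i).some).trans e₄)
  obtain ⟨e₁⟩ := nonempty_prod_linearEquiv_of_surjective (e₅.toLinearMap ∘ₗ f)
    (e₅.surjective.comp hf)
  obtain ⟨e₆⟩ := nonempty_dfinsupp_pi_linearEquiv (S := S) fun i (_ : Fin l) => X i
  obtain ⟨e₇⟩ := nonempty_dfinsupp_linearEquiv_finsupp (S := S) hn
  obtain ⟨e₈⟩ := nonempty_linearEquiv_finsupp_of_swindle hl e₁
    (e₆.symm.trans ((DFinsupp.mapRange.linearEquiv fun i => (hX i).some).trans e₇))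
  exact Module.Free.of_equiv e₈.symm

end Swindle

/-! ### The conclusions for locally finite objects. -/

section LocallyFiniteObjects

variable {k H R M Z : Type*} [Field k] [Ring H] [HopfAlgebra k H] [Ring R] [Nontrivial R]
  [AddCommGroup M] [Module R M] [CommRing Z] [Algebra Z R] {σ : H →+* AddMonoid.End R}

/-- A sum of `l` equal residues modulo `l` vanishes, so `∑ n j = l * r`. Dividing the length
identities by `l` gives the exact ratio `r` at every `Q`. -/
theorem exists_isLocallyFreeOfRank_block (hR : HasLocalIdeals R Z)
    (hZ : Function.Injective (algebraMap Z R)) (hσ : IsSimpleAction k σ)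
    {C : Fin (lengthGcd R) → Type*} [∀ j, AddCommGroup (C j)] [∀ j, Module R (C j)]
    [∀ j, Module.Finite R (C j)] (hC : ∀ j, IsHopfObject k σ (C j))
    {n : Fin (lengthGcd R) → ℕ} (hn0 : ∀ j, n j ≠ 0)
    (hn : ∀ j, IsLocallyFreeOfRank R Z (Fin (lengthGcd R) → C j) (n j))
    (hmod : ∀ j j', (n j : ZMod (lengthGcd R)) = n j') :
    ∃ r ≠ 0, IsLocallyFreeOfRank R Z (∀ j, C j) r := by
  have hl := lengthGcd_ne_zero hR hZ
  let j₀ : Fin (lengthGcd R) := ⟨0, hl.bot_lt⟩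
  obtain ⟨r, hr⟩ : lengthGcd R ∣ ∑ j, n j := by
    rw [← ZMod.natCast_eq_zero_iff, Nat.cast_sum, Finset.sum_congr rfl fun j _ => hmod j j₀]
    simp
  have hr0 : r ≠ 0 := by
    rintro rfl
    rw [mul_zero, Finset.sum_eq_zero_iff] at hr
    exact hn0 j₀ (hr j₀ (Finset.mem_univ _))
  obtain ⟨ρ, hρ⟩ := IsHopfObject.pi hC
  have hlen : ∀ Q : Ideal R, IsMaximalTwoSided Q →
      Module.length R ((∀ j, C j) ⧸ Q • (⊤ : Submodule R (∀ j, C j))) =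
        r * Module.length R (R ⧸ Q) := fun Q hQ => by
    obtain ⟨a, ha⟩ := ENat.ne_top_iff_exists.1 (hR.length_ne_top hQ)
    choose c hc using fun j =>
      ENat.ne_top_iff_exists.1 (hR.length_quotient_ne_top (M := C j) hQ)
    have h1 : ∀ j, lengthGcd R * c j = n j * a := fun j => by
      have := (hn j).length_eq hR hQ
      rw [length_quotient_pi, ← hc, ← ha] at this
      exact_mod_cast this
    rw [length_quotient_piDep, ← ha, ← Finset.sum_congr rfl fun j _ => hc j]
    have h2 : ∑ j, c j = r * a := by
      refine Nat.eq_of_mul_eq_mul_left hl.bot_lt ?_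
      rw [Finset.mul_sum, Finset.sum_congr rfl fun j _ => h1 j, ← Finset.sum_mul, hr, mul_assoc]
    exact_mod_cast h2
  obtain ⟨Q₀, hQ₀⟩ := hR.exists_isMaximalTwoSided hZ
  exact ⟨r, hr0, isLocallyFreeOfRank_of_forall_length_eq hR hσ hρ hQ₀ (hlen Q₀ hQ₀)
    fun Q hQ => (hlen Q hQ).le⟩

variable {ρ : H →+* AddMonoid.End M}

theorem projective_of_locallyFinite (hR : HasLocalIdeals R Z)
    (hZ : Function.Injective (algebraMap Z R)) (hσ : IsSimpleAction k σ)
    (hρ : IsEquivariant k σ ρ)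
    (hfin : ∀ x : M, ∃ N : Submodule R M, N.FG ∧ (∀ h, ∀ x ∈ N, ρ h x ∈ N) ∧ x ∈ N) :
    Module.Projective R M := by
  obtain ⟨I, C, ⟨_, hC⟩, h⟩ := exists_isInternal_isHopfObject hR hZ hσ hρ hfin
  have : ∀ i, Module.Projective R (C i) := fun i => by
    obtain ⟨_, _, hi⟩ := h i
    exact projective_of_isHopfObject hR hZ hσ hi
  have : Module.Projective R (DirectSum I fun i => C i) :=
    inferInstanceAs (Module.Projective R (Π₀ i, C i))
  exact Module.Projective.of_equiv (LinearEquiv.ofBijective (DirectSum.coeLinearMap C) hC)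

theorem traceIdeal_eq_top_of_locallyFinite [Nontrivial M] (hR : HasLocalIdeals R Z)
    (hZ : Function.Injective (algebraMap Z R)) (hσ : IsSimpleAction k σ)
    (hρ : IsEquivariant k σ ρ)
    (hfin : ∀ x : M, ∃ N : Submodule R M, N.FG ∧ (∀ h, ∀ x ∈ N, ρ h x ∈ N) ∧ x ∈ N) :
    traceIdeal R M = ⊤ := by
  obtain ⟨I, C, ⟨_, hC⟩, h⟩ := exists_isInternal_isHopfObject hR hZ hσ hρ hfin
  have hI : Nonempty I := by
    by_contra hI
    rw [not_nonempty_iff] at hI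
    have h1 : (⊤ : Submodule R M) = ⊥ := by rw [← hC.submodule_iSup_eq_top, iSup_of_empty]
    exact top_ne_bot h1
  obtain ⟨i⟩ := hI
  obtain ⟨_, _, hi⟩ := h i
  let e := LinearEquiv.ofBijective (DirectSum.coeLinearMap C) hC
  refine top_le_iff.1 ((traceIdeal_eq_top_of_isHopfObject hR hZ hσ hi).ge.trans
    (traceIdeal_mono (DirectSum.component R I (fun i => C i) i ∘ₗ e.symm.toLinearMap) fun y => ?_))
  exact ⟨e (DirectSum.lof R I (fun i => C i) i y), by simp⟩

variable (p : Ideal Z) [p.IsPrime]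

theorem free_locAt_pi_of_locallyFinite (hR : HasLocalIdeals R Z)
    (hZ : Function.Injective (algebraMap Z R)) (hσ : IsSimpleAction k σ)
    (hρ : IsEquivariant k σ ρ)
    (hfin : ∀ x : M, ∃ N : Submodule R M, N.FG ∧ (∀ h, ∀ x ∈ N, ρ h x ∈ N) ∧ x ∈ N) :
    Module.Free (LocAt R p R) (LocAt R p (Fin (lengthGcd R) → M)) := by
  obtain ⟨I, C, ⟨_, hC⟩, h⟩ := exists_isInternal_isHopfObject hR hZ hσ hρ hfin
  choose hf _ ρ' hρ' using h
  choose n hn using fun i => exists_isLocallyFreeOfRank_pi hR hZ hσ (hρ' i)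
  obtain ⟨e₁⟩ := nonempty_locAt_pi_linearEquiv (R := R) p (Fin (lengthGcd R)) fun _ => M
  obtain ⟨e₂⟩ := nonempty_locAt_linearEquiv_dfinsupp p hC
  obtain ⟨e₃⟩ := nonempty_dfinsupp_pi_linearEquiv (S := LocAt R p R)
    fun i (_ : Fin (lengthGcd R)) => LocAt R p (C i)
  have e₄ := fun i => nonempty_locAt_pi_linearEquiv (R := R) p (Fin (lengthGcd R)) fun _ => C i
  have e₅ := fun i => (hn i).nonempty_linearEquiv (p := p)
  exact Module.Free.of_equiv (e₁.trans <| (LinearEquiv.piCongrRight fun _ => e₂).trans <|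
    e₃.symm.trans <| DFinsupp.mapRange.linearEquiv fun i => (e₄ i).some.symm.trans (e₅ i).some).symm

theorem free_locAt_of_not_finite (hR : HasLocalIdeals R Z)
    (hZ : Function.Injective (algebraMap Z R)) (hσ : IsSimpleAction k σ)
    (hρ : IsEquivariant k σ ρ)
    (hfin : ∀ x : M, ∃ N : Submodule R M, N.FG ∧ (∀ h, ∀ x ∈ N, ρ h x ∈ N) ∧ x ∈ N)
    (hM : ¬ Module.Finite R M) : Module.Free (LocAt R p R) (LocAt R p M) := by
  obtain ⟨I, C, ⟨_, hC⟩, h⟩ := exists_isInternal_isHopfObject hR hZ hσ hρ hfin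
  have hf : ∀ i, Module.Finite R (C i) := fun i => (h i).1
  have hI : Infinite I := by
    refine not_finite_iff_infinite.1 fun hI => hM ?_
    have : Module.Finite R (Π₀ i, C i) := inferInstance
    have : Module.Finite R (DirectSum I fun i => C i) := this
    exact Module.Finite.equiv (LinearEquiv.ofBijective (DirectSum.coeLinearMap C) hC)
  choose n hn0 hn using fun i => by
    obtain ⟨_, _, hi⟩ := h i
    exact exists_isLocallyFreeOfRank_pi_pos hR hZ hσ hi
  obtain ⟨e₁⟩ := nonempty_locAt_linearEquiv_dfinsupp p hC
  have hfree : Module.Free (LocAt R p R) (Π₀ i, LocAt R p (C i)) := by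
    refine free_dfinsupp_of_blocks (lengthGcd_ne_zero hR hZ) hn0 (fun i => ?_) fun b hb => ?_
    · obtain ⟨e₂⟩ := nonempty_locAt_pi_linearEquiv (R := R) p (Fin (lengthGcd R)) fun _ => C i
      obtain ⟨e₃⟩ := (hn i).nonempty_linearEquiv (p := p)
      exact ⟨e₂.symm.trans e₃⟩
    · obtain ⟨r, hr, hB⟩ := exists_isLocallyFreeOfRank_block hR hZ hσ (C := fun j => C (b j))
        (fun j => (h (b j)).2.2) (fun j => hn0 (b j)) (fun j => hn (b j)) hb
      obtain ⟨e₂⟩ := nonempty_locAt_pi_linearEquiv (R := R) p (Fin (lengthGcd R)) fun j => C (b j)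
      obtain ⟨e₃⟩ := hB.nonempty_linearEquiv (p := p)
      exact ⟨r, hr, ⟨e₂.symm.trans e₃⟩⟩
  exact Module.Free.of_equiv e₁.symm

end LocallyFiniteObjects

/-! ### Translation from module algebras to `R = Aᵐᵒᵖ`, and the theorem. -/

section FromModuleAlgebras

open MulOpposite TensorProduct Coalgebra

variable {k H A M : Type*} [Field k] [Ring H] [HopfAlgebra k H] [Ring A] [Algebra k A]
  [Module H A]

theorem IsModuleAlgebra.isHopfModule (hA : IsModuleAlgebra k H A) :
    IsHopfModule k H A Aᵐᵒᵖ where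
  smul_op_smul h 𝓡 v a := by
    change op (h • (unop v * a)) = _
    rw [hA.smul_mul h 𝓡, Finset.op_sum]
    rfl

variable [IsScalarTower k H A]

/-- Any expansion of `Δ h` evaluates the same bilinear map `B`, so the one given by the
multiplicative matrix may be used. -/
theorem IsHopfModule.isEquivariant [AddCommGroup M] [Module k M] [Module H M]
    [IsScalarTower k H M] [Module Aᵐᵒᵖ M] [IsScalarTower k Aᵐᵒᵖ M] (hM : IsHopfModule k H A M) :
    IsEquivariant k (Module.toAddMonoidEnd H Aᵐᵒᵖ) (Module.toAddMonoidEnd H M) := by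
  intro d t ht i j r x
  obtain ⟨a, rfl⟩ := op_surjective r
  have : SMulCommClass k Aᵐᵒᵖ M := IsScalarTower.to_smulCommClass
  let B : H →ₗ[k] H →ₗ[k] M := LinearMap.mk₂ k (fun x' y => op (y • a) • x' • x)
    (fun _ _ _ => by rw [add_smul, smul_add])
    (fun c x' y => by rw [smul_assoc, smul_comm])
    (fun _ _ _ => by rw [add_smul, op_add, add_smul])
    (fun c x' y => by rw [smul_assoc, op_smul, smul_assoc])
  have h1 : ∀ h : H, h • op a • x = TensorProduct.lift B (comul (R := k) h) := fun h => by
    rw [hM.smul_op_smul h (Coalgebra.Repr.arbitrary k h), ← (Coalgebra.Repr.arbitrary k h).eq, map_sum]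
    rfl
  change t i j • op a • x = ∑ l, op (t l j • a) • t i l • x
  rw [h1, ht.comul, map_sum]
  rfl

theorem exists_twoSidedIdeal_mem_iff (Q : Ideal Aᵐᵒᵖ) [Q.IsTwoSided] :
    ∃ I : TwoSidedIdeal A, ∀ a, a ∈ I ↔ op a ∈ Q :=
  ⟨TwoSidedIdeal.mk' {a | op a ∈ Q} Q.zero_mem Q.add_mem Q.neg_mem
    (fun {x _} hy => Q.mul_mem_right (op x) hy) (fun {_ y} hx => Q.mul_mem_left (op y) hx), fun _ =>
    TwoSidedIdeal.mem_mk' ..⟩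

theorem IsModuleAlgebra.isSimpleAction (hA : IsModuleAlgebra k H A) (hs : IsHSimple H A) :
    IsSimpleAction k (Module.toAddMonoidEnd H Aᵐᵒᵖ) where
  one d t ht i j := by
    change op (t i j • (1 : A)) = _
    rw [hA.smul_one, ht.counit]
    split_ifs <;> simp
  equivariant := hA.isHopfModule.isEquivariant
  simple Q hQ hQ' a ha := by
    obtain ⟨a, rfl⟩ := op_surjective a
    have hall : ∀ h : H, op (h • a) ∈ Q := fun h => by
      obtain ⟨d, t, ht, c, rfl⟩ := exists_isComatrix (k := k) h
      simp only [Finset.sum_smul, Finset.op_sum, smul_assoc, op_smul]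
      refine Q.sum_mem fun i _ => Q.sum_mem fun j _ => ?_
      rw [Algebra.smul_def]
      exact Q.mul_mem_left _ (ha ht i j)
    have hmul : ∀ b c : A, (∀ h : H, op (h • b) ∈ Q) ∨ (∀ h : H, op (h • c) ∈ Q) →
        ∀ h : H, op (h • (b * c)) ∈ Q := fun b c hbc h => by
      rw [hA.smul_mul h (Coalgebra.Repr.arbitrary k h), Finset.op_sum]
      refine Q.sum_mem fun i _ => ?_
      rw [op_mul]
      exact hbc.elim (fun hb => Q.mul_mem_left _ (hb _)) fun hc => Q.mul_mem_right _ (hc _)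
    -- The largest `H`-stable two-sided ideal inside `Q`. It contains `a`, and it is proper since
    -- `Q` is.
    let I : TwoSidedIdeal A := TwoSidedIdeal.mk' {b | ∀ h : H, op (h • b) ∈ Q}
      (fun h => by rw [smul_zero]; exact Q.zero_mem)
      (fun hx hy h => by rw [smul_add]; exact Q.add_mem (hx h) (hy h))
      (fun hx h => by rw [smul_neg]; exact Q.neg_mem (hx h))
      (fun hy => hmul _ _ (Or.inr hy)) (fun hx => hmul _ _ (Or.inl hx))
    have hI : ∀ b, b ∈ I ↔ ∀ h : H, op (h • b) ∈ Q := fun b => TwoSidedIdeal.mem_mk' ..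
    rcases hs I fun h b hb => (hI _).2 fun h' => by
      rw [← mul_smul]
      exact (hI b).1 hb _ with h | h
    · have h1 := (hI a).2 hall
      rw [h, TwoSidedIdeal.mem_bot] at h1
      rw [h1, op_zero]
    · have h1 : (1 : A) ∈ I := h ▸ trivial
      have h2 := (hI 1).1 h1 1
      rw [one_smul] at h2
      exact absurd ((Ideal.eq_top_iff_one Q).2 h2) hQ'

variable {Z : Type*} [CommRing Z] [Algebra Z A]

/-- A left inverse `u` of `1 - x` itself has a left inverse, which must be `1 - x`. The right
inverse is the side that becomes left in the opposite ring. -/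
theorem exists_mul_eq_one_of_mem_jacobson {S : Type*} [Ring S] {x : S} (hx : x ∈ Ring.jacobson S) :
    ∃ u, (1 - x) * u = 1 := by
  rw [← Ideal.jacobson_bot] at hx
  obtain ⟨u, hu⟩ := Ideal.mem_jacobson_iff.1 hx (-1)
  have h1 : u * (1 - x) = 1 := by
    rw [Ideal.mem_bot, sub_eq_zero] at hu
    refine Eq.trans ?_ hu
    noncomm_ring
  obtain ⟨v, hv⟩ := Ideal.mem_jacobson_iff.1 hx u
  have h2 : v * u = 1 := by
    rw [Ideal.mem_bot, sub_eq_zero] at hv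
    have h3 : u = 1 + u * x := by
      rw [mul_sub, mul_one, sub_eq_iff_eq_add] at h1
      exact h1
    rw [← hv]
    conv_lhs => rw [h3]
    noncomm_ring
  have h4 : v = 1 - x := by
    calc v = v * (u * (1 - x)) := by rw [h1, mul_one]
      _ = 1 - x := by rw [← mul_assoc, h2, one_mul]
  exact ⟨u, h4 ▸ h2⟩

/-- The local ideal is the preimage of `Jac(A_m)`. As `m` maps into the radical, each denominator
has an inverse coming from `Z` modulo the radical, so `A → A_m / Jac(A_m)` is onto and the quotient
of `Aᵐᵒᵖ` is the opposite of a semisimple ring. -/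
theorem HasSemilocalLocalizations.hasLocalIdeals (h : HasSemilocalLocalizations Z A) :
    HasLocalIdeals Aᵐᵒᵖ Z := by
  intro m hm
  obtain ⟨hart, hmap⟩ := h m
  have : IsArtinianRing (LocAt A m A ⧸ Ring.jacobson (LocAt A m A)) := hart
  have hss : IsSemisimpleRing (LocAt A m A ⧸ Ring.jacobson (LocAt A m A)) :=
    IsArtinianRing.isSemisimpleRing_iff_jacobson.2 (Ring.jacobson_quotient_jacobson _)
  let ν : A →+* LocAt A m A := OreLocalization.numeratorRingHom
  have hν : IsCentralLocalization m (LocAt.numerator A m A) := isCentralLocalization_numerator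
  have hνz : ∀ (z : Z) (x : LocAt A m A), algebraMap Z A z • x = ν (algebraMap Z A z) * x :=
    fun z x => (oreDiv_smul_numerator m (algebraMap Z A z) x).symm
  have hmJ : ∀ z ∈ m, ν (algebraMap Z A z) ∈ Ring.jacobson (LocAt A m A) := fun z hz =>
    hmap (Ideal.mem_map_of_mem (LocAt.ofCentral A m) hz)
  let ψ : A →+* LocAt A m A ⧸ Ring.jacobson (LocAt A m A) := (Ideal.Quotient.mk _).comp ν
  have hψ : Function.Surjective ψ := fun y => by
    obtain ⟨x, rfl⟩ := Ideal.Quotient.mk_surjective y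
    obtain ⟨z, hz, a, ha⟩ := hν.exists_eq x
    obtain ⟨w, hw⟩ := Ideal.exists_mul_sub_one_mem hm hz
    refine ⟨algebraMap Z A w * a, Ideal.Quotient.eq.2 ?_⟩
    have h1 : ν a = ν (algebraMap Z A z) * x := by rw [← hνz, ha]; rfl
    have h2 : ν (algebraMap Z A w * a) - x = ν (algebraMap Z A (w * z - 1)) * x := by
      simp only [map_mul, map_sub, map_one, h1, sub_mul, one_mul, mul_assoc]
    rw [h2]
    exact Ideal.mul_mem_right _ _ (hmJ _ hw)
  let ψ' : Aᵐᵒᵖ →+* (LocAt A m A ⧸ Ring.jacobson (LocAt A m A))ᵐᵒᵖ := RingHom.op ψ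
  have hψ' : Function.Surjective ψ' := fun y => by
    obtain ⟨a, ha⟩ := hψ (unop y)
    exact ⟨op a, unop_injective ha⟩
  have hmem : ∀ a : A, op a ∈ RingHom.ker ψ' ↔ ν a ∈ Ring.jacobson (LocAt A m A) := fun a => by
    rw [RingHom.mem_ker, ← Ideal.Quotient.eq_zero_iff_mem]
    exact op_eq_zero_iff _
  refine ⟨RingHom.ker ψ', inferInstance, ⟨fun z hz => (hmem _).2 (hmJ z hz), fun a ha => ?_, ?_⟩⟩
  · obtain ⟨a, rfl⟩ := op_surjective a
    obtain ⟨u, hu⟩ := exists_mul_eq_one_of_mem_jacobson ((hmem a).1 ha)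
    obtain ⟨z, hz, c, hc⟩ := hν.exists_eq u
    have h1 : ν c = ν (algebraMap Z A z) * u := by rw [← hνz, hc]; rfl
    have h2 : ν ((1 - a) * c - algebraMap Z A z) = 0 := by
      rw [map_sub, map_mul, map_sub, map_one, h1, ← mul_assoc, ← map_one ν, ← map_sub, ← map_mul,
        ← Algebra.commutes, map_mul, mul_assoc, map_sub, map_one, hu, mul_one, sub_self]
    obtain ⟨w, hw, hwz⟩ := hν.exists_smul_eq_zero _ h2
    refine ⟨op (algebraMap Z A w * c), w * z, fun h => (hm.isPrime.mem_or_mem h).elim hw hz, ?_⟩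
    apply unop_injective
    change (1 - a) * (algebraMap Z A w * c) = algebraMap Z A (w * z)
    rw [smul_eq_mul, mul_sub, sub_eq_zero, ← map_mul, ← mul_assoc, Algebra.commutes, mul_assoc] at hwz
    rw [← hwz]
  · exact (RingHom.quotientKerEquivOfSurjective hψ').symm.isSemisimpleRing

theorem isMaximalTwoSided_asIdealOpposite {Q : TwoSidedIdeal A} (hQ : IsCoatom Q) :
    IsMaximalTwoSided (TwoSidedIdeal.asIdealOpposite Q) where
  isTwoSided := ⟨fun {a} b ha => by
    rw [TwoSidedIdeal.mem_asIdealOpposite, unop_mul] at *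
    exact Q.mul_mem_left _ _ ha⟩
  ne_top h := hQ.1 <| by
    have h1 : (1 : Aᵐᵒᵖ) ∈ TwoSidedIdeal.asIdealOpposite Q := h ▸ Submodule.mem_top
    rw [TwoSidedIdeal.mem_asIdealOpposite, unop_one] at h1
    exact (TwoSidedIdeal.one_mem_iff Q).1 h1
  le_of_le I hI hne hle := by
    obtain ⟨J, hJ⟩ := exists_twoSidedIdeal_mem_iff I
    rcases hQ.le_iff.1 (show Q ≤ J from fun a ha => (hJ a).2
      (hle (TwoSidedIdeal.mem_asIdealOpposite.2 ha))) with h | h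
    · exact absurd ((Ideal.eq_top_iff_one I).2 ((hJ 1).1 (h ▸ trivial))) hne
    · intro x hx
      rw [TwoSidedIdeal.mem_asIdealOpposite, ← h, hJ]
      exact hx

theorem gcdLength_eq_lengthGcd : gcdLength A = lengthGcd Aᵐᵒᵖ := by
  unfold gcdLength lengthGcd
  congr 1
  ext n
  constructor
  · rintro ⟨Q, hQ, hn⟩
    exact ⟨_, isMaximalTwoSided_asIdealOpposite hQ, hn⟩
  · rintro ⟨Q, hQ, hn⟩
    have := hQ.isTwoSided
    obtain ⟨I, hI⟩ := exists_twoSidedIdeal_mem_iff Q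
    have hQI : TwoSidedIdeal.asIdealOpposite I = Q := by
      ext x
      rw [TwoSidedIdeal.mem_asIdealOpposite, hI, op_unop]
    refine ⟨I, ⟨fun h => hQ.ne_top ?_, fun J hJ => ?_⟩, by rw [quotientLength, hQI, hn]⟩
    · exact (Ideal.eq_top_iff_one Q).2 ((hI 1).1 (h ▸ trivial))
    · by_contra hne
      refine hJ.not_ge fun a ha => (hI a).2 (hQ.le_of_le (TwoSidedIdeal.asIdealOpposite J) ?_ ?_ ?_
        (TwoSidedIdeal.mem_asIdealOpposite.2 ha))
      · exact ⟨fun {a} b ha => by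
          rw [TwoSidedIdeal.mem_asIdealOpposite, unop_mul] at *
          exact J.mul_mem_left _ _ ha⟩
      · intro h
        have h1 : (1 : Aᵐᵒᵖ) ∈ TwoSidedIdeal.asIdealOpposite J := h ▸ Submodule.mem_top
        rw [TwoSidedIdeal.mem_asIdealOpposite, unop_one] at h1
        exact hne ((TwoSidedIdeal.one_mem_iff J).1 h1)
      · rw [← hQI]
        exact fun x hx => TwoSidedIdeal.mem_asIdealOpposite.2
          (hJ.le (TwoSidedIdeal.mem_asIdealOpposite.1 hx))

theorem free_locAt_of_subsingleton {R : Type*} [Ring R] [Subsingleton R] [Algebra Z R] (p : Ideal Z)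
    [p.IsPrime] (X : Type*) [AddCommGroup X] [Module R X] :
    Module.Free (LocAt R p R) (LocAt R p X) := by
  have hX : Subsingleton X := Module.subsingleton R X
  have : Subsingleton (LocAt R p X) := ⟨fun a b => by
    obtain ⟨x, y, s, rfl, rfl⟩ := exists_common_oreDiv p a b
    rw [Subsingleton.elim x y]⟩
  exact Module.Free.of_subsingleton ..

end FromModuleAlgebras

theorem theorem5p6 {k H A Z M : Type*} [Field k] [Ring H] [HopfAlgebra k H]
    [Ring A] [Algebra k A] [Module H A] [IsScalarTower k H A]
    (hA : IsModuleAlgebra k H A) (hsimple : IsHSimple H A)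
    [CommRing Z] [Algebra Z A] (hZ : Function.Injective (algebraMap Z A))
    (hloc : HasSemilocalLocalizations Z A)
    [AddCommGroup M] [Module k M] [Module H M] [IsScalarTower k H M]
    [Module Aᵐᵒᵖ M] [IsScalarTower k Aᵐᵒᵖ M]
    (hM : IsHopfModule k H A M) (hfin : IsLocallyAFinite H A M) :
    (∀ Q : TwoSidedIdeal A, IsCoatom Q → quotientLength Q ≠ ⊤) ∧
    (Module.Projective Aᵐᵒᵖ M ∧ (Nontrivial M → IsGenerator.{w} Aᵐᵒᵖ M)) ∧
    (∀ (p : Ideal Z) [p.IsPrime],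
      Module.Free (LocAt Aᵐᵒᵖ p Aᵐᵒᵖ) (LocAt Aᵐᵒᵖ p (Fin (gcdLength A) → M))) ∧
    (¬ Module.Finite Aᵐᵒᵖ M → ∀ (p : Ideal Z) [p.IsPrime],
      Module.Free (LocAt Aᵐᵒᵖ p Aᵐᵒᵖ) (LocAt Aᵐᵒᵖ p M)) := by
  have hR : HasLocalIdeals Aᵐᵒᵖ Z := hloc.hasLocalIdeals
  refine ⟨fun Q hQ => hR.length_ne_top (isMaximalTwoSided_asIdealOpposite hQ), ?_⟩
  -- Over the zero ring there are no maximal ideals, but all modules vanish as well.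
  rcases subsingleton_or_nontrivial A with _ | _
  · have : Subsingleton M := Module.subsingleton Aᵐᵒᵖ M
    exact ⟨⟨inferInstance, fun h => absurd h (not_nontrivial M)⟩,
      fun p _ => free_locAt_of_subsingleton p _, fun _ p _ => free_locAt_of_subsingleton p _⟩
  · have hZ' : Function.Injective (algebraMap Z Aᵐᵒᵖ) := fun x y h =>
      hZ (MulOpposite.op_injective h)
    have hσ := hA.isSimpleAction hsimple
    have hρ := hM.isEquivariant
    obtain ⟨F, -, hF, hcov⟩ := hfin
    have hfin' : ∀ x : M, ∃ N : Submodule Aᵐᵒᵖ M, N.FG ∧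
        (∀ h, ∀ x ∈ N, Module.toAddMonoidEnd H M h x ∈ N) ∧ x ∈ N := fun x => by
      obtain ⟨N, hN, hx⟩ := hcov x
      exact ⟨N, (hF N hN).1, (hF N hN).2, hx⟩
    rw [gcdLength_eq_lengthGcd]
    exact ⟨⟨projective_of_locallyFinite hR hZ' hσ hρ hfin', fun _ =>
        isGenerator_of_traceIdeal_eq_top (traceIdeal_eq_top_of_locallyFinite hR hZ' hσ hρ hfin')⟩,
      fun p _ => free_locAt_pi_of_locallyFinite p hR hZ' hσ hρ hfin',
      fun hnf p _ => free_locAt_of_not_finite p hR hZ' hσ hρ hfin' hnf⟩
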